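/- Let $N$ be a connected, orientable smooth manifold (Hausdorff, second countable) of dimension $n$, let $p+q=n$, let $M\to N$ be the bundle of pseudo-Riemannian metrics of signature $(p,q)$ and $C\to N$ the bundle of linear connections on $N$, and put $E=M\times_N C$. Coordinates $(x^i)$ on $N$ induce fibred coordinates $(x^i,y_{ij},A^i_{jk})$ on $E$ (components of the metric and Christoffel symbols), written $(x^i,y^\alpha)$ for short, and coordinates $(x^i,y^\alpha,y^\alpha_i)$ on the first jet bundle $J^1E$. For a smooth vector field $X$ on $N$ let $\bar X$ be its natural lift to $E$ and $\bar X^{(1)}$ the first jet prolongation of $\bar X$ to $J^1E$. A first-order Lagrangian density is a smooth horizontal $n$-form $\Lambda$ on $J^1E$, locally $\Lambda=L\,dx^1\wedge\cdots\wedge dx^n$. A horizontal $n$-form on $J^1E$ is called $\mathfrak X(N)$-invariant if its Lie derivative along $\bar X^{(1)}$ vanishes for every smooth vector field $X$ on $N$. An Ehresmann connection on $E\to N$ is a smooth $1$-form $\gamma$ on $E$ with values in the vertical bundle $V(E\to N)$ which is the identity on vertical vectors; locally $\gamma=(dy^\alpha+\gamma^\alpha_j\,dx^j)\otimes\partial/\partial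 y^\alpha$. It defines the vertical vector field $$D^\gamma=(\gamma^\alpha_i+y^\alpha_i)\frac{\partial}{\partial y^\alpha_i}$$ on $J^1E$ and, for every $\Lambda$, the covariant Hamiltonian, locally $$\Lambda^\gamma=\Bigl((\gamma^\alpha_i+y^\alpha_i)\frac{\partial L}{\partial y^\alpha_i}-L\Bigr)dx^1\wedge\cdots\wedge dx^n .$$ The connection $\gamma$ has property (P) if $\Lambda^\gamma$ is $\mathfrak X(N)$-invariant for every $\mathfrak X(N)$-invariant first-order Lagrangian density $\Lambda$ on $J^1E$. The invariance distribution is $$\mathcal D_z=\{\bar X^{(1)}_z : X\in\mathfrak X(N)\}\subseteq T_z(J^1E),\qquad z\in J^1E,$$ and $\Gamma(\mathcal D)$ denotes the set of smooth vector fields $Y$ on $J^1E$ with $Y_z\in\mathcal D_z$ for all $z$. Then, for every Ehresmann connection $\gamma$ on $E=M\times_N C$, property (P) holds for $\gamma$ if and only if $[D^\gamma,\Gamma(\mathcal D)]\subseteq\Gamma(\mathcal D)$. -/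

import Mathlib

open scoped Manifold ContDiff

/-! # Coordinate models

`N` is an `n`-dimensional manifold, `M → N` the bundle of pseudo-Riemannian metrics of signature
`(p, q)` and `C → N` the bundle of linear connections.  A coordinate system on `N` induces
coordinates on `M ×_N C` and on `J¹(M ×_N C)`; these bundles are the manifolds glued from the
corresponding coordinate domains along the induced coordinate changes. Smooth objects on them
(functions, forms, vector fields, Ehresmann connections) are given, as usual, by smooth local
expressions in all coordinate systems which correspond to each other under coordinate changes. -/

section Models

/-- The coordinate space `ℝⁿ` of `N`. -/
abbrev Base (n : ℕ) : Type := EuclideanSpace ℝ (Fin n)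

/-- The partial derivative `∂f/∂xⁱ` at `x`. -/
noncomputable def pd {n : ℕ} {F : Type*} [NormedAddCommGroup F] [NormedSpace ℝ F]
    (i : Fin n) (f : Base n → F) (x : Base n) : F :=
  fderiv ℝ f x (EuclideanSpace.single i 1)

/-- Coordinates `y_{ij} = y_{ji}` on the fibres of the bundle of symmetric bilinear forms. -/
abbrev SymForm (n : ℕ) : Type := Sym2 (Fin n) → ℝ

/-- Coordinates on the fibres of `C`: the Christoffel symbols, `A i j k` being the component
`A^i_{jk}` of `∇_{∂_j} ∂_k` along `∂_i`. -/
abbrev ConnForm (n : ℕ) : Type := Fin n → Fin n → Fin n → ℝ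

/-- Coordinates on the fibres of `M ×_N C`. -/
abbrev Fib (n : ℕ) : Type := SymForm n × ConnForm n

/-- Coordinates `(x, (y, A))` on `E = M ×_N C`. -/
abbrev ECoord (n : ℕ) : Type := Base n × Fib n

/-- Coordinates on `J¹E`: `x`, `(y, A)` and, for each `k`, the derivatives
`(y_{ij,k}, A^h_{ij,k})` with respect to `x^k` at `x` of the local expression of a section. -/
abbrev JCoord (n : ℕ) : Type := Base n × Fib n × (Fin n → Fib n)

/-- The projection `J¹E → E` in coordinates. -/
def JCoord.toE {n : ℕ} (z : JCoord n) : ECoord n := (z.1, z.2.1)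

/-- The value `g(a, b) = y_{ij} a^i b^j`. -/
def SymForm.val {n : ℕ} (g : SymForm n) (a b : Base n) : ℝ :=
  ∑ i, ∑ j, g s(i, j) * a i * b j

/-- `g` has signature `(p, q)`: there is an orthonormal basis with `p` vectors of square `1` and
`q` vectors of square `-1`. -/
def HasSignature {n : ℕ} (p q : ℕ) (g : SymForm n) : Prop :=
  ∃ b : Module.Basis (Fin p ⊕ Fin q) ℝ (Base n),
    (∀ i j, i ≠ j → g.val (b i) (b j) = 0) ∧
    (∀ i, g.val (b (Sum.inl i)) (b (Sum.inl i)) = 1) ∧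
    (∀ i, g.val (b (Sum.inr i)) (b (Sum.inr i)) = -1)

/-- The form with components `g(P_i, P_j)`. -/
def SymForm.pull {n : ℕ} (P : Fin n → Base n) (g : SymForm n) : SymForm n :=
  Sym2.lift ⟨fun i j => g.val (P i) (P j), fun i j => by
    simp only [SymForm.val]
    rw [Finset.sum_comm]
    refine Finset.sum_congr rfl fun r _ => Finset.sum_congr rfl fun s _ => ?_
    rw [Sym2.eq_swap]
    ring⟩

/-- The form with components `∑_h (P^h_i y_{hj} + P^h_j y_{ih})`. -/
def SymForm.infPull {n : ℕ} (P : Fin n → Base n) (g : SymForm n) : SymForm n :=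
  Sym2.lift ⟨fun i j => ∑ h, (P i h * g s(h, j) + P j h * g s(i, h)), fun i j =>
    Finset.sum_congr rfl fun h _ => by
      rw [Sym2.eq_swap (a := h) (b := j), Sym2.eq_swap (a := i) (b := h)]
      ring⟩

end Models

section Charts

/-- Coordinate systems of `N`: the charts of its maximal smooth atlas. -/
abbrev CoordSys (n : ℕ) (N : Type*) [TopologicalSpace N] [ChartedSpace (Base n) N] : Type _ :=
  {e : OpenPartialHomeomorph N (Base n) // e ∈ IsManifold.maximalAtlas (𝓡 n) ∞ N}

variable {n : ℕ} {N : Type*} [TopologicalSpace N] [ChartedSpace (Base n) N]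

/-- The coordinate change of `N` from `e` to `e'`. -/
def transition (e e' : CoordSys n N) (x : Base n) : Base n := e'.1 (e.1.symm x)

/-- The domain, in the coordinates `e`, of the coordinate change from `e` to `e'`. -/
def overlap (e e' : CoordSys n N) : Set (Base n) :=
  {x | x ∈ e.1.target ∧ e.1.symm x ∈ e'.1.source}

/-- Coordinate change on the fibres of `M ×_N C`, over the point with new coordinates `y`. With
`σ` the coordinate change from `e'` to `e` and `τ` its inverse,
`y'_{jk} = ∂_j σ^r ∂_k σ^s y_{rs}` and
`A'^i_{jk} = ∂_l τ^i (∂_j σ^r ∂_k σ^s A^l_{rs} + ∂_j ∂_k σ^l)`. -/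
noncomputable def fibTrans (e e' : CoordSys n N) (y : Base n) (f : Fib n) : Fib n :=
  let σ := transition e' e
  let τ := transition e e'
  (SymForm.pull (fun i => pd i σ y) f.1,
    fun i j k => ∑ l, pd l τ (σ y) i *
      (∑ r, ∑ s, pd j σ y r * pd k σ y s * f.2 l r s + pd j (pd k σ) y l))

/-- Coordinate change on `E = M ×_N C`. -/
noncomputable def eTrans (e e' : CoordSys n N) (w : ECoord n) : ECoord n :=
  (transition e e' w.1, fibTrans e e' (transition e e' w.1) w.2)

/-- The local expression in `e'` of the section of `E` whose local expression in `e` is the affine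
map `x ↦ f + (x^k - x₀^k) S_k`, for `z = (x₀, f, S)`. -/
noncomputable def transportedSection (e e' : CoordSys n N) (z : JCoord n) (y : Base n) : Fib n :=
  fibTrans e e' y (z.2.1 + ∑ k, (transition e' e y k - z.1 k) • z.2.2 k)

/-- Coordinate change on `J¹E`: the `1`-jet of a section goes to the `1`-jet of the section
written in the new coordinates. -/
noncomputable def jTrans (e e' : CoordSys n N) (z : JCoord n) : JCoord n :=
  let y := transition e e' z.1
  (y, transportedSection e e' z y, fun k => pd k (transportedSection e e' z) y)

/-- The coordinate domain of `E = M ×_N C` induced by `e`. -/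
def eDom (p q : ℕ) (e : CoordSys n N) : Set (ECoord n) :=
  {w | w.1 ∈ e.1.target ∧ HasSignature p q w.2.1}

/-- The coordinate domain of `J¹E` induced by `e`. -/
def jDom (p q : ℕ) (e : CoordSys n N) : Set (JCoord n) :=
  {z | z.toE ∈ eDom p q e}

variable (n N) in
/-- `N` is orientable: it carries a nowhere vanishing smooth `n`-form, with local expressions
`v e dx¹ ∧ ⋯ ∧ dxⁿ`. -/
def IsOrientable : Prop :=
  ∃ v : CoordSys n N → Base n → ℝ,
    (∀ e, ContDiffOn ℝ ∞ (v e) e.1.target) ∧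
    (∀ e, ∀ x ∈ e.1.target, v e x ≠ 0) ∧
    ∀ e e', ∀ x ∈ overlap e e',
      v e' (transition e e' x) * (fderiv ℝ (transition e e') x).det = v e x

end Charts

section VectorFields

variable {n : ℕ} {N : Type*} [TopologicalSpace N] [ChartedSpace (Base n) N]

/-- Local expressions on the coordinate domains of `J¹E` which define a smooth vector field. -/
def IsVectorFieldOnJet (p q : ℕ) (Y : CoordSys n N → JCoord n → JCoord n) : Prop :=
  (∀ e, ContDiffOn ℝ ∞ (Y e) (jDom p q e)) ∧
  ∀ e e', ∀ z ∈ jDom p q e, z.1 ∈ overlap e e' →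
    fderiv ℝ (jTrans e e') z (Y e z) = Y e' (jTrans e e' z)

/-- Lie bracket of vector fields on `J¹E`, in coordinates. -/
noncomputable def jetBracket (Y W : CoordSys n N → JCoord n → JCoord n) :
    CoordSys n N → JCoord n → JCoord n :=
  fun e => VectorField.lieBracket ℝ (Y e) (W e)

/-- The local expression `u = (u¹, …, uⁿ)` of a vector field `X` on `N`. -/
noncomputable def localExpr (X : (x : N) → TangentSpace (𝓡 n) x) (e : CoordSys n N)
    (x : Base n) : Base n :=
  mfderiv (𝓡 n) 𝓘(ℝ, Base n) e.1 (e.1.symm x) (X (e.1.symm x))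

/-- Fibre component of the natural lift to `M ×_N C` of the vector field `u` of `ℝⁿ`:
`v_{ij} = - ∂_i u^h y_{hj} - ∂_j u^h y_{ih}` and
`w^i_{jk} = - ∂_j ∂_k u^i + ∂_l u^i A^l_{jk} - ∂_k u^l A^i_{jl} - ∂_j u^l A^i_{lk}`. -/
noncomputable def liftFib (u : Base n → Base n) (w : ECoord n) : Fib n :=
  let P := fun i => pd i u w.1
  let A := w.2.2
  (-(SymForm.infPull P w.2.1),
    fun i j k => -(pd j (pd k u) w.1 i)
      + ∑ l, (P l i * A l j k - P k l * A i j l - P j l * A i l k))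

/-- First jet prolongation of the vector field `u^i ∂/∂x^i + v^α ∂/∂y^α` of `E`, `u` depending
only on `x`:  the component along `∂/∂y^α_i` is
`∂v^α/∂x^i + y^β_i ∂v^α/∂y^β - y^α_k ∂u^k/∂x^i`. -/
noncomputable def prolong (u : Base n → Base n) (v : ECoord n → Fib n) (z : JCoord n) :
    JCoord n :=
  (u z.1, v z.toE, fun i =>
    fderiv ℝ v z.toE (EuclideanSpace.single i 1, z.2.2 i) - ∑ k, pd i u z.1 k • z.2.2 k)

/-- The vector field `X̄⁽¹⁾` on `J¹(M ×_N C)`: the prolongation of the natural lift of the vector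
field `X` of `N`. -/
noncomputable def jetLift (X : (x : N) → TangentSpace (𝓡 n) x) (e : CoordSys n N) :
    JCoord n → JCoord n :=
  prolong (localExpr X e) (liftFib (localExpr X e))

/-- `X` is a smooth vector field on `N`. -/
def IsSmoothVectorField [IsManifold (𝓡 n) ∞ N] (X : (x : N) → TangentSpace (𝓡 n) x) : Prop :=
  ContMDiff (𝓡 n) (𝓡 n).tangent ∞ (fun x => (⟨x, X x⟩ : TangentBundle (𝓡 n) N))

/-- The invariance distribution `𝒟` on `J¹(M ×_N C)`: at each point, the values of all `X̄⁽¹⁾`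
with `X` a smooth vector field on `N`. -/
def invDistribution [IsManifold (𝓡 n) ∞ N] (e : CoordSys n N) (z : JCoord n) :
    Set (JCoord n) :=
  {V | ∃ X : (x : N) → TangentSpace (𝓡 n) x, IsSmoothVectorField X ∧ V = jetLift X e z}

variable (n N) in
/-- `Γ(𝒟)`: the smooth vector fields on `J¹(M ×_N C)` with values in `𝒟`. -/
def sectionsInvDistribution [IsManifold (𝓡 n) ∞ N] (p q : ℕ) :
    Set (CoordSys n N → JCoord n → JCoord n) :=
  {Y | IsVectorFieldOnJet p q Y ∧ ∀ e, ∀ z ∈ jDom p q e, Y e z ∈ invDistribution e z}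

end VectorFields

section Hamiltonian

variable {n : ℕ} {N : Type*} [TopologicalSpace N] [ChartedSpace (Base n) N]

variable (n N) in
/-- An Ehresmann connection on `E = M ×_N C`: a smooth differential `1`-form on `E` with values
in the vertical bundle, which is the identity on vertical vectors. A vertical
vector is `(0, f)` in coordinates, and `form e w` gives its component `f`. -/
structure EhresmannConnection (p q : ℕ) where
  /-- The local expression `(dy^α + γ^α_j dx^j) ⊗ ∂/∂y^α`. -/
  form : CoordSys n N → ECoord n → (ECoord n →L[ℝ] Fib n)
  smooth : ∀ e, ContDiffOn ℝ ∞ (form e) (eDom p q e)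
  vertical : ∀ e, ∀ w ∈ eDom p q e, ∀ f : Fib n, form e w (0, f) = f
  compat : ∀ e e', ∀ w ∈ eDom p q e, w.1 ∈ overlap e e' → ∀ V : ECoord n,
    fderiv ℝ (eTrans e e') w (0, form e w V) =
      (0, form e' (eTrans e e' w) (fderiv ℝ (eTrans e e') w V))

/-- The vertical vector field `D^γ = (γ^α_i + y^α_i) ∂/∂y^α_i` on `J¹E`. -/
noncomputable def EhresmannConnection.vert {p q : ℕ} (γ : EhresmannConnection n N p q)
    (e : CoordSys n N) (z : JCoord n) : JCoord n :=
  (0, 0, fun i => γ.form e z.toE (EuclideanSpace.single i 1, z.2.2 i))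

variable (n N) in
/-- A first-order Lagrangian density on `E`: a smooth horizontal `n`-form `L dx¹ ∧ ⋯ ∧ dxⁿ`
on `J¹E`, with the local functions `L = coeff e`. -/
structure LagrangianDensity (p q : ℕ) where
  coeff : CoordSys n N → JCoord n → ℝ
  smooth : ∀ e, ContDiffOn ℝ ∞ (coeff e) (jDom p q e)
  compat : ∀ e e', ∀ z ∈ jDom p q e, z.1 ∈ overlap e e' →
    coeff e' (jTrans e e' z) * (fderiv ℝ (transition e e') z.1).det = coeff e z

/-- The local functions of the covariant Hamiltonian
`Λ^γ = ((γ^α_i + y^α_i) ∂L/∂y^α_i - L) dx¹ ∧ ⋯ ∧ dxⁿ` of `Λ = L dx¹ ∧ ⋯ ∧ dxⁿ`. -/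
noncomputable def covariantHamiltonian {p q : ℕ} (γ : EhresmannConnection n N p q)
    (Λ : LagrangianDensity n N p q) (e : CoordSys n N) (z : JCoord n) : ℝ :=
  fderiv ℝ (Λ.coeff e) z (γ.vert e z) - Λ.coeff e z

/-- The form `L dx¹ ∧ ⋯ ∧ dxⁿ` on the coordinate space of `J¹E`. -/
noncomputable def horizontalForm (L : JCoord n → ℝ) (z : JCoord n) :
    JCoord n [⋀^Fin n]→ₗ[ℝ] ℝ :=
  L z • (EuclideanSpace.basisFun (Fin n) ℝ).toBasis.det.compLinearMap
    (LinearMap.fst ℝ (Base n) (Fib n × (Fin n → Fib n)))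

/-- The Lie derivative `(L_Y η)_z (V₁, …, V_k)`, in coordinates. -/
noncomputable def lieDerivForm {k : ℕ} (Y : JCoord n → JCoord n)
    (η : JCoord n → JCoord n [⋀^Fin k]→ₗ[ℝ] ℝ) (z : JCoord n) (V : Fin k → JCoord n) : ℝ :=
  fderiv ℝ (fun z' => η z' V) z (Y z)
    + ∑ i, η z (Function.update V i (fderiv ℝ Y z (V i)))

/-- The horizontal `n`-form with local functions `L e` is `𝔛(N)`-invariant: its Lie derivative
along `X̄⁽¹⁾` vanishes for every smooth vector field `X` on `N`. -/
def IsInvariantDensity [IsManifold (𝓡 n) ∞ N] (p q : ℕ)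
    (L : CoordSys n N → JCoord n → ℝ) : Prop :=
  ∀ X : (x : N) → TangentSpace (𝓡 n) x, IsSmoothVectorField X →
    ∀ e, ∀ z ∈ jDom p q e, ∀ V : Fin n → JCoord n,
      lieDerivForm (jetLift X e) (horizontalForm (L e)) z V = 0

/-- Property (P): the covariant Hamiltonian with respect to `γ` of every invariant Lagrangian
density is invariant. -/
def EhresmannConnection.PropertyP [IsManifold (𝓡 n) ∞ N] {p q : ℕ}
    (γ : EhresmannConnection n N p q) : Prop :=
  ∀ Λ : LagrangianDensity n N p q, IsInvariantDensity p q Λ.coeff →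
    IsInvariantDensity p q (covariantHamiltonian γ Λ)

end Hamiltonian

/-! Write `D` for `D^γ`. For an invariant `Λ = L dx` the field `D` is vertical over `N`, so
differentiating the invariance equation of `L` along `D` shows that the Lie derivative of `Λ^γ`
along `X̄⁽¹⁾` is `-dL([D, X̄⁽¹⁾]) dx` (`fderiv_covariantHamiltonian`). Moreover `[D, X̄⁽¹⁾]` is
vertical over `E`, with components `ξ` depending only on the point of `E`
(`EhresmannConnection.lieBracket_vert_prolong`). Everything turns on whether such vectors lie in
`𝒟`.

Suppose brackets with `D` stay in `𝒟`. At each point the bracket is then the lift of some field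
`X'`. Being vertical over `E`, this lift does not move the metric, so the derivative of `X'` is skew
for the metric and has trace zero; the invariance of `L` along `X'` becomes `dL([D, X̄⁽¹⁾]) = 0`,
which is (P).

Conversely, (P) gives `dL(0, 0, ξ) = 0` on the whole fibre of `J¹E → E`, for every invariant `L`.
The test densities are `√|det g| · |T|²`, with `T` the covariant derivative of the metric, the
curvature of the connection, and the curvature of the transposed connection; an orientation turns
them into `n`-forms. Each `T` is affine in the first derivatives, so stationarity along `ξ` makes
the linear part of `T` at `ξ` orthogonal to all its linear parts. Raising indices preserves the
symmetries of `T`, hence some linear part has the raised components of `T(ξ)` as its own components;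
the pairing becomes a sum of squares, and `T(ξ) = 0` in any signature (`JetTensor.lin_eq_zero`). The
three tensors together say that `ξ` has no metric part and that its connection part is symmetric in
all three lower indices. Such a `ξ` is the prolonged lift, at every jet over `x`, of a cut-off cubic
field `-(1/6) ξ(y - x, y - x, y - x)` (`IsSymmetricVertical.mem_invDistribution`).

A general section `Y` of `𝒟` has pointwise values `X̄⁽¹⁾`, with `X` depending on the point without
any regularity. Along the line `z + t D_z` the values of `Y` are carried back to `z` by an explicit
linear map; the result is a curve in the fixed finite-dimensional space `𝒟_z`, whose derivative at
`0` is `[D, Y] + Y` at `z`. -/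

/-! ### Evaluation of forms, connections and jets on vectors -/

section Algebra

variable {n : ℕ}

/-- The vector with components `A^i_{jk} a^j b^k`. -/
def ConnForm.app (A : ConnForm n) (a b : Base n) : Base n :=
  WithLp.toLp 2 fun i => ∑ j, ∑ k, A i j k * a j * b k

/-- The combination `a^k S_k`. -/
def along {F : Type*} [AddCommGroup F] [Module ℝ F] (S : Fin n → F) (a : Base n) : F :=
  ∑ k, a k • S k

theorem ConnForm.app_apply (A : ConnForm n) (a b : Base n) (i : Fin n) :
    A.app a b i = ∑ j, ∑ k, A i j k * a j * b k := rfl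

namespace SymForm

theorem val_add_form (g g' : SymForm n) (a b : Base n) :
    SymForm.val (g + g') a b = g.val a b + g'.val a b := by
  simp [SymForm.val, add_mul, Finset.sum_add_distrib]

theorem val_smul_form (c : ℝ) (g : SymForm n) (a b : Base n) :
    SymForm.val (c • g) a b = c * g.val a b := by
  simp [SymForm.val, Finset.mul_sum, mul_assoc]

theorem val_add_left (g : SymForm n) (a a' b : Base n) :
    g.val (a + a') b = g.val a b + g.val a' b := by
  simp [SymForm.val, add_mul, mul_add, Finset.sum_add_distrib]

theorem val_smul_left (g : SymForm n) (c : ℝ) (a b : Base n) :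
    g.val (c • a) b = c * g.val a b := by
  simp only [SymForm.val, Finset.mul_sum, PiLp.smul_apply, smul_eq_mul]
  exact Finset.sum_congr rfl fun _ _ => Finset.sum_congr rfl fun _ _ => by ring

theorem val_comm (g : SymForm n) (a b : Base n) : g.val a b = g.val b a := by
  simp only [SymForm.val]
  rw [Finset.sum_comm]
  refine Finset.sum_congr rfl fun r _ => Finset.sum_congr rfl fun s _ => ?_
  rw [Sym2.eq_swap]
  ring

theorem val_add_right (g : SymForm n) (a b b' : Base n) :
    g.val a (b + b') = g.val a b + g.val a b' := by
  rw [val_comm, val_add_left, val_comm, g.val_comm b']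

theorem val_smul_right (g : SymForm n) (c : ℝ) (a b : Base n) :
    g.val a (c • b) = c * g.val a b := by
  rw [val_comm, val_smul_left, val_comm]

theorem val_neg_form (g : SymForm n) (a b : Base n) : SymForm.val (-g) a b = -g.val a b := by
  have := val_smul_form (-1) g a b
  simpa using this

theorem val_sub_form (g g' : SymForm n) (a b : Base n) :
    SymForm.val (g - g') a b = g.val a b - g'.val a b := by
  rw [sub_eq_add_neg, val_add_form, val_neg_form, sub_eq_add_neg]

theorem val_neg_left (g : SymForm n) (a b : Base n) : g.val (-a) b = -g.val a b := by
  simpa using g.val_smul_left (-1) a b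

theorem val_neg_right (g : SymForm n) (a b : Base n) : g.val a (-b) = -g.val a b := by
  simpa using g.val_smul_right (-1) a b

theorem val_sub_left (g : SymForm n) (a a' b : Base n) :
    g.val (a - a') b = g.val a b - g.val a' b := by
  rw [sub_eq_add_neg, val_add_left, val_neg_left, sub_eq_add_neg]

theorem val_sub_right (g : SymForm n) (a b b' : Base n) :
    g.val a (b - b') = g.val a b - g.val a b' := by
  rw [sub_eq_add_neg, val_add_right, val_neg_right, sub_eq_add_neg]

theorem val_single (g : SymForm n) (i j : Fin n) :
    g.val (EuclideanSpace.single i 1) (EuclideanSpace.single j 1) = g s(i, j) := by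
  simp [SymForm.val, mul_ite]

theorem ext_val {g g' : SymForm n} (h : ∀ a b, g.val a b = g'.val a b) : g = g' := by
  funext s
  induction s using Sym2.ind with
  | _ i j => simpa only [val_single] using h (.single i 1) (.single j 1)

theorem val_sum_left {ι : Type*} (g : SymForm n) (s : Finset ι) (f : ι → Base n) (b : Base n) :
    g.val (∑ i ∈ s, f i) b = ∑ i ∈ s, g.val (f i) b :=
  map_sum (AddMonoidHom.mk' (fun a => g.val a b) fun a a' => g.val_add_left a a' b) f s

theorem val_sum_right {ι : Type*} (g : SymForm n) (s : Finset ι) (f : ι → Base n) (b : Base n) :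
    g.val b (∑ i ∈ s, f i) = ∑ i ∈ s, g.val b (f i) :=
  map_sum (AddMonoidHom.mk' (fun a => g.val b a) fun a a' => g.val_add_right b a a') f s

/-- Index formulas are replaced by values on vectors, so that coordinate changes become identities
between Fréchet derivatives. -/
theorem val_pull (P : Fin n → Base n) (g : SymForm n) (a b : Base n) :
    (g.pull P).val a b = g.val (along P a) (along P b) := by
  simp only [along, val_sum_left, val_sum_right, val_smul_left, val_smul_right,
    Finset.mul_sum]
  rw [Finset.sum_comm]
  simp only [SymForm.val, SymForm.pull, Sym2.lift_mk]
  exact Finset.sum_congr rfl fun _ _ => Finset.sum_congr rfl fun _ _ => by ring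

theorem val_infPull (P : Fin n → Base n) (g : SymForm n) (a b : Base n) :
    (g.infPull P).val a b = g.val (along P a) b + g.val a (along P b) := by
  simp only [along, val_sum_left, val_sum_right, val_smul_left, val_smul_right]
  simp only [SymForm.val, SymForm.infPull, Sym2.lift_mk, Finset.sum_add_distrib, add_mul,
    Finset.mul_sum, Finset.sum_mul]
  congr 1
  · refine Finset.sum_congr rfl fun i _ => ?_
    rw [Finset.sum_comm]
    exact Finset.sum_congr rfl fun _ _ => Finset.sum_congr rfl fun _ _ => by ring
  · rw [Finset.sum_comm]
    refine Finset.sum_congr rfl fun i _ => Finset.sum_congr rfl fun _ _ =>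
      Finset.sum_congr rfl fun _ _ => by ring

end SymForm

namespace ConnForm

theorem app_add_form (A A' : ConnForm n) (a b : Base n) :
    ConnForm.app (A + A') a b = A.app a b + A'.app a b := by
  ext i; simp [ConnForm.app_apply, add_mul, Finset.sum_add_distrib]

theorem app_smul_form (c : ℝ) (A : ConnForm n) (a b : Base n) :
    ConnForm.app (c • A) a b = c • A.app a b := by
  ext i; simp [ConnForm.app_apply, Finset.mul_sum, mul_assoc]

theorem app_add_left (A : ConnForm n) (a a' b : Base n) :
    A.app (a + a') b = A.app a b + A.app a' b := by
  ext i; simp [ConnForm.app_apply, add_mul, mul_add, Finset.sum_add_distrib]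

theorem app_smul_left (A : ConnForm n) (c : ℝ) (a b : Base n) :
    A.app (c • a) b = c • A.app a b := by
  ext i
  simp only [ConnForm.app_apply, Finset.mul_sum, PiLp.smul_apply, smul_eq_mul]
  exact Finset.sum_congr rfl fun _ _ => Finset.sum_congr rfl fun _ _ => by ring

theorem app_add_right (A : ConnForm n) (a b b' : Base n) :
    A.app a (b + b') = A.app a b + A.app a b' := by
  ext i; simp [ConnForm.app_apply, mul_add, Finset.sum_add_distrib]

theorem app_smul_right (A : ConnForm n) (c : ℝ) (a b : Base n) :
    A.app a (c • b) = c • A.app a b := by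
  ext i
  simp only [ConnForm.app_apply, Finset.mul_sum, PiLp.smul_apply, smul_eq_mul]
  exact Finset.sum_congr rfl fun _ _ => Finset.sum_congr rfl fun _ _ => by ring

theorem app_neg_form (A : ConnForm n) (a b : Base n) : ConnForm.app (-A) a b = -A.app a b := by
  simpa using app_smul_form (-1) A a b

theorem app_neg_right (A : ConnForm n) (a b : Base n) : A.app a (-b) = -A.app a b := by
  simpa using A.app_smul_right (-1) a b

theorem app_sub_form (A A' : ConnForm n) (a b : Base n) :
    ConnForm.app (A - A') a b = A.app a b - A'.app a b := by
  rw [sub_eq_add_neg, app_add_form, app_neg_form, sub_eq_add_neg]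

theorem app_sub_right (A : ConnForm n) (a b b' : Base n) :
    A.app a (b - b') = A.app a b - A.app a b' := by
  rw [sub_eq_add_neg, app_add_right, app_neg_right, sub_eq_add_neg]

theorem app_single (A : ConnForm n) (i j k : Fin n) :
    A.app (EuclideanSpace.single j 1) (EuclideanSpace.single k 1) i = A i j k := by
  simp [ConnForm.app_apply, mul_ite]

theorem ext_app {A A' : ConnForm n} (h : ∀ a b, A.app a b = A'.app a b) : A = A' := by
  funext i j k
  rw [← app_single A, h, app_single]

theorem app_sum_left {ι : Type*} (A : ConnForm n) (s : Finset ι) (f : ι → Base n) (b : Base n) :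
    A.app (∑ i ∈ s, f i) b = ∑ i ∈ s, A.app (f i) b :=
  map_sum (AddMonoidHom.mk' (fun a => A.app a b) fun a a' => A.app_add_left a a' b) f s

theorem app_sum_right {ι : Type*} (A : ConnForm n) (s : Finset ι) (f : ι → Base n) (b : Base n) :
    A.app b (∑ i ∈ s, f i) = ∑ i ∈ s, A.app b (f i) :=
  map_sum (AddMonoidHom.mk' (fun a => A.app b a) fun a a' => A.app_add_right b a a') f s

/-- The connection with components `A^i_{kj}`. -/
def transpose (A : ConnForm n) : ConnForm n := fun i j k => A i k j

theorem app_transpose (A : ConnForm n) (a b : Base n) : A.transpose.app a b = A.app b a := by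
  ext i
  simp only [ConnForm.app_apply, transpose]
  rw [Finset.sum_comm]
  exact Finset.sum_congr rfl fun _ _ => Finset.sum_congr rfl fun _ _ => by ring

end ConnForm

section Along

variable {F : Type*} [AddCommGroup F] [Module ℝ F]

theorem along_add_left (S S' : Fin n → F) (a : Base n) :
    along (S + S') a = along S a + along S' a := by
  simp [along, Finset.sum_add_distrib]

theorem along_smul_left (c : ℝ) (S : Fin n → F) (a : Base n) :
    along (c • S) a = c • along S a := by
  simp only [along, Finset.smul_sum, Pi.smul_apply]
  exact Finset.sum_congr rfl fun _ _ => smul_comm _ _ _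

theorem along_neg_left (S : Fin n → F) (a : Base n) : along (-S) a = -along S a := by
  simpa using along_smul_left (-1) S a

theorem along_sub_left (S S' : Fin n → F) (a : Base n) :
    along (S - S') a = along S a - along S' a := by
  rw [sub_eq_add_neg, along_add_left, along_neg_left, sub_eq_add_neg]

theorem along_add (S : Fin n → F) (a b : Base n) : along S (a + b) = along S a + along S b := by
  simp [along, Finset.sum_add_distrib, add_smul]

theorem along_smul (S : Fin n → F) (c : ℝ) (a : Base n) : along S (c • a) = c • along S a := by
  simp [along, Finset.smul_sum, smul_smul]

theorem along_single (S : Fin n → F) (i : Fin n) :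
    along S (EuclideanSpace.single i 1) = S i := by
  simp [along, ite_smul]

theorem along_ext {S S' : Fin n → F} (h : ∀ a, along S a = along S' a) : S = S' := by
  funext i
  rw [← along_single S, h, along_single]

theorem along_linear {G : Type*} [AddCommGroup G] [Module ℝ G] (f : F →ₗ[ℝ] G) (S : Fin n → F)
    (a : Base n) : along (fun k => f (S k)) a = f (along S a) := by
  simp [along]

theorem sum_smul_single (a : Base n) :
    ∑ i, a i • (EuclideanSpace.single i 1 : Base n) = a := by
  ext j
  simp [Finset.sum_apply, Pi.single_apply]

theorem along_linear_single (f : Base n →ₗ[ℝ] F) (a : Base n) :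
    along (fun k => f (EuclideanSpace.single k 1)) a = f a := by
  rw [along_linear, along, sum_smul_single]

theorem along_pd {G : Type*} [NormedAddCommGroup G] [NormedSpace ℝ G] (u : Base n → G)
    (x a : Base n) : along (fun k => pd k u x) a = fderiv ℝ u x a :=
  along_linear_single (fderiv ℝ u x).toLinearMap a

end Along

end Algebra

/-! ### Product rules for these evaluations along curves -/

section Derivatives

variable {n : ℕ}

theorem HasDerivAt.base_apply {a : ℝ → Base n} {a' : Base n} {t : ℝ} (ha : HasDerivAt a a' t)
    (i : Fin n) : HasDerivAt (fun t => a t i) (a' i) t :=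
  (EuclideanSpace.proj (𝕜 := ℝ) i).hasFDerivAt.comp_hasDerivAt t ha

theorem HasDerivAt.base_mk {a : ℝ → Base n} {a' : Base n} {t : ℝ}
    (ha : ∀ i, HasDerivAt (fun t => a t i) (a' i) t) : HasDerivAt a a' t := by
  have := (EuclideanSpace.equiv (Fin n) ℝ).symm.toContinuousLinearMap.hasFDerivAt.comp_hasDerivAt t
    (hasDerivAt_pi.2 ha)
  exact this

theorem HasDerivAt.symForm_val {g : ℝ → SymForm n} {a b : ℝ → Base n} {g' : SymForm n}
    {a' b' : Base n} {t : ℝ} (hg : HasDerivAt g g' t) (ha : HasDerivAt a a' t)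
    (hb : HasDerivAt b b' t) :
    HasDerivAt (fun t => (g t).val (a t) (b t))
      (g'.val (a t) (b t) + (g t).val a' (b t) + (g t).val (a t) b') t := by
  have h := HasDerivAt.fun_sum (u := Finset.univ) fun i _ =>
    HasDerivAt.fun_sum (u := Finset.univ) fun j _ =>
      (((hasDerivAt_pi.1 hg s(i, j)).mul (ha.base_apply i)).mul (hb.base_apply j))
  refine h.congr_deriv ?_
  simp only [SymForm.val, ← Finset.sum_add_distrib]
  exact Finset.sum_congr rfl fun _ _ => Finset.sum_congr rfl fun _ _ => by
    simp only [Pi.mul_apply]; ring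

theorem HasDerivAt.connForm_app {A : ℝ → ConnForm n} {a b : ℝ → Base n} {A' : ConnForm n}
    {a' b' : Base n} {t : ℝ} (hA : HasDerivAt A A' t) (ha : HasDerivAt a a' t)
    (hb : HasDerivAt b b' t) :
    HasDerivAt (fun t => (A t).app (a t) (b t))
      (A'.app (a t) (b t) + (A t).app a' (b t) + (A t).app (a t) b') t := by
  refine HasDerivAt.base_mk fun i => ?_
  have h := HasDerivAt.fun_sum (u := Finset.univ) fun j _ =>
    HasDerivAt.fun_sum (u := Finset.univ) fun k _ =>
      (((hasDerivAt_pi.1 (hasDerivAt_pi.1 (hasDerivAt_pi.1 hA i) j) k).mul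
        (ha.base_apply j)).mul (hb.base_apply k))
  refine h.congr_deriv ?_
  simp only [ConnForm.app_apply, ← Finset.sum_add_distrib, PiLp.add_apply]
  exact Finset.sum_congr rfl fun _ _ => Finset.sum_congr rfl fun _ _ => by
    simp only [Pi.mul_apply]; ring

theorem HasDerivAt.along {F : Type*} [NormedAddCommGroup F] [NormedSpace ℝ F]
    {S : ℝ → Fin n → F} {a : ℝ → Base n} {S' : Fin n → F} {a' : Base n} {t : ℝ}
    (hS : HasDerivAt S S' t) (ha : HasDerivAt a a' t) :
    HasDerivAt (fun t => along (S t) (a t)) (along S' (a t) + along (S t) a') t := by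
  have h := HasDerivAt.fun_sum (u := Finset.univ) fun k _ =>
    (ha.base_apply k).smul (hasDerivAt_pi.1 hS k)
  refine h.congr_deriv ?_
  simp only [_root_.along, Finset.sum_add_distrib]

/-- Directional derivative of a differentiable function along a line. -/
theorem DifferentiableAt.hasDerivAt_line {E F : Type*} [NormedAddCommGroup E] [NormedSpace ℝ E]
    [NormedAddCommGroup F] [NormedSpace ℝ F] {f : E → F} {z : E} (hf : DifferentiableAt ℝ f z)
    (Z : E) : HasDerivAt (fun t : ℝ => f (z + t • Z)) (fderiv ℝ f z Z) 0 :=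
  hf.hasFDerivAt.hasLineDerivAt Z

theorem tendsto_line {E : Type*} [NormedAddCommGroup E] [NormedSpace ℝ E] (z Z : E) :
    Filter.Tendsto (fun t : ℝ => z + t • Z) (nhds 0) (nhds z) := by
  have : Continuous fun t : ℝ => z + t • Z := by fun_prop
  simpa using this.tendsto 0

end Derivatives

/-! ### Forms of a given signature: nondegeneracy and openness -/

section Signature

variable {n : ℕ}

theorem ContDiffAt.symForm_val {E : Type*} [NormedAddCommGroup E] [NormedSpace ℝ E] {m : ℕ∞ω}
    {g : E → SymForm n} {a b : E → Base n} {x : E} (hg : ContDiffAt ℝ m g x)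
    (ha : ContDiffAt ℝ m a x) (hb : ContDiffAt ℝ m b x) :
    ContDiffAt ℝ m (fun z => (g z).val (a z) (b z)) x := by
  unfold SymForm.val
  refine ContDiffAt.sum fun i _ => ContDiffAt.sum fun j _ => ?_
  exact ((contDiffAt_pi.1 hg _).mul (contDiffAt_piLp 2 |>.1 ha i)).mul (contDiffAt_piLp 2 |>.1 hb j)

theorem ContDiffAt.connForm_app {E : Type*} [NormedAddCommGroup E] [NormedSpace ℝ E] {m : ℕ∞ω}
    {A : E → ConnForm n} {a b : E → Base n} {x : E} (hA : ContDiffAt ℝ m A x)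
    (ha : ContDiffAt ℝ m a x) (hb : ContDiffAt ℝ m b x) :
    ContDiffAt ℝ m (fun z => (A z).app (a z) (b z)) x := by
  refine (contDiffAt_piLp 2).2 fun i => ?_
  simp only [ConnForm.app_apply]
  refine ContDiffAt.sum fun j _ => ContDiffAt.sum fun k _ => ?_
  exact ((contDiffAt_pi.1 (contDiffAt_pi.1 (contDiffAt_pi.1 hA i) j) k).mul
    (contDiffAt_piLp 2 |>.1 ha j)).mul (contDiffAt_piLp 2 |>.1 hb k)

theorem ContDiffAt.along {E F : Type*} [NormedAddCommGroup E] [NormedSpace ℝ E]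
    [NormedAddCommGroup F] [NormedSpace ℝ F] {m : ℕ∞ω} {S : E → Fin n → F} {a : E → Base n}
    {x : E} (hS : ContDiffAt ℝ m S x) (ha : ContDiffAt ℝ m a x) :
    ContDiffAt ℝ m (fun z => along (S z) (a z)) x := by
  unfold _root_.along
  exact ContDiffAt.sum fun k _ => ((contDiffAt_piLp 2).1 ha k).smul (contDiffAt_pi.1 hS k)

theorem ContDiffAt.symForm_pull {E : Type*} [NormedAddCommGroup E] [NormedSpace ℝ E]
    {m : ℕ∞ω} {h : E → SymForm n} {P : E → Fin n → Base n} {x : E} (hh : ContDiffAt ℝ m h x)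
    (hP : ContDiffAt ℝ m P x) : ContDiffAt ℝ m (fun z => (h z).pull (P z)) x := by
  refine contDiffAt_pi.2 fun s => ?_
  induction s using Sym2.ind with
  | _ i j => exact hh.symForm_val (contDiffAt_pi.1 hP i) (contDiffAt_pi.1 hP j)

/-- The Gram matrix of `g` in the standard basis. -/
def SymForm.mat (g : SymForm n) : Matrix (Fin n) (Fin n) ℝ := Matrix.of fun i j => g s(i, j)

theorem SymForm.mat_apply (g : SymForm n) (i j : Fin n) : g.mat i j = g s(i, j) := rfl

theorem SymForm.val_single_left (g : SymForm n) (i : Fin n) (b : Base n) :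
    g.val (EuclideanSpace.single i 1) b = (g.mat.mulVec b.ofLp) i := by
  conv_lhs => rw [← sum_smul_single b]
  simp only [SymForm.val_sum_right, SymForm.val_smul_right, SymForm.val_single, Matrix.mulVec,
    dotProduct, SymForm.mat_apply]
  exact Finset.sum_congr rfl fun _ _ => mul_comm _ _

variable {p q : ℕ}

/-- In an orthonormal basis the coordinates of `b` are, up to sign, its products with the basis
vectors. -/
theorem HasSignature.nondegenerate {g : SymForm n} (hg : HasSignature p q g) {b : Base n}
    (hb : ∀ a, g.val a b = 0) : b = 0 := by
  obtain ⟨e, h0, h1, h2⟩ := hg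
  have key : ∀ i, g.val (e i) b = e.repr b i * g.val (e i) (e i) := fun i => by
    conv_lhs => rw [← e.sum_repr b]
    rw [SymForm.val_sum_right, Finset.sum_eq_single i]
    · rw [SymForm.val_smul_right]
    · intro j _ hj
      rw [SymForm.val_smul_right, h0 i j hj.symm, mul_zero]
    · simp
  refine e.ext_elem fun i => ?_
  have := key i
  rw [hb] at this
  rcases i with i | i
  · rw [h1] at this; simpa using this.symm
  · rw [h2] at this; simpa using this.symm

theorem HasSignature.det_ne_zero {g : SymForm n} (hg : HasSignature p q g) : g.mat.det ≠ 0 := by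
  intro h
  obtain ⟨v, hv, hv'⟩ := Matrix.exists_mulVec_eq_zero_iff.2 h
  apply hv
  have : (WithLp.toLp 2 v : Base n) = 0 := hg.nondegenerate fun a => by
    rw [← sum_smul_single a, SymForm.val_sum_left]
    refine Finset.sum_eq_zero fun i _ => ?_
    rw [SymForm.val_smul_left, SymForm.val_single_left]
    simp [hv']
  simpa using congrArg WithLp.ofLp this

theorem HasSignature.of_val_eq {g g' : SymForm n} (hg : HasSignature p q g)
    (f : Base n ≃ₗ[ℝ] Base n) (h : ∀ a b, g'.val (f a) (f b) = g.val a b) :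
    HasSignature p q g' := by
  obtain ⟨e, h0, h1, h2⟩ := hg
  refine ⟨e.map f, ?_, ?_, ?_⟩
  · intro i j hij; simpa [h] using h0 i j hij
  · intro i; simpa [h] using h1 i
  · intro i; simpa [h] using h2 i

theorem HasSignature.of_val_eq_of_injective {g g' : SymForm n} (hg : HasSignature p q g)
    (f : Base n →ₗ[ℝ] Base n) (hf : Function.Injective f)
    (h : ∀ a b, g'.val (f a) (f b) = g.val a b) : HasSignature p q g' :=
  hg.of_val_eq (LinearEquiv.ofInjectiveEndo f hf) (by simpa using h)

/-- `infPull` as a linear map in its first argument. -/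
def infPullLin (g : SymForm n) : (Fin n → Base n) →ₗ[ℝ] SymForm n where
  toFun P := g.infPull P
  map_add' P P' := SymForm.ext_val fun a b => by
    simp only [SymForm.val_infPull, SymForm.val_add_form, along_add_left, SymForm.val_add_left,
      SymForm.val_add_right]
    ring
  map_smul' c P := SymForm.ext_val fun a b => by
    simp only [SymForm.val_infPull, SymForm.val_smul_form, along_smul_left, SymForm.val_smul_left,
      SymForm.val_smul_right, RingHom.id_apply]
    ring

theorem HasSignature.infPullLin_surjective {g : SymForm n} (hg : HasSignature p q g) :
    Function.Surjective (infPullLin g) := by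
  intro S
  have hu : IsUnit g.mat.det := hg.det_ne_zero.isUnit
  -- Half of `S` with one index raised; each of the two terms of `infPull` then contributes `S / 2`.
  refine ⟨fun i => WithLp.toLp 2 (g.mat⁻¹.mulVec fun j => S s(j, i) / 2), ?_⟩
  refine funext fun s => ?_
  induction s using Sym2.ind with
  | _ i j =>
    change SymForm.infPull _ g s(i, j) = _
    rw [← SymForm.val_single (SymForm.infPull _ g)]
    rw [SymForm.val_infPull, along_single, along_single, SymForm.val_comm,
      SymForm.val_single_left, SymForm.val_single_left]
    simp only [Matrix.mulVec_mulVec, Matrix.mul_nonsing_inv _ hu, Matrix.one_mulVec]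
    rw [Sym2.eq_swap]
    ring

theorem hasStrictFDerivAt_pull (g : SymForm n) :
    HasStrictFDerivAt (fun P : Fin n → Base n => g.pull P) (infPullLin g).toContinuousLinearMap
      (fun i => EuclideanSpace.single i 1) := by
  have hc : ContDiffAt ℝ 1 (fun P : Fin n → Base n => g.pull P)
      (fun i => EuclideanSpace.single i 1) := ContDiffAt.symForm_pull contDiffAt_const contDiffAt_id
  refine (hc.hasStrictFDerivAt one_ne_zero).congr_fderiv (ContinuousLinearMap.ext fun H => ?_)
  have h1 := (hc.differentiableAt one_ne_zero).hasDerivAt_line H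
  refine h1.unique (hasDerivAt_pi.2 fun s => ?_)
  induction s using Sym2.ind with
  | _ i j =>
    have hl : ∀ i, HasDerivAt (fun t : ℝ => (EuclideanSpace.single i 1 : Base n) + t • H i) (H i) 0 :=
      fun i => by simpa using ((hasDerivAt_id (0 : ℝ)).smul_const (H i)).const_add (EuclideanSpace.single i 1)
    have := (hasDerivAt_const (0 : ℝ) g).symForm_val (hl i) (hl j)
    refine this.congr_deriv ?_
    change _ = g.infPull H s(i, j)
    rw [← SymForm.val_single (g.infPull H), SymForm.val_infPull, along_single, along_single]
    have h0 : SymForm.val (0 : SymForm n) = 0 := by ext; simp [SymForm.val]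
    simp [h0]

/-- The map `P ↦ g.pull P` has surjective strict derivative at the standard frame, hence is open
there: every form near `g` is the pullback of `g` by a frame near the standard one, which is still a
basis, and so has the signature of `g`. -/
theorem isOpen_hasSignature (p q : ℕ) : IsOpen {g : SymForm n | HasSignature p q g} := by
  rw [isOpen_iff_mem_nhds]
  intro g hg
  have h := (hasStrictFDerivAt_pull g).map_nhds_eq_of_surj
    (LinearMap.range_eq_top.2 hg.infPullLin_surjective)
  have hid : g.pull (fun i => EuclideanSpace.single i 1) = g := SymForm.ext_val fun a b => by
    rw [SymForm.val_pull]; simp only [along, sum_smul_single]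
  rw [hid] at h
  rw [← h, Filter.mem_map]
  have hdet : ∀ᶠ P : Fin n → Base n in nhds (fun i => EuclideanSpace.single i 1),
      (Matrix.of fun i j => P i j).det ≠ 0 := by
    have hc : Continuous fun P : Fin n → Base n => (Matrix.of fun i j => P i j).det := by
      refine Continuous.matrix_det ?_
      refine continuous_matrix fun i j => ?_
      simp only [Matrix.of_apply]
      fun_prop
    refine hc.continuousAt.eventually_ne ?_
    have : (Matrix.of fun i j => (EuclideanSpace.single i 1 : Base n) j)
        = (1 : Matrix (Fin n) (Fin n) ℝ) := by
      ext i j; simp [Matrix.one_apply, eq_comm]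
    rw [this]; simp
  filter_upwards [hdet] with P hP
  have hinj : Function.Injective
      ({ toFun := along P, map_add' := along_add P, map_smul' := along_smul P } :
        Base n →ₗ[ℝ] Base n) := by
    refine (injective_iff_map_eq_zero _).2 fun a ha => ?_
    by_contra hne
    refine hP (Matrix.exists_vecMul_eq_zero_iff.1 ⟨a.ofLp, by simpa using hne, ?_⟩)
    ext j
    have : along P a j = 0 := by
      have : along P a = 0 := ha
      rw [this]; rfl
    simpa [along, Matrix.vecMul, dotProduct] using this
  let f := LinearEquiv.ofInjectiveEndo _ hinj
  refine hg.of_val_eq f.symm fun a b => ?_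
  have := SymForm.val_pull P g (f.symm a) (f.symm b)
  rw [this]
  exact congrArg₂ g.val (f.apply_symm_apply a) (f.apply_symm_apply b)

end Signature

/-! ### Coordinate changes of the base and their derivatives -/

section Transition

variable {n : ℕ} {N : Type*} [TopologicalSpace N] [ChartedSpace (Base n) N]

theorem isOpen_overlap (e e' : CoordSys n N) : IsOpen (overlap e e') :=
  e.1.isOpen_inter_preimage_symm e'.1.open_source

theorem transition_mem {e e' : CoordSys n N} {x : Base n} (hx : x ∈ overlap e e') :
    transition e e' x ∈ overlap e' e := by
  refine ⟨e'.1.map_source hx.2, ?_⟩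
  rw [transition, e'.1.left_inv hx.2]
  exact e.1.map_target hx.1

theorem transition_transition {e e' : CoordSys n N} {x : Base n} (hx : x ∈ overlap e e') :
    transition e' e (transition e e' x) = x := by
  rw [transition, transition, e'.1.left_inv hx.2, e.1.right_inv hx.1]

theorem contDiffAt_transition {e e' : CoordSys n N} {x : Base n} (hx : x ∈ overlap e e') :
    ContDiffAt ℝ ∞ (transition e e') x := by
  have h := StructureGroupoid.compatible_of_mem_maximalAtlas e.2 e'.2
  rw [contDiffGroupoid, mem_groupoid_of_pregroupoid] at h
  have h2 : ContDiffOn ℝ ∞ (transition e e') (overlap e e') := by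
    have := h.1
    simp only [contDiffPregroupoid] at this
    refine (this.mono ?_).congr ?_
    · intro y hy
      simpa [overlap] using hy
    · intro y _; rfl
  exact h2.contDiffAt ((isOpen_overlap e e').mem_nhds hx)

theorem differentiableAt_transition {e e' : CoordSys n N} {x : Base n} (hx : x ∈ overlap e e') :
    DifferentiableAt ℝ (transition e e') x :=
  (contDiffAt_transition hx).differentiableAt (by simp)

theorem contDiffAt_fderiv_transition {e e' : CoordSys n N} {x : Base n} (hx : x ∈ overlap e e') :
    ContDiffAt ℝ ∞ (fderiv ℝ (transition e e')) x :=
  (contDiffAt_transition hx).fderiv_right (by simp)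

theorem eventually_mem_overlap {e e' : CoordSys n N} {x : Base n} (hx : x ∈ overlap e e') :
    ∀ᶠ y in nhds x, y ∈ overlap e e' := (isOpen_overlap e e').mem_nhds hx

theorem fderiv_transition_left {e e' : CoordSys n N} {x : Base n} (hx : x ∈ overlap e e')
    (a : Base n) :
    fderiv ℝ (transition e' e) (transition e e' x) (fderiv ℝ (transition e e') x a) = a := by
  have h1 := (differentiableAt_transition (transition_mem hx)).hasFDerivAt.comp x
    (differentiableAt_transition hx).hasFDerivAt
  have h2 : HasFDerivAt (transition e' e ∘ transition e e') (ContinuousLinearMap.id ℝ (Base n)) x :=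
    (hasFDerivAt_id x).congr_of_eventuallyEq (by
      filter_upwards [eventually_mem_overlap hx] with y hy using transition_transition hy)
  exact DFunLike.congr_fun (h1.unique h2) a

theorem fderiv_transition_right {e e' : CoordSys n N} {x : Base n} (hx : x ∈ overlap e e')
    (a : Base n) :
    fderiv ℝ (transition e e') x (fderiv ℝ (transition e' e) (transition e e' x) a) = a := by
  have := fderiv_transition_left (transition_mem hx) a
  rwa [transition_transition hx] at this

theorem fderiv_fderiv_symm {F : Type*} [NormedAddCommGroup F] [NormedSpace ℝ F]
    {E : Type*} [NormedAddCommGroup E] [NormedSpace ℝ E] {f : E → F} {x : E}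
    (hf : ContDiffAt ℝ ∞ f x) (a b : E) :
    fderiv ℝ (fderiv ℝ f) x a b = fderiv ℝ (fderiv ℝ f) x b a :=
  (hf.isSymmSndFDerivAt (by simpa using WithTop.coe_le_coe.2 (le_top (a := (2 : ℕ∞))))) a b

theorem ContDiffAt.differentiableAt_fderiv {E F : Type*} [NormedAddCommGroup E] [NormedSpace ℝ E]
    [NormedAddCommGroup F] [NormedSpace ℝ F] {f : E → F} {x : E} (hf : ContDiffAt ℝ ∞ f x) :
    DifferentiableAt ℝ (fderiv ℝ f) x :=
  (hf.fderiv_right (m := ∞) (by simp)).differentiableAt (by simp)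

/-- Smoothness of order `∞` at a point gives only finite orders on neighbourhoods, so the argument
goes through order `2`. -/
theorem ContDiffAt.eventually_differentiableAt_fderiv {E F : Type*} [NormedAddCommGroup E]
    [NormedSpace ℝ E] [NormedAddCommGroup F] [NormedSpace ℝ F] {f : E → F} {x : E}
    (hf : ContDiffAt ℝ ∞ f x) : ∀ᶠ y in nhds x, DifferentiableAt ℝ (fderiv ℝ f) y := by
  have h : ContDiffAt ℝ 2 f x :=
    hf.of_le (by simpa using WithTop.coe_le_coe.2 (le_top (a := (2 : ℕ∞))))
  filter_upwards [h.eventually (by simp)] with y hy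
  exact (hy.fderiv_right (m := 1) (by norm_num)).differentiableAt (by simp)

/-- The derivative of `z ↦ f' z (a z)` along `Z`. -/
theorem hasDerivAt_fderiv_apply {E F : Type*} [NormedAddCommGroup E] [NormedSpace ℝ E]
    [NormedAddCommGroup F] [NormedSpace ℝ F] {f : E → F} {c : ℝ → E} {c' : E} {a : ℝ → E}
    {a' : E} {t : ℝ} (hf : ContDiffAt ℝ ∞ f (c t)) (hc : HasDerivAt c c' t)
    (ha : HasDerivAt a a' t) :
    HasDerivAt (fun s => fderiv ℝ f (c s) (a s))
      (fderiv ℝ (fderiv ℝ f) (c t) c' (a t) + fderiv ℝ f (c t) a') t := by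
  have h1 : DifferentiableAt ℝ (fderiv ℝ f) (c t) :=
    (hf.fderiv_right (m := ∞) (by simp)).differentiableAt (by simp)
  exact (h1.hasFDerivAt.comp_hasDerivAt t hc).clm_apply ha

theorem hasDerivAt_line {E : Type*} [NormedAddCommGroup E] [NormedSpace ℝ E] (z Z : E) (t : ℝ) :
    HasDerivAt (fun t : ℝ => z + t • Z) Z t := by
  simpa using ((hasDerivAt_id t).smul_const Z).const_add z

/-- This is the derivative along `a` of the identity `fderiv_transition_left` applied to the
constant vector `b`. -/
theorem snd_fderiv_transition {e e' : CoordSys n N} {x : Base n} (hx : x ∈ overlap e e')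
    (a b : Base n) :
    fderiv ℝ (fderiv ℝ (transition e' e)) (transition e e' x) (fderiv ℝ (transition e e') x a)
        (fderiv ℝ (transition e e') x b)
      + fderiv ℝ (transition e' e) (transition e e' x)
          (fderiv ℝ (fderiv ℝ (transition e e')) x a b) = 0 := by
  have hl := hasDerivAt_line x a 0
  have hx0 : x + (0 : ℝ) • a = x := by simp
  have h1 : HasDerivAt (fun t : ℝ => fderiv ℝ (transition e e') (x + t • a) b)
      (fderiv ℝ (fderiv ℝ (transition e e')) x a b) 0 := by
    have := hasDerivAt_fderiv_apply (f := transition e e') (t := 0)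
      (by rw [hx0]; exact contDiffAt_transition hx) hl (hasDerivAt_const 0 b)
    simpa using this
  have h2 := (differentiableAt_transition hx).hasDerivAt_line a
  have h3 := hasDerivAt_fderiv_apply (f := transition e' e) (t := 0)
    (by rw [hx0]; exact contDiffAt_transition (transition_mem hx)) h2 h1
  rw [hx0] at h3
  refine h3.unique ((hasDerivAt_const (0 : ℝ) b).congr_of_eventuallyEq ?_)
  filter_upwards [(tendsto_line x a).eventually (eventually_mem_overlap hx)] with t ht
  exact fderiv_transition_left ht b

end Transition

/-! ### Coordinate changes on `E`, and on jets through the chain rule -/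

section Bundle

variable {n : ℕ} {N : Type*} [TopologicalSpace N] [ChartedSpace (Base n) N]

theorem pd_pd {F : Type*} [NormedAddCommGroup F] [NormedSpace ℝ F] {u : Base n → F} {x : Base n}
    (hu : DifferentiableAt ℝ (fderiv ℝ u) x) (j k : Fin n) :
    pd j (pd k u) x
      = fderiv ℝ (fderiv ℝ u) x (EuclideanSpace.single j 1) (EuclideanSpace.single k 1) := by
  have := (hu.hasFDerivAt.clm_apply
    (hasFDerivAt_const (EuclideanSpace.single k (1 : ℝ) : Base n) x)).fderiv
  change fderiv ℝ (fun y => (fderiv ℝ u y) (EuclideanSpace.single k 1)) x _ = _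
  rw [this]
  simp

theorem ConnForm.app_eq_bilinear {A : ConnForm n} (β : Base n →ₗ[ℝ] Base n →ₗ[ℝ] Base n)
    (h : ∀ i j k, A i j k = β (EuclideanSpace.single j 1) (EuclideanSpace.single k 1) i)
    (a b : Base n) : A.app a b = β a b := by
  conv_rhs => rw [← sum_smul_single a, ← sum_smul_single b]
  ext i
  simp only [ConnForm.app_apply, map_sum, map_smul, LinearMap.sum_apply, LinearMap.smul_apply, h,
    Finset.smul_sum]
  rw [Finset.sum_comm]
  simp only [WithLp.ofLp_sum, WithLp.ofLp_smul, Finset.sum_apply, Pi.smul_apply, smul_eq_mul]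
  exact Finset.sum_congr rfl fun _ _ => Finset.sum_congr rfl fun _ _ => by ring

/-- `A.app` as a bilinear map. -/
noncomputable def ConnForm.bilin (A : ConnForm n) : Base n →ₗ[ℝ] Base n →ₗ[ℝ] Base n :=
  LinearMap.mk₂ ℝ A.app A.app_add_left A.app_smul_left A.app_add_right A.app_smul_right

/-- A second derivative as a bilinear map. -/
noncomputable def bilinOfCLM (B : Base n →L[ℝ] Base n →L[ℝ] Base n) : Base n →ₗ[ℝ] Base n →ₗ[ℝ] Base n :=
  LinearMap.mk₂ ℝ (fun a b => B a b) (by simp) (by simp) (by simp) (by simp)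

theorem fibTrans_fst_val (e e' : CoordSys n N) (y : Base n) (f : Fib n) (a b : Base n) :
    (fibTrans e e' y f).1.val a b
      = f.1.val (fderiv ℝ (transition e' e) y a) (fderiv ℝ (transition e' e) y b) := by
  simp only [fibTrans, SymForm.val_pull, along_pd]

theorem fibTrans_snd_app {e e' : CoordSys n N} {y : Base n} (hy : y ∈ overlap e' e) (f : Fib n)
    (a b : Base n) :
    (fibTrans e e' y f).2.app a b
      = fderiv ℝ (transition e e') (transition e' e y)
        (f.2.app (fderiv ℝ (transition e' e) y a) (fderiv ℝ (transition e' e) y b)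
          + fderiv ℝ (fderiv ℝ (transition e' e)) y a b) := by
  set Lσ := fderiv ℝ (transition e' e) y with hLσ
  set Lτ := fderiv ℝ (transition e e') (transition e' e y) with hLτ
  refine ConnForm.app_eq_bilinear
    ((f.2.bilin.compl₁₂ Lσ.toLinearMap Lσ.toLinearMap
      + bilinOfCLM (fderiv ℝ (fderiv ℝ (transition e' e)) y)).compr₂ Lτ.toLinearMap) ?_ a b
  intro i j k
  change _ = Lτ (f.2.app (Lσ (EuclideanSpace.single j 1)) (Lσ (EuclideanSpace.single k 1))
    + fderiv ℝ (fderiv ℝ (transition e' e)) y (EuclideanSpace.single j 1)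
      (EuclideanSpace.single k 1)) i
  rw [← pd_pd (contDiffAt_transition hy).differentiableAt_fderiv]
  have hL : ∀ v, Lτ v = along (fun k => Lτ (EuclideanSpace.single k 1)) v :=
    fun v => (along_linear_single Lτ.toLinearMap v).symm
  rw [hL]
  simp only [fibTrans, along, PiLp.add_apply, ConnForm.app_apply, WithLp.ofLp_sum,
    Finset.sum_apply, WithLp.ofLp_smul, Pi.smul_apply, smul_eq_mul]
  refine Finset.sum_congr rfl fun l _ => ?_
  rw [mul_comm]
  refine congrArg₂ (· * ·) (congrArg₂ (· + ·) ?_ rfl) rfl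
  refine Finset.sum_congr rfl fun _ _ => Finset.sum_congr rfl fun _ _ => ?_
  simp only [pd, ← hLσ]
  ring

/-- On transported vectors the inverse coordinate change drops out. In this form the transformation
laws are differentiated later. -/
theorem eTrans_fst_val {e e' : CoordSys n N} {w : ECoord n} (hw : w.1 ∈ overlap e e')
    (a b : Base n) :
    (eTrans e e' w).2.1.val (fderiv ℝ (transition e e') w.1 a) (fderiv ℝ (transition e e') w.1 b)
      = w.2.1.val a b := by
  simp only [eTrans, fibTrans_fst_val, fderiv_transition_left hw]

theorem eTrans_snd_app {e e' : CoordSys n N} {w : ECoord n} (hw : w.1 ∈ overlap e e')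
    (a b : Base n) :
    (eTrans e e' w).2.2.app (fderiv ℝ (transition e e') w.1 a) (fderiv ℝ (transition e e') w.1 b)
      = fderiv ℝ (transition e e') w.1 (w.2.2.app a b)
        - fderiv ℝ (fderiv ℝ (transition e e')) w.1 a b := by
  simp only [eTrans, fibTrans_snd_app (transition_mem hw), fderiv_transition_left hw,
    transition_transition hw, map_add]
  -- The inhomogeneous term, a second derivative of the inverse change, is traded for minus the
  -- second derivative of the change itself.
  rw [eq_neg_of_add_eq_zero_left (snd_fderiv_transition hw a b), map_neg,
    fderiv_transition_right hw, sub_eq_add_neg]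

theorem ContDiffAt.pd {F E : Type*} [NormedAddCommGroup F] [NormedSpace ℝ F]
    [NormedAddCommGroup E] [NormedSpace ℝ E] {u : Base n → F} {c : E → Base n} {x : E}
    (hu : ContDiffAt ℝ ∞ u (c x)) (hc : ContDiffAt ℝ ∞ c x) (k : Fin n) :
    ContDiffAt ℝ ∞ (fun z => _root_.pd k u (c z)) x :=
  ((hu.fderiv_right (m := ∞) (by simp)).comp x hc).clm_apply contDiffAt_const

theorem contDiffAt_fibTrans {e e' : CoordSys n N} {y : Base n} (hy : y ∈ overlap e' e)
    (f : Fib n) : ContDiffAt ℝ ∞ (fun w : ECoord n => fibTrans e e' w.1 w.2) (y, f) := by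
  have hσ := contDiffAt_transition hy
  have hτ := contDiffAt_transition (transition_mem hy)
  have h1 : ContDiffAt ℝ ∞ (fun w : ECoord n => w.1) (y, f) := contDiffAt_fst
  have hpd : ∀ k, ContDiffAt ℝ ∞ (fun w : ECoord n => pd k (transition e' e) w.1) (y, f) :=
    fun k => ContDiffAt.pd (c := fun w : ECoord n => w.1) hσ h1 k
  have hpd2 : ∀ j k, ContDiffAt ℝ ∞ (fun w : ECoord n => pd j (pd k (transition e' e)) w.1) (y, f) :=
    fun j k => ContDiffAt.pd (c := fun w : ECoord n => w.1)
      (ContDiffAt.pd (c := fun x => x) hσ contDiffAt_id k) h1 j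
  have hpτ : ∀ k, ContDiffAt ℝ ∞
      (fun w : ECoord n => pd k (transition e e') (transition e' e w.1)) (y, f) :=
    fun k => ContDiffAt.pd (c := fun w : ECoord n => transition e' e w.1) hτ (ContDiffAt.comp (g := transition e' e) (y, f) hσ h1) k
  have hcoord : ∀ (g : ECoord n → Base n), ContDiffAt ℝ ∞ g (y, f) →
      ∀ i, ContDiffAt ℝ ∞ (fun w => g w i) (y, f) := fun g hg => (contDiffAt_piLp 2).1 hg
  refine ContDiffAt.prodMk ?_ ?_
  · exact ContDiffAt.symForm_pull (contDiffAt_snd.fst) (contDiffAt_pi.2 hpd)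
  · refine contDiffAt_pi.2 fun i => contDiffAt_pi.2 fun j => contDiffAt_pi.2 fun k =>
      ContDiffAt.sum fun l _ => ?_
    refine (hcoord _ (hpτ l) i).mul (ContDiffAt.add ?_ (hcoord _ (hpd2 j k) l))
    refine ContDiffAt.sum fun r _ => ContDiffAt.sum fun s _ => ?_
    refine ((hcoord _ (hpd j) r).mul (hcoord _ (hpd k) s)).mul ?_
    have h2 : ContDiffAt ℝ ∞ (fun w : ECoord n => w.2.2) (y, f) := contDiffAt_snd.snd
    exact contDiffAt_pi.1 (contDiffAt_pi.1 (contDiffAt_pi.1 h2 l) r) s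

theorem contDiffAt_eTrans {e e' : CoordSys n N} {w : ECoord n} (hw : w.1 ∈ overlap e e') :
    ContDiffAt ℝ ∞ (eTrans e e') w := by
  have h1 : ContDiffAt ℝ ∞ (fun w : ECoord n => transition e e' w.1) w :=
    (contDiffAt_transition hw).comp w contDiffAt_fst
  refine h1.prodMk ?_
  exact (contDiffAt_fibTrans (transition_mem hw) w.2).comp w (h1.prodMk contDiffAt_snd)

theorem fderiv_eTrans_fst {e e' : CoordSys n N} {w : ECoord n} (hw : w.1 ∈ overlap e e')
    (V : ECoord n) : (fderiv ℝ (eTrans e e') w V).1 = fderiv ℝ (transition e e') w.1 V.1 := by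
  have h1 := ((contDiffAt_eTrans hw).differentiableAt (by simp)).hasFDerivAt.fst
  have h2 := (differentiableAt_transition hw).hasFDerivAt.comp w
    (hasFDerivAt_fst (𝕜 := ℝ) (E := Base n) (F := Fib n))
  exact DFunLike.congr_fun (h1.unique h2) V

theorem jTrans_toE {e e' : CoordSys n N} {z : JCoord n} (hz : z.1 ∈ overlap e e') :
    (jTrans e e' z).toE = eTrans e e' z.toE := by
  simp only [jTrans, JCoord.toE, eTrans, transportedSection, transition_transition hz]
  simp

theorem jTrans_fst (e e' : CoordSys n N) (z : JCoord n) :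
    (jTrans e e' z).1 = transition e e' z.1 := rfl

/-- The first derivatives of a section in new coordinates. -/
theorem along_jTrans {e e' : CoordSys n N} {z : JCoord n} (hz : z.1 ∈ overlap e e')
    (a : Base n) :
    along (jTrans e e' z).2.2 (fderiv ℝ (transition e e') z.1 a)
      = (fderiv ℝ (eTrans e e') z.toE (a, along z.2.2 a)).2 := by
  simp only [jTrans, along_pd]
  have hd : ContDiffAt ℝ ∞ (transportedSection e e' z) (transition e e' z.1) := by
    have hc : ContDiffAt ℝ ∞ (fun y => (y, z.2.1 + ∑ k, (transition e' e y k - z.1 k) • z.2.2 k))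
        (transition e e' z.1) := by
      refine contDiffAt_id.prodMk (contDiffAt_const.add (ContDiffAt.sum fun k _ => ?_))
      exact (((contDiffAt_piLp 2).1 (contDiffAt_transition (transition_mem hz)) k).sub
        contDiffAt_const).smul contDiffAt_const
    have hF := contDiffAt_fibTrans (transition_mem hz)
      (z.2.1 + ∑ k, (transition e' e (transition e e' z.1) k - z.1 k) • z.2.2 k)
    have := ContDiffAt.comp (transition e e' z.1) (g := fun w : ECoord n => fibTrans e e' w.1 w.2)
      (f := fun y => (y, z.2.1 + ∑ k, (transition e' e y k - z.1 k) • z.2.2 k)) hF hc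
    exact this
  -- Both sides are derivatives at `t = 0` along the image of the line `z.1 + t • a`, where the
  -- transported section is the image under `eTrans` of the affine section with jet `z`.
  have h1 := (hd.differentiableAt (by simp)).hasFDerivAt.comp_hasDerivAt_of_eq 0
    ((differentiableAt_transition hz).hasDerivAt_line a) (by simp)
  have hl : HasDerivAt (fun t : ℝ => (z.1 + t • a, z.2.1 + t • along z.2.2 a))
      (a, along z.2.2 a) 0 := (hasDerivAt_line _ _ _).prodMk (hasDerivAt_line _ _ _)
  have h2 : HasDerivAt (fun t : ℝ => (eTrans e e' (z.1 + t • a, z.2.1 + t • along z.2.2 a)).2) _ 0 :=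
    (((contDiffAt_eTrans (w := z.toE) hz).differentiableAt
    (by simp)).hasFDerivAt.comp_hasDerivAt_of_eq 0 hl (by simp [JCoord.toE])).snd
  refine h1.unique (h2.congr_of_eventuallyEq ?_)
  filter_upwards [(tendsto_line z.1 a).eventually (eventually_mem_overlap hz)] with t ht
  simp only [transportedSection, eTrans, Function.comp, transition_transition ht]
  simp [along, Finset.smul_sum, smul_smul]

end Bundle

theorem HasDerivAt.prod_fst {E F : Type*} [NormedAddCommGroup E] [NormedSpace ℝ E]
    [NormedAddCommGroup F] [NormedSpace ℝ F] {f : ℝ → E × F} {f' : E × F} {t : ℝ}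
    (hf : HasDerivAt f f' t) : HasDerivAt (fun s => (f s).1) f'.1 t :=
  (hasFDerivAt_fst (𝕜 := ℝ) (E := E) (F := F)).comp_hasDerivAt t hf

theorem HasDerivAt.prod_snd {E F : Type*} [NormedAddCommGroup E] [NormedSpace ℝ E]
    [NormedAddCommGroup F] [NormedSpace ℝ F] {f : ℝ → E × F} {f' : E × F} {t : ℝ}
    (hf : HasDerivAt f f' t) : HasDerivAt (fun s => (f s).2) f'.2 t :=
  (hasFDerivAt_snd (𝕜 := ℝ) (E := E) (F := F)).comp_hasDerivAt t hf

/-! ### Coordinate changes on `J¹E`: smoothness and derivative -/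

section JetTransition

variable {n : ℕ} {N : Type*} [TopologicalSpace N] [ChartedSpace (Base n) N]

/-- The definition differentiates a section which itself depends on `z`; here the dependence on `z`
is explicit, so smoothness can be read off. -/
theorem jTrans_eq {e e' : CoordSys n N} {z : JCoord n} (hz : z.1 ∈ overlap e e') :
    jTrans e e' z = (transition e e' z.1, (eTrans e e' z.toE).2, fun k =>
      (fderiv ℝ (eTrans e e') z.toE
        (fderiv ℝ (transition e' e) (transition e e' z.1) (EuclideanSpace.single k 1),
          along z.2.2 (fderiv ℝ (transition e' e) (transition e e' z.1)
            (EuclideanSpace.single k 1)))).2) := by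
  refine Prod.ext rfl (Prod.ext (congrArg Prod.snd (jTrans_toE hz)) (funext fun k => ?_))
  dsimp only
  rw [← along_jTrans hz, fderiv_transition_right hz, along_single]

theorem contDiffAt_toE {m : ℕ∞ω} (z : JCoord n) : ContDiffAt ℝ m (JCoord.toE (n := n)) z :=
  contDiffAt_fst.prodMk contDiffAt_snd.fst

theorem contDiffAt_jTrans {e e' : CoordSys n N} {z : JCoord n} (hz : z.1 ∈ overlap e e') :
    ContDiffAt ℝ ∞ (jTrans e e') z := by
  have hτ : ContDiffAt ℝ ∞ (fun z : JCoord n => transition e e' z.1) z :=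
    ContDiffAt.comp (g := transition e e') z (contDiffAt_transition hz) contDiffAt_fst
  have hΦ : ContDiffAt ℝ ∞ (fun z : JCoord n => eTrans e e' z.toE) z :=
    ContDiffAt.comp (g := eTrans e e') z (contDiffAt_eTrans (w := z.toE) hz) (contDiffAt_toE z)
  have hDΦ : ContDiffAt ℝ ∞ (fun z : JCoord n => fderiv ℝ (eTrans e e') z.toE) z :=
    ContDiffAt.comp (g := fderiv ℝ (eTrans e e')) z
      ((contDiffAt_eTrans (w := z.toE) hz).fderiv_right (by simp)) (contDiffAt_toE z)
  have hσ : ∀ k, ContDiffAt ℝ ∞ (fun z : JCoord n =>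
      fderiv ℝ (transition e' e) (transition e e' z.1) (EuclideanSpace.single k (1 : ℝ))) z :=
    fun k => (ContDiffAt.comp (g := fderiv ℝ (transition e' e)) z
      (contDiffAt_fderiv_transition (transition_mem hz)) hτ).clm_apply contDiffAt_const
  have h3 : ContDiffAt ℝ ∞ (fun z : JCoord n => fun k =>
      (fderiv ℝ (eTrans e e') z.toE
        (fderiv ℝ (transition e' e) (transition e e' z.1) (EuclideanSpace.single k (1 : ℝ)),
          along z.2.2 (fderiv ℝ (transition e' e) (transition e e' z.1)
            (EuclideanSpace.single k 1)))).2) z :=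
    contDiffAt_pi.2 fun k => (hDΦ.clm_apply
      ((hσ k).prodMk (ContDiffAt.along contDiffAt_snd.snd (hσ k)))).snd
  refine (hτ.prodMk (hΦ.snd.prodMk h3)).congr_of_eventuallyEq ?_
  have : ∀ᶠ z' : JCoord n in nhds z, z'.1 ∈ overlap e e' :=
    continuousAt_fst.eventually (eventually_mem_overlap hz)
  filter_upwards [this] with z' hz' using jTrans_eq hz'

theorem eventually_fst_mem_overlap {e e' : CoordSys n N} {z : JCoord n}
    (hz : z.1 ∈ overlap e e') : ∀ᶠ z' in nhds z, z'.1 ∈ overlap e e' :=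
  continuousAt_fst.eventually (eventually_mem_overlap hz)

theorem fderiv_jTrans_toE {e e' : CoordSys n N} {z : JCoord n} (hz : z.1 ∈ overlap e e')
    (Z : JCoord n) : (fderiv ℝ (jTrans e e') z Z).toE = fderiv ℝ (eTrans e e') z.toE Z.toE := by
  have h1 := ((contDiffAt_jTrans hz).differentiableAt (by simp)).hasDerivAt_line Z
  have h2 : HasDerivAt (fun t : ℝ => (jTrans e e' (z + t • Z)).toE)
      (fderiv ℝ (jTrans e e') z Z).toE 0 :=
    h1.prod_fst.prodMk h1.prod_snd.prod_fst
  have h3 := ((contDiffAt_eTrans (w := z.toE) hz).differentiableAt (by simp)).hasDerivAt_line Z.toE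
  refine h2.unique (h3.congr_of_eventuallyEq ?_)
  filter_upwards [(tendsto_line z Z).eventually (eventually_fst_mem_overlap hz)] with t ht
  exact jTrans_toE ht

theorem along_fderiv_jTrans {e e' : CoordSys n N} {z : JCoord n} (hz : z.1 ∈ overlap e e')
    (Z : JCoord n) (a : Base n) :
    along (fderiv ℝ (jTrans e e') z Z).2.2 (fderiv ℝ (transition e e') z.1 a)
        + along (jTrans e e' z).2.2 (fderiv ℝ (fderiv ℝ (transition e e')) z.1 Z.1 a)
      = (fderiv ℝ (fderiv ℝ (eTrans e e')) z.toE Z.toE (a, along z.2.2 a)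
          + fderiv ℝ (eTrans e e') z.toE (0, along Z.2.2 a)).2 := by
  have h0 : z + (0 : ℝ) • Z = z := by simp
  have hl := hasDerivAt_line z Z 0
  have h1 := ((contDiffAt_jTrans hz).differentiableAt (by simp)).hasDerivAt_line Z
  have h2 := hasDerivAt_fderiv_apply (f := transition e e') (t := 0) (c := fun t => (z + t • Z).1)
    (by rw [h0]; exact contDiffAt_transition hz) hl.prod_fst (hasDerivAt_const 0 a)
  have hE : HasDerivAt (fun t : ℝ => (z + t • Z).toE) Z.toE 0 := hl.prod_fst.prodMk hl.prod_snd.prod_fst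
  have h3 := hasDerivAt_fderiv_apply (f := eTrans e e') (t := 0)
    (by rw [h0]; exact contDiffAt_eTrans (w := z.toE) hz) hE
    ((hasDerivAt_const 0 a).prodMk (hl.prod_snd.prod_snd.along (hasDerivAt_const 0 a)))
  have h4 := h1.prod_snd.prod_snd.along h2
  have h5 := h4.unique (h3.prod_snd.congr_of_eventuallyEq (by
    filter_upwards [(tendsto_line z Z).eventually (eventually_fst_mem_overlap hz)] with t ht
    exact along_jTrans ht a))
  have ha0 : ∀ S : Fin n → Fib n, along S 0 = 0 := fun S => by simp [along]
  simpa [h0, ha0] using h5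

/-- The differentiated transformation laws determine the image of `Z`, because every vector is the
image of some `a`. Relatedness of fields on `J¹E` is checked through this criterion. -/
theorem fderiv_jTrans_eq {e e' : CoordSys n N} {z Z W : JCoord n} (hz : z.1 ∈ overlap e e')
    (h1 : W.toE = fderiv ℝ (eTrans e e') z.toE Z.toE)
    (h2 : ∀ a, along W.2.2 (fderiv ℝ (transition e e') z.1 a)
        + along (jTrans e e' z).2.2 (fderiv ℝ (fderiv ℝ (transition e e')) z.1 Z.1 a)
      = (fderiv ℝ (fderiv ℝ (eTrans e e')) z.toE Z.toE (a, along z.2.2 a)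
          + fderiv ℝ (eTrans e e') z.toE (0, along Z.2.2 a)).2) :
    fderiv ℝ (jTrans e e') z Z = W := by
  have h3 := (fderiv_jTrans_toE hz Z).trans h1.symm
  refine Prod.ext (congrArg Prod.fst h3 :) (Prod.ext (congrArg Prod.snd h3 :) (along_ext fun a => ?_))
  have h4 := (along_fderiv_jTrans hz Z
    (fderiv ℝ (transition e' e) (transition e e' z.1) a)).trans (h2 _).symm
  rw [fderiv_transition_right hz] at h4
  exact add_right_cancel h4

variable {p q : ℕ}

theorem isOpen_eDom (e : CoordSys n N) : IsOpen (eDom p q e) :=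
  (e.1.open_target.preimage continuous_fst).inter
    ((isOpen_hasSignature p q).preimage (continuous_fst.comp continuous_snd))

theorem continuous_toE : Continuous (JCoord.toE (n := n)) :=
  continuous_fst.prodMk (continuous_fst.comp continuous_snd)

theorem isOpen_jDom (e : CoordSys n N) : IsOpen (jDom p q e) :=
  (isOpen_eDom e).preimage continuous_toE

theorem eTrans_mem_eDom {e e' : CoordSys n N} {w : ECoord n} (hw : w ∈ eDom p q e)
    (hx : w.1 ∈ overlap e e') : eTrans e e' w ∈ eDom p q e' := by
  refine ⟨(transition_mem hx).1, ?_⟩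
  refine hw.2.of_val_eq_of_injective (fderiv ℝ (transition e e') w.1).toLinearMap ?_
    (eTrans_fst_val hx)
  exact Function.LeftInverse.injective (fderiv_transition_left hx)

theorem jTrans_mem_jDom {e e' : CoordSys n N} {z : JCoord n} (hz : z ∈ jDom p q e)
    (hx : z.1 ∈ overlap e e') : jTrans e e' z ∈ jDom p q e' := by
  change (jTrans e e' z).toE ∈ eDom p q e'
  rw [jTrans_toE hx]
  exact eTrans_mem_eDom hz hx

end JetTransition

/-! ### Related vector fields, their brackets, and the globality of `D^γ` -/

section RelatedFields

/-- The Lie brackets of related vector fields are related. -/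
theorem fderiv_lieBracket_of_related {E F : Type*} [NormedAddCommGroup E] [NormedSpace ℝ E]
    [NormedAddCommGroup F] [NormedSpace ℝ F] {f : E → F} {V W : E → E} {V' W' : F → F} {z : E}
    (hf : ContDiffAt ℝ ∞ f z) (hV : DifferentiableAt ℝ V z) (hW : DifferentiableAt ℝ W z)
    (hV' : DifferentiableAt ℝ V' (f z)) (hW' : DifferentiableAt ℝ W' (f z))
    (h1 : ∀ᶠ y in nhds z, fderiv ℝ f y (V y) = V' (f y))
    (h2 : ∀ᶠ y in nhds z, fderiv ℝ f y (W y) = W' (f y)) :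
    fderiv ℝ f z (VectorField.lieBracket ℝ V W z) = VectorField.lieBracket ℝ V' W' (f z) := by
  have hf' : DifferentiableAt ℝ (fderiv ℝ f) z :=
    (hf.fderiv_right (m := ∞) (by simp)).differentiableAt (by simp)
  -- Differentiate `f'(X) = X' ∘ f`. In the bracket the second derivatives of `f` cancel by
  -- symmetry.
  have key : ∀ {X : E → E} {X' : F → F}, DifferentiableAt ℝ X z → DifferentiableAt ℝ X' (f z) →
      (∀ᶠ y in nhds z, fderiv ℝ f y (X y) = X' (f y)) → ∀ Z,
      fderiv ℝ (fderiv ℝ f) z Z (X z) + fderiv ℝ f z (fderiv ℝ X z Z)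
        = fderiv ℝ X' (f z) (fderiv ℝ f z Z) := by
    intro X X' hX hX' h Z
    have e1 := hf'.hasFDerivAt.clm_apply hX.hasFDerivAt
    have e2 := hX'.hasFDerivAt.comp z (hf.differentiableAt (by simp)).hasFDerivAt
    have := DFunLike.congr_fun (e1.unique (e2.congr_of_eventuallyEq h)) Z
    simpa [add_comm] using this
  have a := key hW hW' h2 (V z)
  have b := key hV hV' h1 (W z)
  rw [h1.self_of_nhds] at a
  rw [h2.self_of_nhds] at b
  simp only [VectorField.lieBracket, map_sub]
  rw [← a, ← b, fderiv_fderiv_symm hf (V z) (W z)]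
  abel

variable {n : ℕ} {N : Type*} [TopologicalSpace N] [ChartedSpace (Base n) N] {p q : ℕ}

theorem IsVectorFieldOnJet.differentiableAt {Y : CoordSys n N → JCoord n → JCoord n}
    (hY : IsVectorFieldOnJet p q Y) {e : CoordSys n N} {z : JCoord n} (hz : z ∈ jDom p q e) :
    DifferentiableAt ℝ (Y e) z :=
  ((hY.1 e).contDiffAt ((isOpen_jDom e).mem_nhds hz)).differentiableAt (by simp)

theorem IsVectorFieldOnJet.jetBracket {Y W : CoordSys n N → JCoord n → JCoord n}
    (hY : IsVectorFieldOnJet p q Y) (hW : IsVectorFieldOnJet p q W) :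
    IsVectorFieldOnJet p q (jetBracket Y W) := by
  refine ⟨fun e z hz => ?_, fun e e' z hz hx => ?_⟩
  · have hn := (isOpen_jDom (p := p) (q := q) e).mem_nhds hz
    exact (ContDiffAt.lieBracket_vectorField ((hY.1 e).contDiffAt hn) ((hW.1 e).contDiffAt hn)
      (by simp)).contDiffWithinAt
  · have hev : ∀ᶠ z' in nhds z, z' ∈ jDom p q e ∧ z'.1 ∈ overlap e e' :=
      Filter.Eventually.and ((isOpen_jDom e).mem_nhds hz) (eventually_fst_mem_overlap hx)
    have hz' := jTrans_mem_jDom hz hx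
    exact fderiv_lieBracket_of_related (contDiffAt_jTrans hx) (hY.differentiableAt hz)
      (hW.differentiableAt hz) (hY.differentiableAt hz') (hW.differentiableAt hz')
      (hev.mono fun y hy => hY.2 e e' y hy.1 hy.2) (hev.mono fun y hy => hW.2 e e' y hy.1 hy.2)

theorem EhresmannConnection.form_apply (γ : EhresmannConnection n N p q) {e : CoordSys n N}
    {w : ECoord n} (hw : w ∈ eDom p q e) (a : Base n) (f : Fib n) :
    γ.form e w (a, f) = γ.form e w (a, 0) + f := by
  rw [← γ.vertical e w hw f, ← map_add]
  simp [γ.vertical e w hw f]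

theorem EhresmannConnection.along_vert (γ : EhresmannConnection n N p q) (e : CoordSys n N)
    (z : JCoord n) (a : Base n) :
    along (γ.vert e z).2.2 a = γ.form e z.toE (a, along z.2.2 a) := by
  simp only [along, EhresmannConnection.vert, ← map_smul, ← map_sum]
  congr 1
  refine Prod.ext ?_ ?_
  · simp only [Prod.fst_sum, Prod.smul_fst]
    exact sum_smul_single a
  · simp only [Prod.snd_sum, Prod.smul_snd]

theorem EhresmannConnection.contDiffAt_vert (γ : EhresmannConnection n N p q) {e : CoordSys n N}
    {z : JCoord n} (hz : z ∈ jDom p q e) : ContDiffAt ℝ ∞ (γ.vert e) z := by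
  have hγ : ContDiffAt ℝ ∞ (fun z : JCoord n => γ.form e z.toE) z :=
    ContDiffAt.comp (g := γ.form e) z ((γ.smooth e).contDiffAt ((isOpen_eDom e).mem_nhds hz))
      (contDiffAt_toE z)
  refine contDiffAt_const.prodMk (contDiffAt_const.prodMk (contDiffAt_pi.2 fun i => ?_))
  exact hγ.clm_apply (contDiffAt_const.prodMk (contDiffAt_pi.1 contDiffAt_snd.snd i))

/-- Since `D^γ` has no component along `E`, all second derivatives of the coordinate change drop out
and the compatibility of `γ` is what remains. -/
theorem EhresmannConnection.isVectorFieldOnJet_vert (γ : EhresmannConnection n N p q) :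
    IsVectorFieldOnJet p q γ.vert := by
  refine ⟨fun e z hz => (γ.contDiffAt_vert hz).contDiffWithinAt, fun e e' z hz hx => ?_⟩
  refine fderiv_jTrans_eq hx ?_ fun a => ?_
  · change ((0, 0) : ECoord n) = fderiv ℝ (eTrans e e') z.toE ((0, 0) : ECoord n)
    exact (map_zero _).symm
  · rw [γ.along_vert, γ.along_vert, γ.compat e e' _ hz hx]
    change _ + along _ (fderiv ℝ (fderiv ℝ (transition e e')) z.1 (0 : Base n) a)
      = (fderiv ℝ (fderiv ℝ (eTrans e e')) z.toE (0 : ECoord n) (a, along z.2.2 a) + _).2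
    have ha0 : ∀ S : Fin n → Fib n, along S 0 = 0 := fun S => by simp [along]
    simp only [map_zero, zero_apply, ha0, add_zero, zero_add]
    rw [jTrans_toE hx, along_jTrans hx]
    congr 1
    exact Prod.ext (fderiv_eTrans_fst (w := z.toE) hx (a, along z.2.2 a)).symm rfl

end RelatedFields

/-! ### Symmetry of third derivatives -/

section ThirdDerivative

variable {E F : Type*} [NormedAddCommGroup E] [NormedSpace ℝ E] [NormedAddCommGroup F]
  [NormedSpace ℝ F] {f : E → F} {x : E}

theorem fderiv_fderiv_fderiv_symm_left (hf : ContDiffAt ℝ ∞ f x) (a b c : E) :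
    fderiv ℝ (fderiv ℝ (fderiv ℝ f)) x a b c = fderiv ℝ (fderiv ℝ (fderiv ℝ f)) x b a c :=
  DFunLike.congr_fun (fderiv_fderiv_symm (hf.fderiv_right (m := ∞) (by simp)) a b) c

theorem hasDerivAt_fderiv_fderiv_apply {c : ℝ → E} {c' : E} {a b : ℝ → E}
    {a' b' : E} {t : ℝ} (hf : ContDiffAt ℝ ∞ f (c t)) (hc : HasDerivAt c c' t)
    (ha : HasDerivAt a a' t) (hb : HasDerivAt b b' t) :
    HasDerivAt (fun s => fderiv ℝ (fderiv ℝ f) (c s) (a s) (b s))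
      (fderiv ℝ (fderiv ℝ (fderiv ℝ f)) (c t) c' (a t) (b t)
        + fderiv ℝ (fderiv ℝ f) (c t) a' (b t) + fderiv ℝ (fderiv ℝ f) (c t) (a t) b') t :=
  (hasDerivAt_fderiv_apply (hf.fderiv_right (m := ∞) (by simp)) hc ha).clm_apply hb

/-- Second derivatives are symmetric at all nearby points; this symmetry is differentiated along
`a`. -/
theorem fderiv_fderiv_fderiv_symm_right (hf : ContDiffAt ℝ ∞ f x) (a b c : E) :
    fderiv ℝ (fderiv ℝ (fderiv ℝ f)) x a b c = fderiv ℝ (fderiv ℝ (fderiv ℝ f)) x a c b := by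
  have hx0 : x + (0 : ℝ) • a = x := by simp
  have h : ∀ b c, HasDerivAt (fun t : ℝ => fderiv ℝ (fderiv ℝ f) (x + t • a) b c)
      (fderiv ℝ (fderiv ℝ (fderiv ℝ f)) x a b c) 0 := fun b c => by
    have := hasDerivAt_fderiv_fderiv_apply (f := f) (t := 0) (by rw [hx0]; exact hf)
      (hasDerivAt_line x a 0) (hasDerivAt_const 0 b) (hasDerivAt_const 0 c)
    simpa [hx0] using this
  refine (h b c).unique ((h c b).congr_of_eventuallyEq ?_)
  have hev : ∀ᶠ y in nhds x, ContDiffAt ℝ 2 f y :=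
    (hf.of_le (by simpa using WithTop.coe_le_coe.2 (le_top (a := (2 : ℕ∞))))).eventually (by simp)
  filter_upwards [(tendsto_line x a).eventually hev] with t ht
  exact (ht.isSymmSndFDerivAt (by simp)) b c

end ThirdDerivative

/-! ### The natural lift and the first jet prolongation -/

section NaturalLift

variable {n : ℕ}

theorem liftFib_fst_val (u : Base n → Base n) (w : ECoord n) (a b : Base n) :
    (liftFib u w).1.val a b
      = -(w.2.1.val (fderiv ℝ u w.1 a) b + w.2.1.val a (fderiv ℝ u w.1 b)) := by
  simp only [liftFib, SymForm.val_neg_form, SymForm.val_infPull, along_pd]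

theorem liftFib_snd_app {u : Base n → Base n} {w : ECoord n}
    (hu : DifferentiableAt ℝ (fderiv ℝ u) w.1)
    (a b : Base n) :
    (liftFib u w).2.app a b = -fderiv ℝ (fderiv ℝ u) w.1 a b + fderiv ℝ u w.1 (w.2.2.app a b)
      - w.2.2.app a (fderiv ℝ u w.1 b) - w.2.2.app (fderiv ℝ u w.1 a) b := by
  set P := fderiv ℝ u w.1 with hP
  refine ConnForm.app_eq_bilinear
    (-bilinOfCLM (fderiv ℝ (fderiv ℝ u) w.1) + w.2.2.bilin.compr₂ P.toLinearMap
      - w.2.2.bilin.compl₂ P.toLinearMap - w.2.2.bilin.comp P.toLinearMap) ?_ a b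
  intro i j k
  change _ = (-fderiv ℝ (fderiv ℝ u) w.1 (EuclideanSpace.single j 1) (EuclideanSpace.single k 1)
    + P (w.2.2.app (EuclideanSpace.single j 1) (EuclideanSpace.single k 1))
    - w.2.2.app (EuclideanSpace.single j 1) (P (EuclideanSpace.single k 1))
    - w.2.2.app (P (EuclideanSpace.single j 1)) (EuclideanSpace.single k 1)) i
  rw [← pd_pd hu]
  have h1 : ∀ v, P v i = ∑ l, v l * pd l u w.1 i := fun v => by
    rw [hP, ← along_pd]; simp [along]
  have h2 : ∀ v, w.2.2.app (EuclideanSpace.single j 1) v i = ∑ l, v l * w.2.2 i j l := fun v => by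
    conv_lhs => rw [← sum_smul_single v, ConnForm.app_sum_right]
    simp only [ConnForm.app_smul_right, WithLp.ofLp_sum, Finset.sum_apply, WithLp.ofLp_smul,
      Pi.smul_apply, smul_eq_mul, ConnForm.app_single]
  have h3 : ∀ v, w.2.2.app v (EuclideanSpace.single k 1) i = ∑ l, v l * w.2.2 i l k := fun v => by
    conv_lhs => rw [← sum_smul_single v, ConnForm.app_sum_left]
    simp only [ConnForm.app_smul_left, WithLp.ofLp_sum, Finset.sum_apply, WithLp.ofLp_smul,
      Pi.smul_apply, smul_eq_mul, ConnForm.app_single]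
  simp only [PiLp.sub_apply, PiLp.add_apply, PiLp.neg_apply, h1, h2, h3, ConnForm.app_single,
    liftFib, Finset.sum_sub_distrib]
  simp only [pd, ← hP, mul_comm]
  ring

theorem contDiffAt_liftFib {u : Base n → Base n} {w : ECoord n} (hu : ContDiffAt ℝ ∞ u w.1) :
    ContDiffAt ℝ ∞ (liftFib u) w := by
  have h1 : ContDiffAt ℝ ∞ (fun w : ECoord n => w.1) w := contDiffAt_fst
  have hpd : ∀ k i, ContDiffAt ℝ ∞ (fun w : ECoord n => pd k u w.1 i) w := fun k i =>
    (contDiffAt_piLp 2).1 (ContDiffAt.pd (c := fun w : ECoord n => w.1) hu h1 k) i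
  have hpd2 : ∀ j k i, ContDiffAt ℝ ∞ (fun w : ECoord n => pd j (pd k u) w.1 i) w := fun j k i =>
    (contDiffAt_piLp 2).1 (ContDiffAt.pd (c := fun w : ECoord n => w.1)
      (ContDiffAt.pd (c := fun x => x) hu contDiffAt_id k) h1 j) i
  have hg : ∀ s, ContDiffAt ℝ ∞ (fun w : ECoord n => w.2.1 s) w := fun s =>
    contDiffAt_pi.1 (contDiffAt_snd.fst) s
  have hA : ∀ i j k, ContDiffAt ℝ ∞ (fun w : ECoord n => w.2.2 i j k) w := fun i j k =>
    contDiffAt_pi.1 (contDiffAt_pi.1 (contDiffAt_pi.1 contDiffAt_snd.snd i) j) k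
  refine ContDiffAt.prodMk (ContDiffAt.neg (contDiffAt_pi.2 fun s => ?_))
    (contDiffAt_pi.2 fun i => contDiffAt_pi.2 fun j => contDiffAt_pi.2 fun k => ?_)
  · induction s using Sym2.ind with
    | _ i j =>
      change ContDiffAt ℝ ∞ (fun w : ECoord n =>
        ∑ h, (pd i u w.1 h * w.2.1 s(h, j) + pd j u w.1 h * w.2.1 s(i, h))) w
      exact ContDiffAt.sum fun h _ => ((hpd i h).mul (hg _)).add ((hpd j h).mul (hg _))
  · exact (hpd2 j k i).neg.add (ContDiffAt.sum fun l _ =>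
      (((hpd l i).mul (hA l j k)).sub ((hpd k l).mul (hA i j l))).sub ((hpd j l).mul (hA i l k)))

theorem contDiffAt_prolong {u : Base n → Base n} {v : ECoord n → Fib n} {z : JCoord n}
    (hu : ContDiffAt ℝ ∞ u z.1) (hv : ContDiffAt ℝ ∞ v z.toE) :
    ContDiffAt ℝ ∞ (prolong u v) z := by
  have h1 : ContDiffAt ℝ ∞ (fun z : JCoord n => z.1) z := contDiffAt_fst
  have hS : ∀ k, ContDiffAt ℝ ∞ (fun z : JCoord n => z.2.2 k) z := fun k =>
    contDiffAt_pi.1 contDiffAt_snd.snd k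
  refine (ContDiffAt.comp (g := u) z hu h1).prodMk
    ((ContDiffAt.comp (g := v) z hv (contDiffAt_toE z)).prodMk (contDiffAt_pi.2 fun i => ?_))
  refine ContDiffAt.sub ?_ (ContDiffAt.sum fun k _ => ?_)
  · exact (ContDiffAt.comp (g := fderiv ℝ v) z (hv.fderiv_right (by simp))
      (contDiffAt_toE z)).clm_apply (contDiffAt_const.prodMk (hS i))
  · exact ((contDiffAt_piLp 2).1 (ContDiffAt.pd (c := fun z : JCoord n => z.1) hu h1 i) k).smul
      (hS k)

/-- The pair `(a, along z.2.2 a)` is the tangent vector in the direction `a` of any section with jet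
`z`. -/
theorem along_prolong (u : Base n → Base n) (v : ECoord n → Fib n) (z : JCoord n) (a : Base n) :
    along (prolong u v z).2.2 a
      = fderiv ℝ v z.toE (a, along z.2.2 a) - along z.2.2 (fderiv ℝ u z.1 a) := by
  have h1 : along (fun i => fderiv ℝ v z.toE (EuclideanSpace.single i 1, z.2.2 i)) a
      = fderiv ℝ v z.toE (a, along z.2.2 a) := by
    simp only [along, ← map_smul, ← map_sum]
    congr 1
    refine Prod.ext ?_ ?_
    · simp only [Prod.fst_sum, Prod.smul_fst]
      exact sum_smul_single a
    · simp only [Prod.snd_sum, Prod.smul_snd]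
  rw [← h1, ← along_pd]
  have h2 := along_linear (IsLinearMap.mk' (along z.2.2) ⟨along_add _, along_smul _⟩)
    (fun i => pd i u z.1) a
  exact (along_sub_left _ (fun i => ∑ k, pd i u z.1 k • z.2.2 k) a).trans
    (congrArg₂ (· - ·) rfl h2)

variable {N : Type*} [TopologicalSpace N] [ChartedSpace (Base n) N]

/-- First and second derivatives of the relation between the two local expressions of a vector
field. -/
theorem fderiv_related {e e' : CoordSys n N} {u u' : Base n → Base n} {x : Base n}
    (hx : x ∈ overlap e e') (hu : DifferentiableAt ℝ u x)
    (hu' : DifferentiableAt ℝ u' (transition e e' x))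
    (h : ∀ᶠ y in nhds x, fderiv ℝ (transition e e') y (u y) = u' (transition e e' y))
    (a : Base n) :
    fderiv ℝ u' (transition e e' x) (fderiv ℝ (transition e e') x a)
      = fderiv ℝ (fderiv ℝ (transition e e')) x a (u x)
        + fderiv ℝ (transition e e') x (fderiv ℝ u x a) := by
  have hx0 : x + (0 : ℝ) • a = x := by simp
  have h1 := hu'.hasFDerivAt.comp_hasDerivAt_of_eq 0
    ((differentiableAt_transition hx).hasDerivAt_line a) (by simp)
  have h2 := hasDerivAt_fderiv_apply (f := transition e e') (t := 0)
    (by rw [hx0]; exact contDiffAt_transition hx) (hasDerivAt_line x a 0)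
    (hu.hasDerivAt_line a)
  rw [hx0] at h2
  exact h1.unique (h2.congr_of_eventuallyEq (((tendsto_line x a).eventually h).mono
    fun t ht => ht.symm))

/-- The identity `fderiv_related` holds at nearby points and is differentiated once more along `a`.
-/
theorem snd_fderiv_related {e e' : CoordSys n N} {u u' : Base n → Base n} {x : Base n}
    (hx : x ∈ overlap e e') (hu : ContDiffAt ℝ ∞ u x) (hu' : ContDiffAt ℝ ∞ u' (transition e e' x))
    (h : ∀ᶠ y in nhds x, fderiv ℝ (transition e e') y (u y) = u' (transition e e' y))
    (a b : Base n) :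
    fderiv ℝ (fderiv ℝ u') (transition e e' x) (fderiv ℝ (transition e e') x a)
          (fderiv ℝ (transition e e') x b)
        + fderiv ℝ u' (transition e e' x) (fderiv ℝ (fderiv ℝ (transition e e')) x a b)
      = fderiv ℝ (fderiv ℝ (fderiv ℝ (transition e e'))) x a b (u x)
        + fderiv ℝ (fderiv ℝ (transition e e')) x b (fderiv ℝ u x a)
        + (fderiv ℝ (fderiv ℝ (transition e e')) x a (fderiv ℝ u x b)
        + fderiv ℝ (transition e e') x (fderiv ℝ (fderiv ℝ u) x a b)) := by
  have hx0 : x + (0 : ℝ) • a = x := by simp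
  have hτ := contDiffAt_transition hx
  have hl := hasDerivAt_line x a 0
  have k1 := hasDerivAt_fderiv_apply (f := u') (t := 0) (c := fun t => transition e e' (x + t • a))
    (by rw [hx0]; exact hu') ((differentiableAt_transition hx).hasDerivAt_line a)
    (hasDerivAt_fderiv_apply (f := transition e e') (t := 0) (by rw [hx0]; exact hτ) hl
      (hasDerivAt_const 0 b))
  have k2 := hasDerivAt_fderiv_fderiv_apply (f := transition e e') (t := 0)
    (by rw [hx0]; exact hτ) hl (hasDerivAt_const 0 b)
    ((hu.differentiableAt (by simp)).hasDerivAt_line a)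
  have k3 := hasDerivAt_fderiv_apply (f := transition e e') (t := 0) (by rw [hx0]; exact hτ) hl
    (hasDerivAt_fderiv_apply (f := u) (t := 0) (by rw [hx0]; exact hu) hl (hasDerivAt_const 0 b))
  have := k1.unique ((k2.add k3).congr_of_eventuallyEq ?_)
  · simpa [hx0] using this
  have e1 := (hu.of_le (m := 1) (by simp)).eventually (by simp)
  have e2 := (differentiableAt_transition hx).continuousAt.eventually
    ((hu'.of_le (m := 1) (by simp)).eventually (by simp))
  filter_upwards [(tendsto_line x a).eventually (((eventually_mem_overlap hx).and
    h.eventually_nhds).and (e1.and e2))] with t ht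
  simpa using fderiv_related ht.1.1 (ht.2.1.differentiableAt (by simp))
    (ht.2.2.differentiableAt (by simp)) ht.1.2 b

end NaturalLift

/-! ### Lifts and prolongations are compatible with coordinate changes -/

section Naturality

variable {n : ℕ} {N : Type*} [TopologicalSpace N] [ChartedSpace (Base n) N]

theorem SymForm.ext_val_transition {e e' : CoordSys n N} {x : Base n} (hx : x ∈ overlap e e')
    {g g' : SymForm n}
    (h : ∀ a b, g.val (fderiv ℝ (transition e e') x a) (fderiv ℝ (transition e e') x b)
      = g'.val (fderiv ℝ (transition e e') x a) (fderiv ℝ (transition e e') x b)) : g = g' :=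
  SymForm.ext_val fun a b => by
    have := h (fderiv ℝ (transition e' e) (transition e e' x) a)
      (fderiv ℝ (transition e' e) (transition e e' x) b)
    rwa [fderiv_transition_right hx, fderiv_transition_right hx] at this

theorem ConnForm.ext_app_transition {e e' : CoordSys n N} {x : Base n} (hx : x ∈ overlap e e')
    {A A' : ConnForm n}
    (h : ∀ a b, A.app (fderiv ℝ (transition e e') x a) (fderiv ℝ (transition e e') x b)
      = A'.app (fderiv ℝ (transition e e') x a) (fderiv ℝ (transition e e') x b)) : A = A' :=
  ConnForm.ext_app fun a b => by
    have := h (fderiv ℝ (transition e' e) (transition e e' x) a)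
      (fderiv ℝ (transition e' e) (transition e e' x) b)
    rwa [fderiv_transition_right hx, fderiv_transition_right hx] at this

/-- Derivative of the transformation law of the metric. -/
theorem fderiv_eTrans_fst_val {e e' : CoordSys n N} {w : ECoord n} (hw : w.1 ∈ overlap e e')
    (Z : ECoord n) (a b : Base n) :
    (fderiv ℝ (eTrans e e') w Z).2.1.val (fderiv ℝ (transition e e') w.1 a)
        (fderiv ℝ (transition e e') w.1 b)
      + (eTrans e e' w).2.1.val (fderiv ℝ (fderiv ℝ (transition e e')) w.1 Z.1 a)
        (fderiv ℝ (transition e e') w.1 b)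
      + (eTrans e e' w).2.1.val (fderiv ℝ (transition e e') w.1 a)
        (fderiv ℝ (fderiv ℝ (transition e e')) w.1 Z.1 b)
      = Z.2.1.val a b := by
  have h0 : w + (0 : ℝ) • Z = w := by simp
  have hl := hasDerivAt_line w Z 0
  have h1 := ((contDiffAt_eTrans hw).differentiableAt (by simp)).hasDerivAt_line Z
  have h2 := fun a => hasDerivAt_fderiv_apply (f := transition e e') (t := 0)
    (c := fun t => (w + t • Z).1)
    (by rw [h0]; exact contDiffAt_transition hw) hl.prod_fst (hasDerivAt_const 0 a)
  have h3 := h1.prod_snd.prod_fst.symForm_val (h2 a) (h2 b)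
  have h4 := hl.prod_snd.prod_fst.symForm_val (hasDerivAt_const 0 a) (hasDerivAt_const 0 b)
  have hz1 : ∀ (g : SymForm n) (v : Base n), g.val 0 v = 0 := fun g v => by simp [SymForm.val]
  have hz2 : ∀ (g : SymForm n) (v : Base n), g.val v 0 = 0 := fun g v => by simp [SymForm.val]
  have := h3.unique (h4.congr_of_eventuallyEq ?_)
  · simpa [h0, hz1, hz2] using this
  · filter_upwards [(tendsto_line w Z).eventually
      (continuousAt_fst.eventually (eventually_mem_overlap hw))] with t ht
    exact eTrans_fst_val ht a b

/-- Derivative of the transformation law of the connection. -/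
theorem fderiv_eTrans_snd_app {e e' : CoordSys n N} {w : ECoord n} (hw : w.1 ∈ overlap e e')
    (Z : ECoord n) (a b : Base n) :
    (fderiv ℝ (eTrans e e') w Z).2.2.app (fderiv ℝ (transition e e') w.1 a)
        (fderiv ℝ (transition e e') w.1 b)
      + (eTrans e e' w).2.2.app (fderiv ℝ (fderiv ℝ (transition e e')) w.1 Z.1 a)
        (fderiv ℝ (transition e e') w.1 b)
      + (eTrans e e' w).2.2.app (fderiv ℝ (transition e e') w.1 a)
        (fderiv ℝ (fderiv ℝ (transition e e')) w.1 Z.1 b)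
      = fderiv ℝ (fderiv ℝ (transition e e')) w.1 Z.1 (w.2.2.app a b)
        + fderiv ℝ (transition e e') w.1 (Z.2.2.app a b)
        - fderiv ℝ (fderiv ℝ (fderiv ℝ (transition e e'))) w.1 Z.1 a b := by
  have h0 : w + (0 : ℝ) • Z = w := by simp
  have hl := hasDerivAt_line w Z 0
  have h1 := ((contDiffAt_eTrans hw).differentiableAt (by simp)).hasDerivAt_line Z
  have hτ : ContDiffAt ℝ ∞ (transition e e') (w + (0 : ℝ) • Z).1 := by
    rw [h0]; exact contDiffAt_transition hw
  have h2 := fun a => hasDerivAt_fderiv_apply (f := transition e e') (t := 0)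
    (c := fun t => (w + t • Z).1) hτ hl.prod_fst (hasDerivAt_const 0 a)
  have h3 := h1.prod_snd.prod_snd.connForm_app (h2 a) (h2 b)
  have h4 := hl.prod_snd.prod_snd.connForm_app (hasDerivAt_const 0 a) (hasDerivAt_const 0 b)
  have h5 := hasDerivAt_fderiv_apply (f := transition e e') (t := 0)
    (c := fun t => (w + t • Z).1) hτ hl.prod_fst h4
  have h6 := hasDerivAt_fderiv_fderiv_apply (f := transition e e') (t := 0)
    (c := fun t => (w + t • Z).1) hτ hl.prod_fst (hasDerivAt_const 0 a) (hasDerivAt_const 0 b)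
  have hz1 : ∀ (A : ConnForm n) (v : Base n), A.app 0 v = 0 := fun A v => by
    simpa using A.app_smul_left 0 0 v
  have hz2 : ∀ (A : ConnForm n) (v : Base n), A.app v 0 = 0 := fun A v => by
    simpa using A.app_smul_right 0 v 0
  have := h3.unique ((h5.sub h6).congr_of_eventuallyEq ?_)
  · simpa [h0, hz1, hz2] using this
  · filter_upwards [(tendsto_line w Z).eventually
      (continuousAt_fst.eventually (eventually_mem_overlap hw))] with t ht
    exact eTrans_snd_app ht a b

/-- The natural lift to `M ×_N C` is compatible with coordinate changes. -/
theorem fderiv_eTrans_lift {e e' : CoordSys n N} {u u' : Base n → Base n} {w : ECoord n}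
    (hw : w.1 ∈ overlap e e') (hu : ContDiffAt ℝ ∞ u w.1)
    (hu' : ContDiffAt ℝ ∞ u' (transition e e' w.1))
    (h : ∀ᶠ y in nhds w.1, fderiv ℝ (transition e e') y (u y) = u' (transition e e' y)) :
    fderiv ℝ (eTrans e e') w (u w.1, liftFib u w)
      = (u' (transition e e' w.1), liftFib u' (eTrans e e' w)) := by
  have hτ := contDiffAt_transition hw
  have hD := fun a => fderiv_related hw (hu.differentiableAt (by simp))
    (hu'.differentiableAt (by simp)) h a
  have hD2 := fun a b => snd_fderiv_related hw hu hu' h a b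
  have hfst : (eTrans e e' w).1 = transition e e' w.1 := rfl
  refine Prod.ext ?_ (Prod.ext ?_ ?_)
  · rw [fderiv_eTrans_fst hw]
    exact h.self_of_nhds
  · refine SymForm.ext_val_transition hw fun a b => ?_
    have h1 := fderiv_eTrans_fst_val hw (u w.1, liftFib u w) a b
    simp only [liftFib_fst_val, hfst, hD, SymForm.val_add_left, SymForm.val_add_right,
      eTrans_fst_val hw] at h1 ⊢
    rw [fderiv_fderiv_symm hτ a, fderiv_fderiv_symm hτ b]
    linarith
  · refine ConnForm.ext_app_transition hw fun a b => ?_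
    have h1 := fderiv_eTrans_snd_app hw (u w.1, liftFib u w) a b
    have h2 := hD2 a b
    simp only [liftFib_snd_app hu.differentiableAt_fderiv] at h1
    rw [liftFib_snd_app (by exact hu'.differentiableAt_fderiv)]
    simp only [hfst, hD, ConnForm.app_add_left, ConnForm.app_add_right, eTrans_snd_app hw,
      map_sub, map_add, map_neg] at h1 h2 ⊢
    -- Both `h1` and `h2` contain the higher derivatives of the coordinate change, with arguments in
    -- different orders; symmetry aligns them so that they cancel.
    rw [fderiv_fderiv_fderiv_symm_left hτ (u w.1) a b,
      fderiv_fderiv_fderiv_symm_right hτ a (u w.1) b,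
      fderiv_fderiv_symm hτ (u w.1) (w.2.2.app a b), fderiv_fderiv_symm hτ (u w.1) a,
      fderiv_fderiv_symm hτ (u w.1) b] at h1
    rw [fderiv_fderiv_symm hτ b (fderiv ℝ u w.1 a)] at h2
    linear_combination (norm := module) h1 + h2

/-- Prolongations of related vector fields are related. -/
theorem fderiv_jTrans_prolong {e e' : CoordSys n N} {u u' : Base n → Base n}
    {v v' : ECoord n → Fib n} {z : JCoord n}
    (hz : z.1 ∈ overlap e e') (hu : DifferentiableAt ℝ u z.1)
    (hu' : DifferentiableAt ℝ u' (transition e e' z.1))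
    (hv : DifferentiableAt ℝ v z.toE) (hv' : DifferentiableAt ℝ v' (eTrans e e' z.toE))
    (h : ∀ᶠ y in nhds z.1, fderiv ℝ (transition e e') y (u y) = u' (transition e e' y))
    (h' : ∀ᶠ w in nhds z.toE,
      fderiv ℝ (eTrans e e') w (u w.1, v w) = (u' (transition e e' w.1), v' (eTrans e e' w))) :
    fderiv ℝ (jTrans e e') z (prolong u v z) = prolong u' v' (jTrans e e' z) := by
  have hE := jTrans_toE hz
  have hΦ := contDiffAt_eTrans (w := z.toE) hz
  refine fderiv_jTrans_eq hz ?_ fun a => ?_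
  · change (u' (transition e e' z.1), v' (jTrans e e' z).toE) = fderiv ℝ (eTrans e e') z.toE
      (u z.1, v z.toE)
    rw [hE]
    exact h'.self_of_nhds.symm
  -- The relation `h'` on `E` is differentiated along `V`, the tangent vector of a section with jet
  -- `z`.
  · set V : ECoord n := (a, along z.2.2 a) with hV
    have hV' : (fderiv ℝ (transition e e') z.1 a,
        along (jTrans e e' z).2.2 (fderiv ℝ (transition e e') z.1 a))
        = fderiv ℝ (eTrans e e') z.toE V := by
      rw [along_jTrans hz]
      exact Prod.ext (fderiv_eTrans_fst (w := z.toE) hz V).symm rfl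
    have h0 : z.toE + (0 : ℝ) • V = z.toE := by simp
    have hl := hasDerivAt_line z.toE V 0
    have hΦl := (hΦ.differentiableAt (by simp)).hasDerivAt_line V
    have k1 := hv'.hasFDerivAt.comp_hasDerivAt_of_eq 0 hΦl (by simp)
    have hu1 : HasDerivAt (fun t : ℝ => u (z.toE + t • V).1) (fderiv ℝ u z.1 a) 0 :=
      hu.hasDerivAt_line a
    have k2 := hasDerivAt_fderiv_apply (f := eTrans e e') (t := 0) (by rw [h0]; exact hΦ) hl
      (hu1.prodMk (hv.hasDerivAt_line V))
    have key := k1.unique (k2.prod_snd.congr_of_eventuallyEq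
      (((tendsto_line z.toE V).eventually h').mono fun t ht => (congrArg Prod.snd ht).symm))
    rw [h0] at key
    rw [along_prolong, along_prolong, hE, jTrans_fst, hV', key,
      fderiv_related hz hu hu' h, along_add]
    rw [along_jTrans hz (fderiv ℝ u z.1 a)]
    change _ + along _ (fderiv ℝ (fderiv ℝ (transition e e')) z.1 (u z.1) a) = _
    rw [fderiv_fderiv_symm (contDiffAt_transition hz) (u z.1) a,
      fderiv_fderiv_symm hΦ _ (a, along z.2.2 a)]
    -- Split into a vector tangent to a section with jet `z` and a vertical one; by `along_prolong`
    -- the latter is the jet component of the prolongation.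
    have e1 : ((fderiv ℝ u z.1 a, fderiv ℝ v z.toE V) : ECoord n)
        = (fderiv ℝ u z.1 a, along z.2.2 (fderiv ℝ u z.1 a))
          + (0, fderiv ℝ v z.toE V - along z.2.2 (fderiv ℝ u z.1 a)) := by
      refine Prod.ext ?_ ?_ <;> simp
    rw [e1, map_add, ← hV]
    simp only [Prod.snd_add]
    have e2 : (prolong u v z).toE = (u z.toE.1, v z.toE) := rfl
    rw [e2]
    abel

end Naturality

/-! ### Local expressions of global vector fields -/

section LocalExpression

variable {n : ℕ} {N : Type*} [TopologicalSpace N] [ChartedSpace (Base n) N]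

theorem localExpr_transition (X : (x : N) → TangentSpace (𝓡 n) x) {e e' : CoordSys n N}
    {x : Base n} (hx : x ∈ overlap e e') :
    fderiv ℝ (transition e e') x (localExpr X e x) = localExpr X e' (transition e e' x) := by
  have hd : ∀ (e : CoordSys n N) {y : N}, y ∈ e.1.source →
      MDifferentiableAt (𝓡 n) 𝓘(ℝ, Base n) e.1 y := fun e y hy =>
    ((contMDiffOn_of_mem_maximalAtlas e.2).contMDiffAt (e.1.open_source.mem_nhds hy)).mdifferentiableAt
      (by simp)
  have hy := e.1.map_target hx.1
  have h1 : HasMFDerivAt 𝓘(ℝ, Base n) 𝓘(ℝ, Base n) (transition e e') (e.1 (e.1.symm x))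
      (fderiv ℝ (transition e e') x) := by
    rw [e.1.right_inv hx.1]
    exact (differentiableAt_transition hx).hasFDerivAt.hasMFDerivAt
  have h2 := h1.comp (e.1.symm x) (hd e hy).hasMFDerivAt
  have h3 := (hd e' hx.2).hasMFDerivAt
  have h4 := h3.congr_of_eventuallyEq (f₁ := transition e e' ∘ e.1) (by
    filter_upwards [e.1.open_source.mem_nhds hy] with y hy
    simp [transition, e.1.left_inv hy])
  have h5 := hasMFDerivAt_unique h2 h4
  have := DFunLike.congr_fun h5 (X (e.1.symm x))
  rw [localExpr, localExpr]
  have e3 : e'.1.symm (transition e e' x) = e.1.symm x := e'.1.left_inv hx.2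
  rw [e3]
  exact this

variable [IsManifold (𝓡 n) ∞ N] {p q : ℕ}

theorem contDiffAt_localExpr {X : (x : N) → TangentSpace (𝓡 n) x} (hX : IsSmoothVectorField X)
    (e : CoordSys n N) {x : Base n} (hx : x ∈ e.1.target) : ContDiffAt ℝ ∞ (localExpr X e) x := by
  have h1 : ContMDiffOn (𝓡 n).tangent 𝓘(ℝ, Base n).tangent ∞
      (tangentMapWithin (𝓡 n) 𝓘(ℝ, Base n) e.1 e.1.source)
      ((Bundle.TotalSpace.proj : TangentBundle (𝓡 n) N → N) ⁻¹' e.1.source) :=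
    (contMDiffOn_of_mem_maximalAtlas e.2).contMDiffOn_tangentMapWithin (by simp)
      e.1.open_source.uniqueMDiffOn
  have h2 : ContMDiffOn 𝓘(ℝ, Base n) (𝓡 n).tangent ∞
      (fun y => (⟨e.1.symm y, X (e.1.symm y)⟩ : TangentBundle (𝓡 n) N)) e.1.target :=
    hX.comp_contMDiffOn (contMDiffOn_symm_of_mem_maximalAtlas e.2)
  have h3 := h1.comp h2 (fun y hy => e.1.map_target hy)
  have h4 : ContMDiffAt 𝓘(ℝ, Base n) 𝓘(ℝ, Base n).tangent ∞
      (fun y => (⟨y, localExpr X e y⟩ : TangentBundle 𝓘(ℝ, Base n) (Base n))) x := by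
    refine ((h3.congr ?_).contMDiffAt (e.1.open_target.mem_nhds hx))
    intro y hy
    simp only [Function.comp, tangentMapWithin, localExpr]
    rw [mfderivWithin_of_isOpen e.1.open_source (e.1.map_target hy), e.1.right_inv hy]
  have := (contMDiffAt_vectorSpace_iff_contDiffAt (V := localExpr X e)).1 h4
  exact this

theorem contDiffAt_jetLift {X : (x : N) → TangentSpace (𝓡 n) x} (hX : IsSmoothVectorField X)
    {e : CoordSys n N} {z : JCoord n} (hz : z.1 ∈ e.1.target) : ContDiffAt ℝ ∞ (jetLift X e) z :=
  contDiffAt_prolong (contDiffAt_localExpr hX e hz)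
    (contDiffAt_liftFib (w := z.toE) (contDiffAt_localExpr hX e hz))

/-- This is what makes `jetLift X` an element of `Γ(𝒟)`. -/
theorem isVectorFieldOnJet_jetLift {X : (x : N) → TangentSpace (𝓡 n) x}
    (hX : IsSmoothVectorField X) : IsVectorFieldOnJet p q (jetLift X) := by
  refine ⟨fun e z hz => (contDiffAt_jetLift hX hz.1).contDiffWithinAt, fun e e' z hz hx => ?_⟩
  have hu := contDiffAt_localExpr hX e (x := z.1) hx.1
  have hu' := contDiffAt_localExpr hX e' (transition_mem hx).1
  have hrel : ∀ {y}, y ∈ overlap e e' → ∀ᶠ y in nhds y, fderiv ℝ (transition e e') y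
      (localExpr X e y) = localExpr X e' (transition e e' y) := fun hy =>
    (eventually_mem_overlap hy).mono fun y hy => localExpr_transition X hy
  refine fderiv_jTrans_prolong hx (hu.differentiableAt (by simp)) (hu'.differentiableAt (by simp))
    ((contDiffAt_liftFib (w := z.toE) hu).differentiableAt (by simp))
    ((contDiffAt_liftFib (w := eTrans e e' z.toE) hu').differentiableAt (by simp)) (hrel hx) ?_
  filter_upwards [continuousAt_fst.eventually (eventually_mem_overlap (x := z.toE.1) hx)] with w hw
  exact fderiv_eTrans_lift hw (contDiffAt_localExpr hX e hw.1)
    (contDiffAt_localExpr hX e' (transition_mem hw).1) (hrel hw)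

end LocalExpression

/-! ### Lie derivative of a horizontal `n`-form -/

section Trace

variable {n : ℕ}

theorem hasDerivAt_det_one_add (P : Base n →ₗ[ℝ] Base n) :
    HasDerivAt (fun t : ℝ => LinearMap.det (1 + t • P)) (LinearMap.trace ℝ (Base n) P) 0 := by
  let b := (EuclideanSpace.basisFun (Fin n) ℝ).toBasis
  have h : ∀ t : ℝ, LinearMap.det (1 + t • P)
      = 1 + LinearMap.trace ℝ (Base n) P * t
        + Polynomial.eval t (Matrix.det
          (1 + (Polynomial.X : Polynomial ℝ) • (LinearMap.toMatrix b b P).map Polynomial.C)).divX.divX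
          * t ^ 2 := fun t => by
    rw [← LinearMap.det_toMatrix b, map_add, map_smul, LinearMap.toMatrix_one,
      Matrix.det_one_add_smul, LinearMap.trace_eq_matrix_trace ℝ b]
  rw [funext h]
  have h1 : HasDerivAt (fun t : ℝ => 1 + LinearMap.trace ℝ (Base n) P * t)
      (LinearMap.trace ℝ (Base n) P) 0 := by
    simpa using ((hasDerivAt_id (0 : ℝ)).const_mul (LinearMap.trace ℝ (Base n) P)).const_add 1
  have h2 := (Polynomial.hasDerivAt (Matrix.det
    (1 + (Polynomial.X : Polynomial ℝ) • (LinearMap.toMatrix b b P).map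
      Polynomial.C)).divX.divX (0 : ℝ)).mul (hasDerivAt_pow 2 (0 : ℝ))
  exact (h1.add h2).congr_deriv (by simp)

theorem MultilinearMap.hasDerivAt_line_family {k : ℕ}
    (f : MultilinearMap ℝ (fun _ : Fin k => Base n) ℝ) (v w : Fin k → Base n) :
    HasDerivAt (fun t : ℝ => f fun m => v m + t • w m)
      (∑ m, f (Function.update v m (w m))) 0 := by
  -- A multilinear map on `Base n` is a polynomial in the components of its arguments, hence
  -- continuous.
  let F : ContinuousMultilinearMap ℝ (fun _ : Fin k => Base n) ℝ :=
    ⟨f, by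
    have h : ∀ v : Fin k → Base n, f v
        = ∑ I : Fin k → Fin n, (∏ m, v m (I m)) * f fun m => EuclideanSpace.single (I m) 1 := by
      intro v
      conv_lhs => rw [show v = fun m => ∑ j, v m j • EuclideanSpace.single j (1 : ℝ) from
        funext fun m => (sum_smul_single _).symm]
      rw [MultilinearMap.map_sum]
      simp only [MultilinearMap.map_smul_univ, smul_eq_mul]
    change Continuous fun v => f v
    rw [show (fun v => f v) = _ from funext h]
    fun_prop⟩
  have h1 : HasDerivAt (fun t : ℝ => fun m => v m + t • w m) w 0 :=
    hasDerivAt_pi.2 fun m => hasDerivAt_line (v m) (w m) 0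
  have h2 := (F.hasFDerivAt v).comp_hasDerivAt_of_eq 0 h1 (by simp)
  refine h2.congr_deriv ?_
  rw [ContinuousMultilinearMap.linearDeriv_apply]
  rfl

/-- The determinant of the vectors `(1 + t P) v_i` is differentiated at `t = 0` twice, by
multilinearity and by multiplicativity. -/
theorem sum_det_update (P : Base n →ₗ[ℝ] Base n) (v : Fin n → Base n) :
    ∑ i, (EuclideanSpace.basisFun (Fin n) ℝ).toBasis.det (Function.update v i (P (v i)))
      = LinearMap.trace ℝ (Base n) P * (EuclideanSpace.basisFun (Fin n) ℝ).toBasis.det v := by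
  have h1 := MultilinearMap.hasDerivAt_line_family
    (EuclideanSpace.basisFun (Fin n) ℝ).toBasis.det.toMultilinearMap v fun m => P (v m)
  have h2 := (hasDerivAt_det_one_add P).mul_const ((EuclideanSpace.basisFun (Fin n) ℝ).toBasis.det v)
  refine h1.unique (h2.congr_of_eventuallyEq (Filter.Eventually.of_forall fun t => ?_))
  exact (EuclideanSpace.basisFun (Fin n) ℝ).toBasis.det_comp (1 + t • P) v

/-- A horizontal form sees only the base component of its arguments, so the derivative of the
prolongation enters through the trace of the derivative of `u`. -/
theorem lieDerivForm_horizontalForm {L : JCoord n → ℝ} {u : Base n → Base n}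
    {v : ECoord n → Fib n} {z : JCoord n} (hL : DifferentiableAt ℝ L z)
    (hY : DifferentiableAt ℝ (prolong u v) z) (hu : DifferentiableAt ℝ u z.1)
    (V : Fin n → JCoord n) :
    lieDerivForm (prolong u v) (horizontalForm L) z V
      = (fderiv ℝ L z (prolong u v z)
          + LinearMap.trace ℝ (Base n) (fderiv ℝ u z.1).toLinearMap * L z)
        * (EuclideanSpace.basisFun (Fin n) ℝ).toBasis.det fun i => (V i).1 := by
  set d := (EuclideanSpace.basisFun (Fin n) ℝ).toBasis.det with hd
  have h1 : fderiv ℝ (fun z' => horizontalForm L z' V) z (prolong u v z)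
      = fderiv ℝ L z (prolong u v z) * d fun i => (V i).1 := by
    have : HasFDerivAt (fun z' => horizontalForm L z' V)
        ((d fun i => (V i).1) • fderiv ℝ L z) z := hL.hasFDerivAt.mul_const _
    rw [this.fderiv]
    simp [mul_comm]
  have h2 : ∀ i, (fderiv ℝ (prolong u v) z (V i)).1 = fderiv ℝ u z.1 (V i).1 := fun i => by
    have e1 := hY.hasFDerivAt.fst
    have e2 := hu.hasFDerivAt.comp z (hasFDerivAt_fst (𝕜 := ℝ) (E := Base n))
    exact DFunLike.congr_fun (e1.unique e2) (V i)
  have h3 : ∀ i, horizontalForm L z (Function.update V i (fderiv ℝ (prolong u v) z (V i)))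
      = L z * d (Function.update (fun i => (V i).1) i
        ((fderiv ℝ u z.1).toLinearMap ((fun i => (V i).1) i))) := fun i => by
    change L z * d (fun j => (Function.update V i (fderiv ℝ (prolong u v) z (V i)) j).1) = _
    congr 2
    funext j
    by_cases hj : j = i
    · subst hj; simp [h2]
    · simp [hj]
  rw [lieDerivForm, h1, Finset.sum_congr rfl fun i _ => h3 i, ← Finset.mul_sum, sum_det_update]
  ring

end Trace

/-! ### Tensor powers of matrices and the norm density of a covariant tensor -/

section TensorPower

variable {n k : ℕ}

/-- The `k`-th tensor power of a matrix. -/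
def tpow (k : ℕ) (A : Matrix (Fin n) (Fin n) ℝ) :
    Matrix (Fin k → Fin n) (Fin k → Fin n) ℝ :=
  Matrix.of fun I J => ∏ m, A (I m) (J m)

theorem tpow_mul (A B : Matrix (Fin n) (Fin n) ℝ) : tpow k (A * B) = tpow k A * tpow k B := by
  ext I J
  simp only [tpow, Matrix.of_apply, Matrix.mul_apply, Finset.prod_univ_sum,
    Fintype.piFinset_univ, Finset.prod_mul_distrib]

theorem tpow_one : tpow k (1 : Matrix (Fin n) (Fin n) ℝ) = 1 := by
  ext I J
  simp only [tpow, Matrix.of_apply, Matrix.one_apply]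
  by_cases h : I = J
  · simp [h]
  · obtain ⟨m, hm⟩ := Function.ne_iff.1 h
    rw [if_neg h]
    exact Finset.prod_eq_zero (Finset.mem_univ m) (if_neg hm)

theorem tpow_transpose (A : Matrix (Fin n) (Fin n) ℝ) :
    tpow k A.transpose = (tpow k A).transpose := rfl

/-- Raising all indices commutes with permuting the slots; hence raised tensors keep their
symmetries. -/
theorem tpow_mulVec_comp (A : Matrix (Fin n) (Fin n) ℝ) (T : (Fin k → Fin n) → ℝ)
    (σ : Equiv.Perm (Fin k)) (I : Fin k → Fin n) :
    (tpow k A).mulVec T (I ∘ σ) = (tpow k A).mulVec (fun J => T (J ∘ σ)) I := by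
  simp only [Matrix.mulVec, dotProduct, tpow, Matrix.of_apply]
  refine (Fintype.sum_equiv (σ.arrowCongr (Equiv.refl _)).symm _ _ fun J => ?_).symm
  change _ = (∏ m, A (I (σ m)) (J (σ m))) * T (J ∘ σ)
  rw [Equiv.prod_comp σ fun m => A (I m) (J m)]

/-- The matrix whose rows are the images of the standard basis. -/
noncomputable def rowMat (M : Base n →ₗ[ℝ] Base n) : Matrix (Fin n) (Fin n) ℝ :=
  Matrix.of fun i j => M (EuclideanSpace.single i 1) j

theorem det_rowMat (M : Base n →ₗ[ℝ] Base n) : (rowMat M).det = LinearMap.det M := by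
  rw [← LinearMap.det_toMatrix (EuclideanSpace.basisFun (Fin n) ℝ).toBasis, ← Matrix.det_transpose]
  congr 1

theorem mat_of_val_eq {g g' : SymForm n} {M : Base n →ₗ[ℝ] Base n}
    (h : ∀ a b, g'.val (M a) (M b) = g.val a b) :
    g.mat = rowMat M * g'.mat * (rowMat M).transpose := by
  ext i j
  rw [SymForm.mat_apply, ← SymForm.val_single g, ← h]
  simp only [SymForm.val, Matrix.mul_apply, Matrix.transpose_apply, rowMat, Matrix.of_apply,
    SymForm.mat_apply, Finset.sum_mul]
  rw [Finset.sum_comm]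
  exact Finset.sum_congr rfl fun _ _ => Finset.sum_congr rfl fun _ _ => by ring

/-- The components of a multilinear form. -/
noncomputable def tcomp (f : MultilinearMap ℝ (fun _ : Fin k => Base n) ℝ) (I : Fin k → Fin n) : ℝ :=
  f fun m => EuclideanSpace.single (I m) 1

theorem tpow_rowMat_mulVec (M : Base n →ₗ[ℝ] Base n)
    (f : MultilinearMap ℝ (fun _ : Fin k => Base n) ℝ) (I : Fin k → Fin n) :
    (tpow k (rowMat M)).mulVec (tcomp f) I
      = f fun m => M (EuclideanSpace.single (I m) 1) := by
  have h : (fun m => M (EuclideanSpace.single (I m) 1))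
      = fun m => ∑ j, M (EuclideanSpace.single (I m) 1) j • EuclideanSpace.single j (1 : ℝ) :=
    funext fun m => (sum_smul_single _).symm
  rw [h, MultilinearMap.map_sum]
  simp only [Matrix.mulVec, dotProduct, MultilinearMap.map_smul_univ]
  rfl

theorem tpow_mulVec_eq {f f' : MultilinearMap ℝ (fun _ : Fin k => Base n) ℝ}
    {M : Base n →ₗ[ℝ] Base n} (h : ∀ v, f' (fun m => M (v m)) = f v) :
    tcomp f = (tpow k (rowMat M)).mulVec (tcomp f') := by
  funext I
  rw [tpow_rowMat_mulVec, h]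
  rfl

/-- The density `√|det g| · |T|²` of a metric and a covariant tensor. -/
noncomputable def normDensity (G : Matrix (Fin n) (Fin n) ℝ) (T : (Fin k → Fin n) → ℝ) : ℝ :=
  Real.sqrt |G.det| * (T ⬝ᵥ (tpow k G⁻¹).mulVec T)

/-- The determinant of `G` picks up `det B ^ 2`, while in the contraction the factors `B` on `T`
cancel against those of the inverse of `B * G * Bᵀ`. -/
theorem normDensity_congr {G B : Matrix (Fin n) (Fin n) ℝ} (T : (Fin k → Fin n) → ℝ)
    (hB : B.det ≠ 0) :
    normDensity (B * G * B.transpose) ((tpow k B).mulVec T) = |B.det| * normDensity G T := by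
  have hu : IsUnit B.det := hB.isUnit
  have h1 : Real.sqrt |(B * G * B.transpose).det| = |B.det| * Real.sqrt |G.det| := by
    rw [Matrix.det_mul, Matrix.det_mul, Matrix.det_transpose,
      show B.det * G.det * B.det = B.det ^ 2 * G.det by ring, abs_mul,
      Real.sqrt_mul (abs_nonneg _), abs_pow, Real.sqrt_sq (abs_nonneg _)]
  have h2 : tpow k B⁻¹ * tpow k B = 1 := by
    rw [← tpow_mul, Matrix.nonsing_inv_mul _ hu, tpow_one]
  have h3 : tpow k (B * G * B.transpose)⁻¹
      = (tpow k B⁻¹).transpose * (tpow k G⁻¹ * tpow k B⁻¹) := by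
    rw [Matrix.mul_inv_rev, Matrix.mul_inv_rev, tpow_mul, tpow_mul, ← tpow_transpose,
      Matrix.transpose_nonsing_inv]
  rw [normDensity, normDensity, h1, h3]
  rw [← Matrix.mulVec_mulVec, ← Matrix.mulVec_mulVec, Matrix.mulVec_mulVec _ (tpow k B⁻¹) (tpow k B),
    h2, Matrix.one_mulVec, Matrix.dotProduct_mulVec, Matrix.vecMul_transpose, Matrix.mulVec_mulVec,
    h2, Matrix.one_mulVec]
  ring

end TensorPower

/-! ### Smoothness and first variation of the norm density -/

section NormDensity

variable {n k : ℕ}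

theorem ContDiffAt.matrix_det {E : Type*} [NormedAddCommGroup E] [NormedSpace ℝ E] {m : ℕ∞ω}
    {G : E → Matrix (Fin n) (Fin n) ℝ} {x : E} (hG : ∀ i j, ContDiffAt ℝ m (fun z => G z i j) x) :
    ContDiffAt ℝ m (fun z => (G z).det) x := by
  simp only [Matrix.det_apply]
  exact ContDiffAt.sum fun σ _ => (contDiffAt_prod fun i _ => hG _ _).const_smul _

theorem ContDiffAt.matrix_inv {E : Type*} [NormedAddCommGroup E] [NormedSpace ℝ E] {m : ℕ∞ω}
    {G : E → Matrix (Fin n) (Fin n) ℝ} {x : E} (hG : ∀ i j, ContDiffAt ℝ m (fun z => G z i j) x)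
    (h0 : (G x).det ≠ 0) (i j : Fin n) : ContDiffAt ℝ m (fun z => (G z)⁻¹ i j) x := by
  simp only [Matrix.inv_def, Ring.inverse_eq_inv', Matrix.smul_apply, Matrix.adjugate_apply,
    smul_eq_mul]
  refine ((ContDiffAt.matrix_det hG).inv h0).mul (ContDiffAt.matrix_det fun r s => ?_)
  simp only [Matrix.updateRow_apply]
  split_ifs
  · exact contDiffAt_const
  · exact hG r s

theorem ContDiffAt.normDensity {E : Type*} [NormedAddCommGroup E] [NormedSpace ℝ E]
    {G : E → Matrix (Fin n) (Fin n) ℝ} {T : E → (Fin k → Fin n) → ℝ} {x : E}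
    (hG : ∀ i j, ContDiffAt ℝ ∞ (fun z => G z i j) x) (h0 : (G x).det ≠ 0)
    (hT : ∀ I, ContDiffAt ℝ ∞ (fun z => T z I) x) :
    ContDiffAt ℝ ∞ (fun z => _root_.normDensity (G z) (T z)) x := by
  have habs : ContDiffAt ℝ ∞ (fun z => |(G z).det|) x :=
    ContDiffAt.comp (g := fun y : ℝ => |y|) x (contDiffAt_abs h0) (ContDiffAt.matrix_det hG)
  refine (habs.sqrt (abs_ne_zero.2 h0)).mul ?_
  simp only [dotProduct, Matrix.mulVec, tpow, Matrix.of_apply]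
  exact ContDiffAt.sum fun I _ => (hT I).mul (ContDiffAt.sum fun J _ =>
    (contDiffAt_prod fun l _ => ContDiffAt.matrix_inv hG h0 _ _).mul (hT J))

/-- Infinitesimal relative invariance of `normDensity`. -/
theorem hasDerivAt_normDensity {G B : ℝ → Matrix (Fin n) (Fin n) ℝ}
    {T : ℝ → (Fin k → Fin n) → ℝ} {G' : Fin n → Fin n → ℝ} {T' : (Fin k → Fin n) → ℝ} {c : ℝ}
    (h0 : (G 0).det ≠ 0) (hB : B 0 = 1) (hdet : HasDerivAt (fun t => (B t).det) c 0)
    (hG : ∀ i j, HasDerivAt (fun t => G t i j) (G' i j) 0)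
    (hT : ∀ I, HasDerivAt (fun t => T t I) (T' I) 0)
    (hG' : ∀ i j, HasDerivAt (fun t => (B t * G 0 * (B t).transpose) i j) (G' i j) 0)
    (hT' : ∀ I, HasDerivAt (fun t => (tpow k (B t)).mulVec (T 0) I) (T' I) 0) :
    HasDerivAt (fun t => normDensity (G t) (T t)) (c * normDensity (G 0) (T 0)) 0 := by
  -- The derivative depends only on the velocity `(G', T')`. The given curve may thus be replaced by
  -- the orbit of its initial point under `B t`, along which the density is multiplied by `|det (B
  -- t)|`.
  let Ψ : (Fin n → Fin n → ℝ) × ((Fin k → Fin n) → ℝ) → ℝ :=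
    fun p => normDensity (Matrix.of p.1) p.2
  let p0 : (Fin n → Fin n → ℝ) × ((Fin k → Fin n) → ℝ) := (G 0, T 0)
  have hΨ : DifferentiableAt ℝ Ψ p0 := by
    refine ContDiffAt.differentiableAt (n := ∞) (ContDiffAt.normDensity (fun i j => ?_) h0
      fun I => contDiffAt_pi.1 contDiffAt_snd I) (by simp)
    exact contDiffAt_pi.1 (contDiffAt_pi.1 contDiffAt_fst i) j
  have key : ∀ {c : ℝ → (Fin n → Fin n → ℝ) × ((Fin k → Fin n) → ℝ)},
      HasDerivAt c (G', T') 0 → c 0 = p0 → HasDerivAt (fun t => Ψ (c t)) (fderiv ℝ Ψ p0 (G', T')) 0 :=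
    fun hc h => hΨ.hasFDerivAt.comp_hasDerivAt_of_eq 0 hc h.symm
  have k1 := key (c := fun t => (G t, T t)) ((hasDerivAt_pi.2 fun i => hasDerivAt_pi.2 (hG i)).prodMk
    (hasDerivAt_pi.2 hT)) rfl
  have k2 := key (c := fun t => (B t * G 0 * (B t).transpose, (tpow k (B t)).mulVec (T 0)))
    ((hasDerivAt_pi.2 fun i => hasDerivAt_pi.2 (hG' i)).prodMk (hasDerivAt_pi.2 hT')) (by
      simp [hB, tpow_one, p0])
  have hev : ∀ᶠ t in nhds (0 : ℝ), 0 < (B t).det :=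
    hdet.continuousAt.eventually (lt_mem_nhds (by simp [hB]))
  have k3 : HasDerivAt (fun t => (B t).det * normDensity (G 0) (T 0))
      (c * normDensity (G 0) (T 0)) 0 := hdet.mul_const _
  have k4 := k2.unique (k3.congr_of_eventuallyEq (hev.mono fun t ht => by
    have := normDensity_congr (G := G 0) (T 0) ht.ne'
    rw [abs_of_pos ht] at this
    exact this))
  rw [← k4]
  exact k1

end NormDensity

/-! ### Invariant Lagrangians built from natural tensors -/

section JetTensor

variable {n k : ℕ} {N : Type*} [TopologicalSpace N] [ChartedSpace (Base n) N] {p q : ℕ}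

variable (n N k) in
/-- A natural covariant tensor depending on the `1`-jet of a metric and a connection, affine in
the first derivatives. -/
structure JetTensor where
  /-- The value at a jet. -/
  toFun : JCoord n → MultilinearMap ℝ (fun _ : Fin k => Base n) ℝ
  /-- The linear part with respect to the first derivatives. -/
  lin : ECoord n → (Fin n → Fib n) → MultilinearMap ℝ (fun _ : Fin k => Base n) ℝ
  smooth : ∀ v z, ContDiffAt ℝ ∞ (fun z => toFun z v) z
  affine : ∀ (z : JCoord n) (ξ : Fin n → Fib n) (t : ℝ) v,
    toFun (z.1, z.2.1, z.2.2 + t • ξ) v = toFun z v + t * lin z.toE ξ v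
  natural : ∀ (e e' : CoordSys n N) (z : JCoord n), z.1 ∈ overlap e e' → ∀ v,
    toFun (jTrans e e' z) (fun m => fderiv ℝ (transition e e') z.1 (v m)) = toFun z v
  infNatural : ∀ (u : Base n → Base n) (z : JCoord n), ContDiffAt ℝ ∞ u z.1 → ∀ v,
    fderiv ℝ (fun z => toFun z v) z (prolong u (liftFib u) z)
      = -∑ m, toFun z (Function.update v m (fderiv ℝ u z.1 (v m)))

/-- The coefficient of the density `√|det y| · |T|²`, with the sign given by an orientation. -/
noncomputable def JetTensor.coeff (T : JetTensor n k N) (v : CoordSys n N → Base n → ℝ)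
    (e : CoordSys n N) (z : JCoord n) : ℝ :=
  Real.sign (v e z.1) * normDensity z.2.1.1.mat (tcomp (T.toFun z))

theorem eventually_sign_eq {v : Base n → ℝ} {x : Base n} (hv : ContinuousAt v x) (h0 : v x ≠ 0) :
    ∀ᶠ y in nhds x, Real.sign (v y) = Real.sign (v x) := by
  rcases lt_or_gt_of_ne h0 with h | h
  · filter_upwards [hv.eventually (gt_mem_nhds h)] with y hy
    rw [Real.sign_of_neg hy, Real.sign_of_neg h]
  · filter_upwards [hv.eventually (lt_mem_nhds h)] with y hy
    rw [Real.sign_of_pos hy, Real.sign_of_pos h]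

theorem contDiffAt_mat (z : JCoord n) (i j : Fin n) :
    ContDiffAt ℝ ∞ (fun z : JCoord n => z.2.1.1.mat i j) z :=
  contDiffAt_pi.1 (contDiffAt_snd.fst.fst) s(i, j)

theorem JetTensor.contDiffAt_coeff (T : JetTensor n k N) {v : CoordSys n N → Base n → ℝ}
    {e : CoordSys n N} {z : JCoord n} (hz : z ∈ jDom p q e) (hv : ContinuousAt (v e) z.1)
    (h0 : v e z.1 ≠ 0) : ContDiffAt ℝ ∞ (T.coeff v e) z := by
  refine ContDiffAt.mul ?_ (ContDiffAt.normDensity (contDiffAt_mat z) hz.2.det_ne_zero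
    fun I => T.smooth _ z)
  exact contDiffAt_const.congr_of_eventuallyEq
    (continuousAt_fst.eventually (eventually_sign_eq hv h0))

/-- The norm density transforms by `|det|`, the coefficient of an `n`-form by `det`; the sign of the
orientation form makes up the difference. -/
theorem sign_mul_sign_eq {a b d : ℝ} (hd : d ≠ 0) (h : a * d = b) :
    Real.sign a * d = Real.sign b * |d| := by
  rcases lt_or_gt_of_ne hd with h1 | h1
  · rcases lt_trichotomy a 0 with h2 | h2 | h2
    · rw [Real.sign_of_neg h2, Real.sign_of_pos (h ▸ mul_pos_of_neg_of_neg h2 h1), abs_of_neg h1]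
      ring
    · subst h2; rw [zero_mul] at h; subst h; simp
    · rw [Real.sign_of_pos h2, Real.sign_of_neg (h ▸ mul_neg_of_pos_of_neg h2 h1), abs_of_neg h1]
      ring
  · rcases lt_trichotomy a 0 with h2 | h2 | h2
    · rw [Real.sign_of_neg h2, Real.sign_of_neg (h ▸ mul_neg_of_neg_of_pos h2 h1), abs_of_pos h1]
    · subst h2; rw [zero_mul] at h; subst h; simp
    · rw [Real.sign_of_pos h2, Real.sign_of_pos (h ▸ mul_pos h2 h1), abs_of_pos h1]

/-- The Lagrangian density `√|det y| · |T|²` of a natural tensor on an oriented manifold. -/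
noncomputable def JetTensor.lagrangian (T : JetTensor n k N) (p q : ℕ)
    {v : CoordSys n N → Base n → ℝ} (hv : ∀ e, ContDiffOn ℝ ∞ (v e) e.1.target)
    (hv0 : ∀ e, ∀ x ∈ e.1.target, v e x ≠ 0)
    (hvt : ∀ e e', ∀ x ∈ overlap e e',
      v e' (transition e e' x) * (fderiv ℝ (transition e e') x).det = v e x) :
    LagrangianDensity n N p q where
  coeff := T.coeff v
  smooth e z hz := (T.contDiffAt_coeff hz ((hv e).continuousOn.continuousAt
    (e.1.open_target.mem_nhds hz.1)) (hv0 e _ hz.1)).contDiffWithinAt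
  compat e e' z hz hx := by
    set L := fderiv ℝ (transition e e') z.1 with hL
    have hdet : L.toLinearMap.det ≠ 0 := fun h => by
      have := hvt e e' z.1 hx
      rw [← hL, ContinuousLinearMap.det, h, mul_zero] at this
      exact hv0 e _ hx.1 this.symm
    have hG : z.2.1.1.mat = rowMat L.toLinearMap * (jTrans e e' z).2.1.1.mat
        * (rowMat L.toLinearMap).transpose :=
      mat_of_val_eq (M := L.toLinearMap) fun a b => by
        have h1 := eTrans_fst_val (w := z.toE) hx a b
        rw [← jTrans_toE hx] at h1
        exact h1
    have hT : tcomp (T.toFun z) = (tpow k (rowMat L.toLinearMap)).mulVec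
        (tcomp (T.toFun (jTrans e e' z))) :=
      tpow_mulVec_eq (M := L.toLinearMap) (T.natural e e' z hx)
    have hs := sign_mul_sign_eq hdet (hvt e e' z.1 hx)
    rw [JetTensor.coeff, JetTensor.coeff, hG, hT, normDensity_congr _ (by rwa [det_rowMat]),
      det_rowMat, ← mul_assoc, ← hs, jTrans_fst]
    change _ * LinearMap.det L.toLinearMap = _
    ring

theorem hasDerivAt_det_rowMat (P : Base n →ₗ[ℝ] Base n) :
    HasDerivAt (fun t : ℝ => (rowMat (1 + t • (-P))).det) (-LinearMap.trace ℝ (Base n) P) 0 := by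
  simp only [det_rowMat]
  exact (hasDerivAt_det_one_add (-P)).congr_deriv (map_neg _ _)

/-- Infinitesimal relative invariance of `√|det y| · |T|²`. -/
theorem JetTensor.fderiv_coeff (T : JetTensor n k N) {v : CoordSys n N → Base n → ℝ}
    {e : CoordSys n N} {z : JCoord n} (hz : z ∈ jDom p q e) (hv : ContinuousAt (v e) z.1)
    (h0 : v e z.1 ≠ 0) {u : Base n → Base n} (hu : ContDiffAt ℝ ∞ u z.1) :
    fderiv ℝ (T.coeff v e) z (prolong u (liftFib u) z)
      = -LinearMap.trace ℝ (Base n) (fderiv ℝ u z.1).toLinearMap * T.coeff v e z := by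
  set Z := prolong u (liftFib u) z with hZ
  set P := (fderiv ℝ u z.1).toLinearMap with hP
  have hz0 : z + (0 : ℝ) • Z = z := by simp
  have hB : rowMat (1 + (0 : ℝ) • (-P)) = 1 := by
    ext i j
    simp [rowMat, Matrix.one_apply, eq_comm]
  -- To first order the prolonged lift of `u` changes the metric and `T` as the linear map `1 - t P`
  -- does, by `liftFib_fst_val` and `infNatural`.
  have key := hasDerivAt_normDensity (k := k) (G := fun t => (z + t • Z).2.1.1.mat)
    (B := fun t => rowMat (1 + t • (-P))) (T := fun t => tcomp (T.toFun (z + t • Z)))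
    (G' := fun i j => (liftFib u z.toE).1 s(i, j))
    (T' := fun I => -∑ m, T.toFun z (Function.update (fun m => EuclideanSpace.single (I m) 1) m
      (P (EuclideanSpace.single (I m) 1))))
    (by rw [hz0]; exact hz.2.det_ne_zero) hB (hasDerivAt_det_rowMat P)
    (fun i j => hasDerivAt_pi.1 (hasDerivAt_line z Z 0).prod_snd.prod_fst.prod_fst s(i, j))
    (fun I => by
      refine HasDerivAt.congr_deriv (((T.smooth _ z).differentiableAt (by simp)).hasDerivAt_line Z)
        (T.infNatural u z hu fun m => EuclideanSpace.single (I m) 1))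
    (fun i j => by
      have e1 : ∀ t : ℝ, (rowMat (1 + t • (-P)) * (z + (0 : ℝ) • Z).2.1.1.mat
          * (rowMat (1 + t • (-P))).transpose : Matrix (Fin n) (Fin n) ℝ) i j
          = z.2.1.1.val (EuclideanSpace.single i 1 + t • (-P (EuclideanSpace.single i 1)))
            (EuclideanSpace.single j 1 + t • (-P (EuclideanSpace.single j 1))) := fun t => by
        have := mat_of_val_eq (M := 1 + t • (-P)) (g' := z.2.1.1)
          (g := z.2.1.1.pull fun i => (1 + t • (-P)) (EuclideanSpace.single i 1)) (fun a b => by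
            rw [SymForm.val_pull, along_linear_single, along_linear_single])
        rw [hz0, ← this]
        rfl
      simp only [e1]
      have h2 := (hasDerivAt_const (0 : ℝ) z.2.1.1).symForm_val
        (hasDerivAt_line (EuclideanSpace.single i 1) (-P (EuclideanSpace.single i 1)) 0)
        (hasDerivAt_line (EuclideanSpace.single j 1) (-P (EuclideanSpace.single j 1)) 0)
      refine h2.congr_deriv ?_
      rw [← SymForm.val_single (liftFib u z.toE).1, liftFib_fst_val]
      have hz' : ∀ a b, SymForm.val (0 : SymForm n) a b = 0 := fun a b => by simp [SymForm.val]
      simp only [hz', zero_smul, add_zero, SymForm.val_neg_left, SymForm.val_neg_right]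
      change _ = -(z.2.1.1.val (P _) _ + z.2.1.1.val _ (P _))
      ring)
    (fun I => by
      simp only [tpow_rowMat_mulVec, hz0]
      have h2 := MultilinearMap.hasDerivAt_line_family (T.toFun z)
        (fun m => EuclideanSpace.single (I m) 1) (fun m => -P (EuclideanSpace.single (I m) 1))
      refine h2.congr_deriv ?_
      rw [← Finset.sum_neg_distrib]
      refine Finset.sum_congr rfl fun m _ => ?_
      rw [← neg_one_smul ℝ (P (EuclideanSpace.single (I m) 1)), MultilinearMap.map_update_smul]
      simp)
  have hd := ((T.contDiffAt_coeff hz hv h0).differentiableAt (by simp)).hasDerivAt_line Z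
  have hc := (key.const_mul (Real.sign (v e z.1))).congr_of_eventuallyEq
    (f₁ := fun t => T.coeff v e (z + t • Z)) (((tendsto_line z Z).eventually
      (continuousAt_fst.eventually (eventually_sign_eq hv h0))).mono fun t ht => by
        simp only [JetTensor.coeff]
        rw [ht])
  rw [hd.unique hc, hz0, JetTensor.coeff]
  ring

theorem JetTensor.isInvariantDensity [IsManifold (𝓡 n) ∞ N] (T : JetTensor n k N)
    {v : CoordSys n N → Base n → ℝ} (hv : ∀ e, ContDiffOn ℝ ∞ (v e) e.1.target)
    (hv0 : ∀ e, ∀ x ∈ e.1.target, v e x ≠ 0) : IsInvariantDensity p q (T.coeff v) := by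
  intro X hX e z hz V
  have hc := (hv e).continuousOn.continuousAt (e.1.open_target.mem_nhds hz.1)
  have hu := contDiffAt_localExpr hX e (x := z.1) hz.1
  rw [jetLift, lieDerivForm_horizontalForm ((T.contDiffAt_coeff hz hc
    (hv0 e _ hz.1)).differentiableAt (by simp))
    ((contDiffAt_jetLift hX (z := z) hz.1).differentiableAt (by simp))
    (hu.differentiableAt (by simp)), T.fderiv_coeff hz hc (hv0 e _ hz.1) hu]
  ring

/-- A vertical direction along which `√|det y| · |T|²` is stationary on a whole fibre is orthogonal
to the image of the linear part of `T`. -/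
theorem JetTensor.dotProduct_lin_eq_zero (T : JetTensor n k N) {v : CoordSys n N → Base n → ℝ}
    {e : CoordSys n N} {w : ECoord n} (hw : w ∈ eDom p q e) (hv : ContinuousAt (v e) w.1)
    (h0 : v e w.1 ≠ 0) {ξ : Fin n → Fib n}
    (h : ∀ S, fderiv ℝ (T.coeff v e) (w.1, w.2, S) (0, 0, ξ) = 0) (S : Fin n → Fib n) :
    tcomp (T.lin w S) ⬝ᵥ (tpow k w.2.1.mat⁻¹).mulVec (tcomp (T.lin w ξ)) = 0 := by
  set M := tpow k w.2.1.mat⁻¹ with hM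
  have hsymm : M.transpose = M := by
    rw [hM, ← tpow_transpose, Matrix.transpose_nonsing_inv]
    congr 2
    ext i j
    rw [Matrix.transpose_apply, SymForm.mat_apply, SymForm.mat_apply, Sym2.eq_swap]
  have hdot : ∀ a b, a ⬝ᵥ M.mulVec b = b ⬝ᵥ M.mulVec a := fun a b => by
    rw [Matrix.dotProduct_mulVec, ← Matrix.mulVec_transpose, hsymm, dotProduct_comm]
  -- Along `ξ` the coefficient is a quadratic polynomial in `t` whose linear term is the pairing of
  -- `T` with `T.lin w ξ`, up to the nonzero factor `2 * c`.
  have key : ∀ S, tcomp (T.toFun (w.1, w.2, S)) ⬝ᵥ M.mulVec (tcomp (T.lin w ξ)) = 0 := fun S => by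
    have hz : ((w.1, w.2, S) : JCoord n) ∈ jDom p q e := hw
    have hd := ((T.contDiffAt_coeff hz hv h0).differentiableAt (by simp)).hasDerivAt_line
      ((0, 0, ξ) : JCoord n)
    rw [h] at hd
    set τ := tcomp (T.toFun (w.1, w.2, S)) with hτ
    set l := tcomp (T.lin w ξ) with hl
    set c := Real.sign (v e w.1) * Real.sqrt |w.2.1.mat.det| with hc
    have e1 : (fun t : ℝ => T.coeff v e (((w.1, w.2, S) : JCoord n) + t • ((0, 0, ξ) : JCoord n)))
        = fun t => c * (τ ⬝ᵥ M.mulVec τ) + t * (2 * c * (τ ⬝ᵥ M.mulVec l))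
          + t ^ 2 * (c * (l ⬝ᵥ M.mulVec l)) := by
      funext t
      have e2 : ((w.1, w.2, S) : JCoord n) + t • ((0, 0, ξ) : JCoord n) = (w.1, w.2, S + t • ξ) := by
        refine Prod.ext ?_ (Prod.ext ?_ ?_) <;> simp
      have e3 : tcomp (T.toFun (w.1, w.2, S + t • ξ)) = τ + t • l :=
        funext fun I => T.affine (w.1, w.2, S) ξ t _
      rw [e2, JetTensor.coeff, e3, normDensity]
      change Real.sign (v e w.1) * (Real.sqrt |w.2.1.mat.det| * ((τ + t • l) ⬝ᵥ M.mulVec (τ + t • l)))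
        = _
      rw [Matrix.mulVec_add, Matrix.mulVec_smul, add_dotProduct, dotProduct_add, dotProduct_add,
        smul_dotProduct, smul_dotProduct, dotProduct_smul, dotProduct_smul, hdot l τ, hc]
      simp only [smul_eq_mul]
      ring
    rw [e1] at hd
    have h1 : HasDerivAt (fun t : ℝ => c * (τ ⬝ᵥ M.mulVec τ) + t * (2 * c * (τ ⬝ᵥ M.mulVec l))
        + t ^ 2 * (c * (l ⬝ᵥ M.mulVec l))) (2 * c * (τ ⬝ᵥ M.mulVec l)) 0 := by
      have a1 := ((hasDerivAt_id (0 : ℝ)).mul_const (2 * c * (τ ⬝ᵥ M.mulVec l))).const_add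
        (c * (τ ⬝ᵥ M.mulVec τ))
      have a2 := (hasDerivAt_pow 2 (0 : ℝ)).mul_const (c * (l ⬝ᵥ M.mulVec l))
      exact (a1.add a2).congr_deriv (by simp)
    have h2 := h1.unique hd
    have hc0 : c ≠ 0 := by
      refine mul_ne_zero ?_ (Real.sqrt_ne_zero'.2 (abs_pos.2 hw.2.det_ne_zero))
      rcases lt_or_gt_of_ne h0 with h | h
      · rw [Real.sign_of_neg h]; norm_num
      · rw [Real.sign_of_pos h]; norm_num
    rcases mul_eq_zero.1 h2 with h3 | h3
    · exact absurd h3 (mul_ne_zero two_ne_zero hc0)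
    · exact h3
  -- The linear part is a difference of two values of `T` on the same fibre, which is why
  -- stationarity is required on the whole fibre.
  have e4 : tcomp (T.lin w S) = tcomp (T.toFun (w.1, w.2, S)) - tcomp (T.toFun (w.1, w.2, 0)) := by
    funext I
    have := T.affine (w.1, w.2, 0) S 1 fun m => EuclideanSpace.single (I m) 1
    simp only [one_smul, zero_add, one_mul] at this
    simp only [Pi.sub_apply, tcomp, this]
    exact (add_sub_cancel_left _ _).symm
  rw [e4, sub_dotProduct, key, key, sub_zero]

/-- If the raised components of `T.lin w ξ` are the components of some `T.lin w S`, then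
`T.lin w ξ` vanishes. -/
theorem JetTensor.lin_eq_zero (T : JetTensor n k N) {v : CoordSys n N → Base n → ℝ}
    {e : CoordSys n N} {w : ECoord n} (hw : w ∈ eDom p q e) (hv : ContinuousAt (v e) w.1)
    (h0 : v e w.1 ≠ 0) {ξ : Fin n → Fib n}
    (h : ∀ S, fderiv ℝ (T.coeff v e) (w.1, w.2, S) (0, 0, ξ) = 0) {S : Fin n → Fib n}
    (hS : tcomp (T.lin w S) = (tpow k w.2.1.mat⁻¹).mulVec (tcomp (T.lin w ξ))) :
    tcomp (T.lin w ξ) = 0 := by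
  have h1 := T.dotProduct_lin_eq_zero hw hv h0 h S
  -- For this `S` the pairing is the sum of squares of the raised components, which is definite
  -- whatever the signature of the metric.
  rw [hS, dotProduct_self_eq_zero] at h1
  have h2 := congrArg (tpow k w.2.1.mat).mulVec h1
  rwa [Matrix.mulVec_mulVec, ← tpow_mul, Matrix.mul_nonsing_inv _ hw.2.det_ne_zero.isUnit, tpow_one,
    Matrix.one_mulVec, Matrix.mulVec_zero] at h2

end JetTensor

/-! ### Explicit transformation laws and prolongations for jets of metrics and connections -/

section JetLaws

variable {n : ℕ} {N : Type*} [TopologicalSpace N] [ChartedSpace (Base n) N]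

theorem jTrans_val {e e' : CoordSys n N} {z : JCoord n} (hz : z.1 ∈ overlap e e') (a b : Base n) :
    (jTrans e e' z).2.1.1.val (fderiv ℝ (transition e e') z.1 a) (fderiv ℝ (transition e e') z.1 b)
      = z.2.1.1.val a b := by
  have h := eTrans_fst_val (w := z.toE) hz a b
  rwa [← jTrans_toE hz] at h

theorem jTrans_app {e e' : CoordSys n N} {z : JCoord n} (hz : z.1 ∈ overlap e e') (a b : Base n) :
    (jTrans e e' z).2.1.2.app (fderiv ℝ (transition e e') z.1 a)
        (fderiv ℝ (transition e e') z.1 b)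
      = fderiv ℝ (transition e e') z.1 (z.2.1.2.app a b)
        - fderiv ℝ (fderiv ℝ (transition e e')) z.1 a b := by
  have h := eTrans_snd_app (w := z.toE) hz a b
  rwa [← jTrans_toE hz] at h

theorem jTrans_along_val {e e' : CoordSys n N} {z : JCoord n} (hz : z.1 ∈ overlap e e')
    (a b c : Base n) :
    (along (jTrans e e' z).2.2 (fderiv ℝ (transition e e') z.1 c)).1.val
        (fderiv ℝ (transition e e') z.1 a) (fderiv ℝ (transition e e') z.1 b)
      + (jTrans e e' z).2.1.1.val (fderiv ℝ (fderiv ℝ (transition e e')) z.1 c a)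
        (fderiv ℝ (transition e e') z.1 b)
      + (jTrans e e' z).2.1.1.val (fderiv ℝ (transition e e') z.1 a)
        (fderiv ℝ (fderiv ℝ (transition e e')) z.1 c b)
      = (along z.2.2 c).1.val a b := by
  have h := fderiv_eTrans_fst_val (w := z.toE) hz (c, along z.2.2 c) a b
  rw [along_jTrans hz]
  rwa [← jTrans_toE hz] at h

theorem jTrans_along_app {e e' : CoordSys n N} {z : JCoord n} (hz : z.1 ∈ overlap e e')
    (a b c : Base n) :
    (along (jTrans e e' z).2.2 (fderiv ℝ (transition e e') z.1 c)).2.app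
        (fderiv ℝ (transition e e') z.1 a) (fderiv ℝ (transition e e') z.1 b)
      + (jTrans e e' z).2.1.2.app (fderiv ℝ (fderiv ℝ (transition e e')) z.1 c a)
        (fderiv ℝ (transition e e') z.1 b)
      + (jTrans e e' z).2.1.2.app (fderiv ℝ (transition e e') z.1 a)
        (fderiv ℝ (fderiv ℝ (transition e e')) z.1 c b)
      = fderiv ℝ (fderiv ℝ (transition e e')) z.1 c (z.2.1.2.app a b)
        + fderiv ℝ (transition e e') z.1 ((along z.2.2 c).2.app a b)
        - fderiv ℝ (fderiv ℝ (fderiv ℝ (transition e e'))) z.1 c a b := by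
  have h := fderiv_eTrans_snd_app (w := z.toE) hz (c, along z.2.2 c) a b
  rw [along_jTrans hz]
  rwa [← jTrans_toE hz] at h

theorem val_zero_left (g : SymForm n) (v : Base n) : g.val 0 v = 0 := by simp [SymForm.val]

theorem val_zero_right (g : SymForm n) (v : Base n) : g.val v 0 = 0 := by simp [SymForm.val]

theorem val_zero_form (a b : Base n) : SymForm.val (0 : SymForm n) a b = 0 := by
  simp [SymForm.val]

theorem app_zero_left (A : ConnForm n) (v : Base n) : A.app 0 v = 0 := by
  simpa using A.app_smul_left 0 0 v

theorem app_zero_right (A : ConnForm n) (v : Base n) : A.app v 0 = 0 := by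
  simpa using A.app_smul_right 0 v 0

theorem fderiv_liftFib_val {u : Base n → Base n} {w : ECoord n} (hu : ContDiffAt ℝ ∞ u w.1)
    (Z : ECoord n) (a b : Base n) :
    (fderiv ℝ (liftFib u) w Z).1.val a b
      = -(Z.2.1.val (fderiv ℝ u w.1 a) b + w.2.1.val (fderiv ℝ (fderiv ℝ u) w.1 Z.1 a) b
        + Z.2.1.val a (fderiv ℝ u w.1 b) + w.2.1.val a (fderiv ℝ (fderiv ℝ u) w.1 Z.1 b)) := by
  have h0 : w + (0 : ℝ) • Z = w := by simp
  have hl := hasDerivAt_line w Z 0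
  have hu0 : ContDiffAt ℝ ∞ u (w + (0 : ℝ) • Z).1 := by rwa [h0]
  have h1 := (((contDiffAt_liftFib hu).differentiableAt (by simp)).hasDerivAt_line
    Z).prod_fst.symForm_val (hasDerivAt_const 0 a) (hasDerivAt_const 0 b)
  have hP := fun a => hasDerivAt_fderiv_apply (f := u) (t := 0) (c := fun t => (w + t • Z).1) hu0
    hl.prod_fst (hasDerivAt_const 0 a)
  have h2 := (hl.prod_snd.prod_fst.symForm_val (hP a) (hasDerivAt_const 0 b)).add
    (hl.prod_snd.prod_fst.symForm_val (hasDerivAt_const 0 a) (hP b))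
  have := h1.unique (h2.neg.congr_of_eventuallyEq
    (Filter.Eventually.of_forall fun t => liftFib_fst_val u (w + t • Z) a b))
  simp only [h0, val_zero_left, val_zero_right, map_zero, add_zero] at this
  rw [this]
  ring

theorem fderiv_liftFib_app {u : Base n → Base n} {w : ECoord n} (hu : ContDiffAt ℝ ∞ u w.1)
    (Z : ECoord n) (a b : Base n) :
    (fderiv ℝ (liftFib u) w Z).2.app a b
      = -fderiv ℝ (fderiv ℝ (fderiv ℝ u)) w.1 Z.1 a b
        + fderiv ℝ (fderiv ℝ u) w.1 Z.1 (w.2.2.app a b) + fderiv ℝ u w.1 (Z.2.2.app a b)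
        - Z.2.2.app a (fderiv ℝ u w.1 b) - w.2.2.app a (fderiv ℝ (fderiv ℝ u) w.1 Z.1 b)
        - Z.2.2.app (fderiv ℝ u w.1 a) b - w.2.2.app (fderiv ℝ (fderiv ℝ u) w.1 Z.1 a) b := by
  have h0 : w + (0 : ℝ) • Z = w := by simp
  have hl := hasDerivAt_line w Z 0
  have hu0 : ContDiffAt ℝ ∞ u (w + (0 : ℝ) • Z).1 := by rwa [h0]
  have h1 := (((contDiffAt_liftFib hu).differentiableAt (by simp)).hasDerivAt_line
    Z).prod_snd.connForm_app (hasDerivAt_const 0 a) (hasDerivAt_const 0 b)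
  have hP := fun a => hasDerivAt_fderiv_apply (f := u) (t := 0) (c := fun t => (w + t • Z).1) hu0
    hl.prod_fst (hasDerivAt_const 0 a)
  have hA := hl.prod_snd.prod_snd
  have h2 := (((hasDerivAt_fderiv_fderiv_apply (f := u) (t := 0) (c := fun t => (w + t • Z).1) hu0
    hl.prod_fst (hasDerivAt_const 0 a) (hasDerivAt_const 0 b)).neg.add
      (hasDerivAt_fderiv_apply (f := u) (t := 0) (c := fun t => (w + t • Z).1) hu0
        hl.prod_fst (hA.connForm_app (hasDerivAt_const 0 a) (hasDerivAt_const 0 b)))).sub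
      (hA.connForm_app (hasDerivAt_const 0 a) (hP b))).sub
      (hA.connForm_app (hP a) (hasDerivAt_const 0 b))
  -- The formula for the lift uses a second derivative of `u`, and is needed along the whole line
  -- near `w`.
  have hev : ∀ᶠ t : ℝ in nhds 0, DifferentiableAt ℝ (fderiv ℝ u) (w + t • Z).1 :=
    (tendsto_line w Z).eventually (continuousAt_fst.eventually hu.eventually_differentiableAt_fderiv)
  have := h1.unique (h2.congr_of_eventuallyEq (hev.mono fun t ht => liftFib_snd_app ht a b))
  simp only [h0, app_zero_left, app_zero_right, map_zero, add_zero, zero_apply] at this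
  rw [this]
  module

/-- The first derivatives of the natural lift, metric part. -/
theorem along_prolong_val {u : Base n → Base n} {z : JCoord n} (hu : ContDiffAt ℝ ∞ u z.1)
    (a b c : Base n) :
    (along (prolong u (liftFib u) z).2.2 c).1.val a b
      = -((along z.2.2 c).1.val (fderiv ℝ u z.1 a) b
        + z.2.1.1.val (fderiv ℝ (fderiv ℝ u) z.1 c a) b
        + (along z.2.2 c).1.val a (fderiv ℝ u z.1 b)
        + z.2.1.1.val a (fderiv ℝ (fderiv ℝ u) z.1 c b))
        - (along z.2.2 (fderiv ℝ u z.1 c)).1.val a b := by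
  rw [along_prolong, Prod.fst_sub, SymForm.val_sub_form,
    fderiv_liftFib_val (w := z.toE) hu (c, along z.2.2 c)]
  rfl

/-- The first derivatives of the natural lift, connection part. -/
theorem along_prolong_app {u : Base n → Base n} {z : JCoord n} (hu : ContDiffAt ℝ ∞ u z.1)
    (a b c : Base n) :
    (along (prolong u (liftFib u) z).2.2 c).2.app a b
      = -fderiv ℝ (fderiv ℝ (fderiv ℝ u)) z.1 c a b
        + fderiv ℝ (fderiv ℝ u) z.1 c (z.2.1.2.app a b)
        + fderiv ℝ u z.1 ((along z.2.2 c).2.app a b)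
        - (along z.2.2 c).2.app a (fderiv ℝ u z.1 b)
        - z.2.1.2.app a (fderiv ℝ (fderiv ℝ u) z.1 c b)
        - (along z.2.2 c).2.app (fderiv ℝ u z.1 a) b
        - z.2.1.2.app (fderiv ℝ (fderiv ℝ u) z.1 c a) b
        - (along z.2.2 (fderiv ℝ u z.1 c)).2.app a b := by
  rw [along_prolong, Prod.snd_sub, ConnForm.app_sub_form,
    fderiv_liftFib_app (w := z.toE) hu (c, along z.2.2 c)]
  rfl

theorem prolong_val (u : Base n → Base n) (z : JCoord n) (a b : Base n) :
    (prolong u (liftFib u) z).2.1.1.val a b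
      = -(z.2.1.1.val (fderiv ℝ u z.1 a) b + z.2.1.1.val a (fderiv ℝ u z.1 b)) :=
  liftFib_fst_val u z.toE a b

theorem prolong_app {u : Base n → Base n} {z : JCoord n} (hu : ContDiffAt ℝ ∞ u z.1)
    (a b : Base n) :
    (prolong u (liftFib u) z).2.1.2.app a b
      = -fderiv ℝ (fderiv ℝ u) z.1 a b + fderiv ℝ u z.1 (z.2.1.2.app a b)
      - z.2.1.2.app a (fderiv ℝ u z.1 b) - z.2.1.2.app (fderiv ℝ u z.1 a) b :=
  liftFib_snd_app (w := z.toE) hu.differentiableAt_fderiv a b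

end JetLaws

/-! ### Trilinear and quadrilinear forms as multilinear maps -/

section Multilinear

variable {n : ℕ}

/-- A trilinear form as a multilinear map. -/
def trilinear (f : Base n → Base n → Base n → ℝ)
    (h0 : ∀ b c, IsLinearMap ℝ fun a => f a b c) (h1 : ∀ a c, IsLinearMap ℝ fun b => f a b c)
    (h2 : ∀ a b, IsLinearMap ℝ fun c => f a b c) :
    MultilinearMap ℝ (fun _ : Fin 3 => Base n) ℝ where
  toFun m := f (m 0) (m 1) (m 2)
  map_update_add' {i1} m i x y := by
    -- The axioms of `MultilinearMap` quantify over the decidability instance used by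
    -- `Function.update`; it is identified with the standard one.
    obtain rfl : i1 = instDecidableEqFin 3 := Subsingleton.elim _ _
    fin_cases i
    · simpa using (h0 (m 1) (m 2)).map_add x y
    · simpa using (h1 (m 0) (m 2)).map_add x y
    · simpa using (h2 (m 0) (m 1)).map_add x y
  map_update_smul' {i1} m i c x := by
    obtain rfl : i1 = instDecidableEqFin 3 := Subsingleton.elim _ _
    fin_cases i
    · simpa using (h0 (m 1) (m 2)).map_smul c x
    · simpa using (h1 (m 0) (m 2)).map_smul c x
    · simpa using (h2 (m 0) (m 1)).map_smul c x

/-- A quadrilinear form as a multilinear map. -/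
def quadrilinear (f : Base n → Base n → Base n → Base n → ℝ)
    (h0 : ∀ b c d, IsLinearMap ℝ fun a => f a b c d)
    (h1 : ∀ a c d, IsLinearMap ℝ fun b => f a b c d)
    (h2 : ∀ a b d, IsLinearMap ℝ fun c => f a b c d)
    (h3 : ∀ a b c, IsLinearMap ℝ fun d => f a b c d) :
    MultilinearMap ℝ (fun _ : Fin 4 => Base n) ℝ where
  toFun m := f (m 0) (m 1) (m 2) (m 3)
  map_update_add' {i1} m i x y := by
    obtain rfl : i1 = instDecidableEqFin 4 := Subsingleton.elim _ _
    fin_cases i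
    · simpa using (h0 (m 1) (m 2) (m 3)).map_add x y
    · simpa using (h1 (m 0) (m 2) (m 3)).map_add x y
    · simpa using (h2 (m 0) (m 1) (m 3)).map_add x y
    · simpa using (h3 (m 0) (m 1) (m 2)).map_add x y
  map_update_smul' {i1} m i c x := by
    obtain rfl : i1 = instDecidableEqFin 4 := Subsingleton.elim _ _
    fin_cases i
    · simpa using (h0 (m 1) (m 2) (m 3)).map_smul c x
    · simpa using (h1 (m 0) (m 2) (m 3)).map_smul c x
    · simpa using (h2 (m 0) (m 1) (m 3)).map_smul c x
    · simpa using (h3 (m 0) (m 1) (m 2)).map_smul c x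

end Multilinear

/-! ### The covariant derivative of the metric is a natural tensor -/

section NonMetricity

variable {n : ℕ}

/-- The covariant derivative `(∇_c g)(a, b)`. -/
def nonMetricity (z : JCoord n) (a b c : Base n) : ℝ :=
  (along z.2.2 c).1.val a b - z.2.1.1.val (z.2.1.2.app c a) b - z.2.1.1.val a (z.2.1.2.app c b)

/-- The covariant derivative of the metric as a multilinear map. -/
def nonMetricityMap (z : JCoord n) : MultilinearMap ℝ (fun _ : Fin 3 => Base n) ℝ :=
  trilinear (nonMetricity z)
    (fun b c => ⟨fun a a' => by
      simp only [nonMetricity, SymForm.val_add_left, ConnForm.app_add_right]; ring, fun t a => by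
      simp only [nonMetricity, SymForm.val_smul_left, ConnForm.app_smul_right, smul_eq_mul]; ring⟩)
    (fun a c => ⟨fun a a' => by
      simp only [nonMetricity, SymForm.val_add_right, ConnForm.app_add_right]; ring, fun t a => by
      simp only [nonMetricity, SymForm.val_smul_right, ConnForm.app_smul_right, smul_eq_mul]; ring⟩)
    (fun a b => ⟨fun a a' => by
      simp only [nonMetricity, SymForm.val_add_right, SymForm.val_add_left, ConnForm.app_add_left,
        along_add, Prod.fst_add, SymForm.val_add_form]; ring, fun t a => by
      simp only [nonMetricity, SymForm.val_smul_right, SymForm.val_smul_left,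
        ConnForm.app_smul_left, along_smul, Prod.smul_fst, SymForm.val_smul_form, smul_eq_mul]
      ring⟩)

/-- The leading part of the covariant derivative of the metric. -/
def nonMetricityLin (ξ : Fin n → Fib n) : MultilinearMap ℝ (fun _ : Fin 3 => Base n) ℝ :=
  trilinear (fun a b c => (along ξ c).1.val a b)
    (fun b c => ⟨fun a a' => SymForm.val_add_left _ _ _ _, fun t a => SymForm.val_smul_left _ _ _ _⟩)
    (fun a c => ⟨fun a a' => SymForm.val_add_right _ _ _ _,
      fun t a => SymForm.val_smul_right _ _ _ _⟩)
    (fun a b => ⟨fun a a' => by simp only [along_add, Prod.fst_add, SymForm.val_add_form],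
      fun t a => by simp only [along_smul, Prod.smul_fst, SymForm.val_smul_form, smul_eq_mul]⟩)

theorem contDiffAt_nonMetricity (a b c : Base n) (z : JCoord n) :
    ContDiffAt ℝ ∞ (fun z => nonMetricity z a b c) z := by
  have hg : ContDiffAt ℝ ∞ (fun z : JCoord n => z.2.1.1) z := contDiffAt_snd.fst.fst
  have hA : ContDiffAt ℝ ∞ (fun z : JCoord n => z.2.1.2) z := contDiffAt_snd.fst.snd
  have hS : ContDiffAt ℝ ∞ (fun z : JCoord n => along z.2.2 c) z :=
    ContDiffAt.along contDiffAt_snd.snd contDiffAt_const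
  exact ((ContDiffAt.symForm_val hS.fst contDiffAt_const contDiffAt_const).sub
    (ContDiffAt.symForm_val hg (hA.connForm_app contDiffAt_const contDiffAt_const)
      contDiffAt_const)).sub (ContDiffAt.symForm_val hg contDiffAt_const
        (hA.connForm_app contDiffAt_const contDiffAt_const))

variable {N : Type*} [TopologicalSpace N] [ChartedSpace (Base n) N]

variable (n N) in
/-- The covariant derivative of the metric as a natural tensor. -/
def nonMetricityTensor : JetTensor n 3 N where
  toFun := nonMetricityMap
  lin _ := nonMetricityLin
  smooth v z := contDiffAt_nonMetricity (v 0) (v 1) (v 2) z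
  affine z ξ t v := by
    change nonMetricity _ (v 0) (v 1) (v 2)
      = nonMetricity z (v 0) (v 1) (v 2) + t * (along ξ (v 2)).1.val (v 0) (v 1)
    simp only [nonMetricity, along_add_left, along_smul_left, Prod.fst_add, Prod.smul_fst,
      SymForm.val_add_form, SymForm.val_smul_form]
    ring
  natural e e' z hz v := by
    change nonMetricity (jTrans e e' z) _ _ _ = nonMetricity z (v 0) (v 1) (v 2)
    -- The second derivatives of the coordinate change in the derivative of the metric cancel
    -- against those in the two connection terms.
    have h := jTrans_along_val hz (v 0) (v 1) (v 2)
    simp only [nonMetricity, jTrans_app hz, SymForm.val_sub_left, SymForm.val_sub_right,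
      jTrans_val hz]
    linarith
  infNatural u z hu v := by
    set Z := prolong u (liftFib u) z with hZ
    have hl := hasDerivAt_line z Z 0
    have hg := hl.prod_snd.prod_fst.prod_fst
    have hA := hl.prod_snd.prod_fst.prod_snd
    have hc := fun a : Base n => hasDerivAt_const (0 : ℝ) a
    have hS := (hl.prod_snd.prod_snd.along (hc (v 2))).prod_fst
    have h1 := (hS.symForm_val (hc (v 0)) (hc (v 1))).sub
      (hg.symForm_val (hA.connForm_app (hc (v 2)) (hc (v 0))) (hc (v 1))) |>.sub
      (hg.symForm_val (hc (v 0)) (hA.connForm_app (hc (v 2)) (hc (v 1))))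
    have h2 := ((contDiffAt_nonMetricity (v 0) (v 1) (v 2) z).differentiableAt
      (by simp)).hasDerivAt_line Z
    have h3 := h2.unique h1
    change fderiv ℝ (fun z => nonMetricity z (v 0) (v 1) (v 2)) z Z = _
    rw [h3, Fin.sum_univ_three]
    change _ = -(nonMetricity z _ _ _ + nonMetricity z _ _ _ + nonMetricity z _ _ _)
    have h0 : z + (0 : ℝ) • Z = z := by simp
    have hs : ∀ S : Fin n → Fib n, along S 0 = 0 := fun S => by simp [along]
    simp only [h0, hs, add_zero, val_zero_left, val_zero_right, app_zero_left, app_zero_right]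
    rw [hZ, along_prolong_val hu, prolong_val, prolong_val, prolong_app hu, prolong_app hu]
    simp only [nonMetricity, SymForm.val_add_left, SymForm.val_sub_left, SymForm.val_neg_left,
      SymForm.val_add_right, SymForm.val_sub_right, SymForm.val_neg_right]
    simp
    ring

end NonMetricity

/-! ### The curvatures of the connection and of its transpose are natural tensors -/

section Curvature

variable {n : ℕ}

/-- The transposition of connections as a continuous linear map. -/
noncomputable def transposeCLM (n : ℕ) : ConnForm n →L[ℝ] ConnForm n :=
  LinearMap.toContinuousLinearMap
    { toFun := ConnForm.transpose
      map_add' := fun _ _ => rfl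
      map_smul' := fun _ _ => rfl }

/-- `θ` is the identity or the transposition of the lower indices. -/
def IsIdOrTranspose (θ : ConnForm n →L[ℝ] ConnForm n) : Prop :=
  (∀ (A : ConnForm n) a b, (θ A).app a b = A.app a b) ∨
    ∀ (A : ConnForm n) a b, (θ A).app a b = A.app b a

theorem isIdOrTranspose_id : IsIdOrTranspose (ContinuousLinearMap.id ℝ (ConnForm n)) :=
  Or.inl fun _ _ _ => rfl

theorem isIdOrTranspose_transposeCLM : IsIdOrTranspose (transposeCLM n) :=
  Or.inr fun A a b => A.app_transpose a b

/-- The curvature `R(a, b) c` of the connection `θ A`. -/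
def curvature (θ : ConnForm n →L[ℝ] ConnForm n) (z : JCoord n) (a b c : Base n) : Base n :=
  (θ (along z.2.2 a).2).app b c - (θ (along z.2.2 b).2).app a c
    + (θ z.2.1.2).app a ((θ z.2.1.2).app b c) - (θ z.2.1.2).app b ((θ z.2.1.2).app a c)

/-- The curvature as a covariant `4`-tensor. -/
def curvatureMap (θ : ConnForm n →L[ℝ] ConnForm n) (z : JCoord n) :
    MultilinearMap ℝ (fun _ : Fin 4 => Base n) ℝ :=
  quadrilinear (fun a b c d => z.2.1.1.val (curvature θ z a b c) d)
    (fun b c d => ⟨fun a a' => by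
      simp only [curvature, along_add, Prod.snd_add, map_add, ConnForm.app_add_form,
        ConnForm.app_add_left, ConnForm.app_add_right, SymForm.val_add_left, SymForm.val_sub_left]
      ring, fun t a => by
      simp only [curvature, along_smul, Prod.smul_snd, map_smul, ConnForm.app_smul_form,
        ConnForm.app_smul_left, ConnForm.app_smul_right, SymForm.val_add_left,
        SymForm.val_sub_left, SymForm.val_smul_left, smul_eq_mul]
      ring⟩)
    (fun b c d => ⟨fun a a' => by
      simp only [curvature, along_add, Prod.snd_add, map_add, ConnForm.app_add_form,
        ConnForm.app_add_left, ConnForm.app_add_right, SymForm.val_add_left, SymForm.val_sub_left]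
      ring, fun t a => by
      simp only [curvature, along_smul, Prod.smul_snd, map_smul, ConnForm.app_smul_form,
        ConnForm.app_smul_left, ConnForm.app_smul_right, SymForm.val_add_left,
        SymForm.val_sub_left, SymForm.val_smul_left, smul_eq_mul]
      ring⟩)
    (fun a b d => ⟨fun c c' => by
      simp only [curvature, ConnForm.app_add_right, SymForm.val_add_left, SymForm.val_sub_left]
      ring, fun t a => by
      simp only [curvature, ConnForm.app_smul_right, SymForm.val_add_left,
        SymForm.val_sub_left, SymForm.val_smul_left, smul_eq_mul]
      ring⟩)
    (fun a b c => ⟨fun d d' => SymForm.val_add_right _ _ _ _,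
      fun t d => SymForm.val_smul_right _ _ _ _⟩)

/-- The leading part of the curvature. -/
def curvatureLin (θ : ConnForm n →L[ℝ] ConnForm n) (w : ECoord n) (ξ : Fin n → Fib n) :
    MultilinearMap ℝ (fun _ : Fin 4 => Base n) ℝ :=
  quadrilinear
    (fun a b c d => w.2.1.val ((θ (along ξ a).2).app b c - (θ (along ξ b).2).app a c) d)
    (fun b c d => ⟨fun a a' => by
      simp only [along_add, Prod.snd_add, map_add, ConnForm.app_add_form,
        ConnForm.app_add_left, SymForm.val_add_left, SymForm.val_sub_left]
      ring, fun t a => by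
      simp only [along_smul, Prod.smul_snd, map_smul, ConnForm.app_smul_form,
        ConnForm.app_smul_left, SymForm.val_sub_left, SymForm.val_smul_left, smul_eq_mul]
      ring⟩)
    (fun b c d => ⟨fun a a' => by
      simp only [along_add, Prod.snd_add, map_add, ConnForm.app_add_form,
        ConnForm.app_add_left, SymForm.val_add_left, SymForm.val_sub_left]
      ring, fun t a => by
      simp only [along_smul, Prod.smul_snd, map_smul, ConnForm.app_smul_form,
        ConnForm.app_smul_left, SymForm.val_sub_left, SymForm.val_smul_left, smul_eq_mul]
      ring⟩)
    (fun a b d => ⟨fun c c' => by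
      simp only [ConnForm.app_add_right, SymForm.val_add_left, SymForm.val_sub_left]
      ring, fun t a => by
      simp only [ConnForm.app_smul_right, SymForm.val_sub_left, SymForm.val_smul_left, smul_eq_mul]
      ring⟩)
    (fun a b c => ⟨fun d d' => SymForm.val_add_right _ _ _ _,
      fun t d => SymForm.val_smul_right _ _ _ _⟩)

theorem contDiffAt_curvature (θ : ConnForm n →L[ℝ] ConnForm n) (a b c d : Base n) (z : JCoord n) :
    ContDiffAt ℝ ∞ (fun z => z.2.1.1.val (curvature θ z a b c) d) z := by
  have hg : ContDiffAt ℝ ∞ (fun z : JCoord n => z.2.1.1) z := contDiffAt_snd.fst.fst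
  have hA : ContDiffAt ℝ ∞ (fun z : JCoord n => θ z.2.1.2) z :=
    θ.contDiff.contDiffAt.comp z contDiffAt_snd.fst.snd
  have hS : ∀ a, ContDiffAt ℝ ∞ (fun z : JCoord n => θ (along z.2.2 a).2) z := fun a =>
    θ.contDiff.contDiffAt.comp z (ContDiffAt.along contDiffAt_snd.snd contDiffAt_const).snd
  have hc : ∀ a : Base n, ContDiffAt ℝ ∞ (fun _ : JCoord n => a) z := fun _ => contDiffAt_const
  exact ContDiffAt.symForm_val hg (((((hS a).connForm_app (hc b) (hc c)).sub
    ((hS b).connForm_app (hc a) (hc c))).add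
    (hA.connForm_app (hc a) (hA.connForm_app (hc b) (hc c)))).sub
    (hA.connForm_app (hc b) (hA.connForm_app (hc a) (hc c)))) (hc d)

variable {N : Type*} [TopologicalSpace N] [ChartedSpace (Base n) N]

/-- The inhomogeneous term is symmetric in `a` and `b`, so the transposed connection obeys the law
of a connection too. -/
theorem IsIdOrTranspose.jTrans_app {θ : ConnForm n →L[ℝ] ConnForm n} (hθ : IsIdOrTranspose θ)
    {e e' : CoordSys n N} {z : JCoord n} (hz : z.1 ∈ overlap e e') (a b : Base n) :
    (θ (jTrans e e' z).2.1.2).app (fderiv ℝ (transition e e') z.1 a)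
        (fderiv ℝ (transition e e') z.1 b)
      = fderiv ℝ (transition e e') z.1 ((θ z.2.1.2).app a b)
        - fderiv ℝ (fderiv ℝ (transition e e')) z.1 a b := by
  rcases hθ with h | h
  · simp only [h, _root_.jTrans_app hz]
  · simp only [h, _root_.jTrans_app hz]
    rw [fderiv_fderiv_symm (contDiffAt_transition hz)]

theorem IsIdOrTranspose.jTrans_along_app {θ : ConnForm n →L[ℝ] ConnForm n}
    (hθ : IsIdOrTranspose θ) {e e' : CoordSys n N} {z : JCoord n} (hz : z.1 ∈ overlap e e')
    (a b c : Base n) :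
    (θ (along (jTrans e e' z).2.2 (fderiv ℝ (transition e e') z.1 c)).2).app
        (fderiv ℝ (transition e e') z.1 a) (fderiv ℝ (transition e e') z.1 b)
      = fderiv ℝ (fderiv ℝ (transition e e')) z.1 c ((θ z.2.1.2).app a b)
        + fderiv ℝ (transition e e') z.1 ((θ (along z.2.2 c).2).app a b)
        - fderiv ℝ (fderiv ℝ (fderiv ℝ (transition e e'))) z.1 c a b
        - (θ (jTrans e e' z).2.1.2).app (fderiv ℝ (fderiv ℝ (transition e e')) z.1 c a)
          (fderiv ℝ (transition e e') z.1 b)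
        - (θ (jTrans e e' z).2.1.2).app (fderiv ℝ (transition e e') z.1 a)
          (fderiv ℝ (fderiv ℝ (transition e e')) z.1 c b) := by
  rcases hθ with h | h
  · simp only [h, ← _root_.jTrans_along_app hz]
    abel
  · simp only [h]
    rw [fderiv_fderiv_fderiv_symm_right (contDiffAt_transition hz),
      ← _root_.jTrans_along_app hz]
    abel

/-- Antisymmetrization in `a` and `b` removes all second and third derivatives of the coordinate
change. -/
theorem curvature_jTrans {θ : ConnForm n →L[ℝ] ConnForm n} (hθ : IsIdOrTranspose θ)
    {e e' : CoordSys n N} {z : JCoord n} (hz : z.1 ∈ overlap e e') (a b c : Base n) :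
    curvature θ (jTrans e e' z) (fderiv ℝ (transition e e') z.1 a)
        (fderiv ℝ (transition e e') z.1 b) (fderiv ℝ (transition e e') z.1 c)
      = fderiv ℝ (transition e e') z.1 (curvature θ z a b c) := by
  have hτ := contDiffAt_transition hz
  simp only [curvature, hθ.jTrans_along_app hz, hθ.jTrans_app hz, map_add, map_sub,
    ConnForm.app_sub_right]
  rw [fderiv_fderiv_fderiv_symm_left hτ b a c, fderiv_fderiv_symm hτ b a]
  abel

theorem IsIdOrTranspose.prolong_app {θ : ConnForm n →L[ℝ] ConnForm n} (hθ : IsIdOrTranspose θ)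
    {u : Base n → Base n} {z : JCoord n} (hu : ContDiffAt ℝ ∞ u z.1) (a b : Base n) :
    (θ (prolong u (liftFib u) z).2.1.2).app a b
      = -fderiv ℝ (fderiv ℝ u) z.1 a b + fderiv ℝ u z.1 ((θ z.2.1.2).app a b)
      - (θ z.2.1.2).app a (fderiv ℝ u z.1 b) - (θ z.2.1.2).app (fderiv ℝ u z.1 a) b := by
  rcases hθ with h | h
  · simp only [h, _root_.prolong_app hu]
  · simp only [h, _root_.prolong_app hu]
    rw [fderiv_fderiv_symm hu]
    abel

theorem IsIdOrTranspose.along_prolong_app {θ : ConnForm n →L[ℝ] ConnForm n}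
    (hθ : IsIdOrTranspose θ) {u : Base n → Base n} {z : JCoord n} (hu : ContDiffAt ℝ ∞ u z.1)
    (a b c : Base n) :
    (θ (along (prolong u (liftFib u) z).2.2 c).2).app a b
      = -fderiv ℝ (fderiv ℝ (fderiv ℝ u)) z.1 c a b
        + fderiv ℝ (fderiv ℝ u) z.1 c ((θ z.2.1.2).app a b)
        + fderiv ℝ u z.1 ((θ (along z.2.2 c).2).app a b)
        - (θ (along z.2.2 c).2).app a (fderiv ℝ u z.1 b)
        - (θ z.2.1.2).app a (fderiv ℝ (fderiv ℝ u) z.1 c b)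
        - (θ (along z.2.2 c).2).app (fderiv ℝ u z.1 a) b
        - (θ z.2.1.2).app (fderiv ℝ (fderiv ℝ u) z.1 c a) b
        - (θ (along z.2.2 (fderiv ℝ u z.1 c)).2).app a b := by
  rcases hθ with h | h
  · simp only [h, _root_.along_prolong_app hu]
  · simp only [h, _root_.along_prolong_app hu]
    rw [fderiv_fderiv_fderiv_symm_right hu]
    abel

/-- The curvature as a natural tensor. -/
def curvatureTensor (N : Type*) [TopologicalSpace N] [ChartedSpace (Base n) N]
    {θ : ConnForm n →L[ℝ] ConnForm n} (hθ : IsIdOrTranspose θ) : JetTensor n 4 N where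
  toFun := curvatureMap θ
  lin := curvatureLin θ
  smooth v z := contDiffAt_curvature θ (v 0) (v 1) (v 2) (v 3) z
  affine z ξ t v := by
    change z.2.1.1.val (curvature θ _ (v 0) (v 1) (v 2)) (v 3)
      = z.2.1.1.val (curvature θ z (v 0) (v 1) (v 2)) (v 3) + t * z.2.1.1.val
        ((θ (along ξ (v 0)).2).app (v 1) (v 2) - (θ (along ξ (v 1)).2).app (v 0) (v 2)) (v 3)
    simp only [curvature, along_add_left, along_smul_left, Prod.snd_add, Prod.smul_snd, map_add,
      map_smul, ConnForm.app_add_form, ConnForm.app_smul_form, SymForm.val_add_left,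
      SymForm.val_sub_left, SymForm.val_smul_left]
    ring
  natural e e' z hz v := by
    change (jTrans e e' z).2.1.1.val (curvature θ _ _ _ _) _
      = z.2.1.1.val (curvature θ z (v 0) (v 1) (v 2)) (v 3)
    rw [curvature_jTrans hθ hz, jTrans_val hz]
  infNatural u z hu v := by
    set Z := prolong u (liftFib u) z with hZ
    have hl := hasDerivAt_line z Z 0
    have hg := hl.prod_snd.prod_fst.prod_fst
    have hA : HasDerivAt (fun t : ℝ => θ (z + t • Z).2.1.2) (θ Z.2.1.2) 0 :=
      θ.hasFDerivAt.comp_hasDerivAt 0 hl.prod_snd.prod_fst.prod_snd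
    have hc := fun a : Base n => hasDerivAt_const (0 : ℝ) a
    have hS := fun a : Base n =>
      θ.hasFDerivAt.comp_hasDerivAt 0 (hl.prod_snd.prod_snd.along (hc a)).prod_snd
    have h1 := hg.symForm_val ((((hS (v 0)).connForm_app (hc (v 1)) (hc (v 2))).sub
      ((hS (v 1)).connForm_app (hc (v 0)) (hc (v 2)))).add
      (hA.connForm_app (hc (v 0)) (hA.connForm_app (hc (v 1)) (hc (v 2)))) |>.sub
      (hA.connForm_app (hc (v 1)) (hA.connForm_app (hc (v 0)) (hc (v 2))))) (hc (v 3))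
    have h2 := ((contDiffAt_curvature θ (v 0) (v 1) (v 2) (v 3) z).differentiableAt
      (by simp)).hasDerivAt_line Z
    have h3 := h2.unique h1
    change fderiv ℝ (fun z => z.2.1.1.val (curvature θ z (v 0) (v 1) (v 2)) (v 3)) z Z = _
    rw [h3, Fin.sum_univ_four]
    change _ = -(z.2.1.1.val (curvature θ z _ _ _) _ + z.2.1.1.val (curvature θ z _ _ _) _
      + z.2.1.1.val (curvature θ z _ _ _) _ + z.2.1.1.val (curvature θ z _ _ _) _)
    have h0 : z + (0 : ℝ) • Z = z := by simp
    have hs : ∀ S : Fin n → Fib n, along S 0 = 0 := fun S => by simp [along]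
    simp only [Function.comp_apply, Pi.sub_apply, Pi.add_apply, h0, hs, add_zero, val_zero_right,
      app_zero_left, app_zero_right]
    rw [hZ, hθ.along_prolong_app hu, hθ.along_prolong_app hu, hθ.prolong_app hu,
      hθ.prolong_app hu, hθ.prolong_app hu, hθ.prolong_app hu, prolong_val,
      fderiv_fderiv_fderiv_symm_left hu (v 1) (v 0) (v 2), fderiv_fderiv_symm hu (v 1) (v 0)]
    simp only [curvature, SymForm.val_add_left, SymForm.val_sub_left, SymForm.val_neg_left,
      ConnForm.app_add_right, ConnForm.app_sub_right, ConnForm.app_neg_right, map_add, map_sub]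
    simp
    ring

end Curvature

/-! ### The bracket of `D^γ` with a prolonged natural lift -/

section Bracket

variable {n : ℕ} {N : Type*} [TopologicalSpace N] [ChartedSpace (Base n) N] {p q : ℕ}

/-- The components of the bracket of `D^γ` with the prolongation of the natural lift of `u`. -/
noncomputable def EhresmannConnection.liftDeviation (γ : EhresmannConnection n N p q)
    (e : CoordSys n N) (u : Base n → Base n) (w : ECoord n) (i : Fin n) : Fib n :=
  fderiv ℝ (liftFib u) w (0, γ.form e w (EuclideanSpace.single i 1, 0))
    - ∑ k, pd i u w.1 k • γ.form e w (EuclideanSpace.single k 1, 0)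
    - fderiv ℝ (fun w => γ.form e w (EuclideanSpace.single i 1, 0)) w (u w.1, liftFib u w)
    - fderiv ℝ (liftFib u) w (EuclideanSpace.single i 1, 0)

/-- Prolongations are affine along the fibres of `J¹E → E`; their vertical derivatives are therefore
exact increments. -/
theorem prolong_add_smul_vertical (u : Base n → Base n) (v : ECoord n → Fib n) (z : JCoord n)
    (η : Fin n → Fib n) (t : ℝ) : prolong u v (z + t • ((0, 0, η) : JCoord n))
      = prolong u v z + t • ((0, 0, fun i =>
        fderiv ℝ v z.toE (0, η i) - ∑ k, pd i u z.1 k • η k) : JCoord n) := by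
  have e1 : (z + t • ((0, 0, η) : JCoord n)).toE = z.toE := by
    refine Prod.ext ?_ ?_ <;> simp [JCoord.toE]
  have e2 : (z + t • ((0, 0, η) : JCoord n)).1 = z.1 := by simp
  refine Prod.ext ?_ (Prod.ext ?_ (funext fun i => ?_))
  · simp [prolong]
  · simp only [prolong, e1]; simp
  · simp only [prolong, e1, e2, Prod.snd_add, Prod.smul_snd, Pi.add_apply, Pi.smul_apply]
    have e3 : ((EuclideanSpace.single i 1, z.2.2 i + t • η i) : ECoord n)
        = (EuclideanSpace.single i 1, z.2.2 i) + t • (0, η i) := by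
      refine Prod.ext ?_ ?_ <;> simp
    rw [e3, map_add, map_smul]
    simp only [smul_add, Finset.sum_add_distrib, smul_sub, Finset.smul_sum, smul_comm t]
    abel

theorem fderiv_prolong_vertical {u : Base n → Base n} {v : ECoord n → Fib n} {z : JCoord n}
    (h : DifferentiableAt ℝ (prolong u v) z) (η : Fin n → Fib n) :
    fderiv ℝ (prolong u v) z (0, 0, η)
      = (0, 0, fun i => fderiv ℝ v z.toE (0, η i) - ∑ k, pd i u z.1 k • η k) := by
  have h1 := h.hasDerivAt_line (0, 0, η)
  simp only [prolong_add_smul_vertical] at h1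
  exact h1.unique (hasDerivAt_line _ _ _)

theorem EhresmannConnection.contDiffAt_form (γ : EhresmannConnection n N p q) {e : CoordSys n N}
    {w : ECoord n} (hw : w ∈ eDom p q e) (V : ECoord n) :
    ContDiffAt ℝ ∞ (fun w => γ.form e w V) w :=
  ((γ.smooth e).contDiffAt ((isOpen_eDom e).mem_nhds hw)).clm_apply contDiffAt_const

theorem EhresmannConnection.fderiv_vert (γ : EhresmannConnection n N p q) {e : CoordSys n N}
    {z : JCoord n} (hz : z ∈ jDom p q e) (Z : JCoord n) :
    fderiv ℝ (γ.vert e) z Z = (0, 0, fun i =>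
      fderiv ℝ (fun w => γ.form e w (EuclideanSpace.single i 1, 0)) z.toE Z.toE + Z.2.2 i) := by
  have h1 := ((γ.contDiffAt_vert hz).differentiableAt (by simp)).hasDerivAt_line Z
  have hE : HasDerivAt (fun t : ℝ => (z + t • Z).toE) Z.toE 0 :=
    (hasDerivAt_line z Z 0).prod_fst.prodMk (hasDerivAt_line z Z 0).prod_snd.prod_fst
  have h2 : ∀ i, HasDerivAt (fun t : ℝ => γ.form e (z + t • Z).toE (EuclideanSpace.single i 1, 0)
      + (z + t • Z).2.2 i)
      (fderiv ℝ (fun w => γ.form e w (EuclideanSpace.single i 1, 0)) z.toE Z.toE + Z.2.2 i) 0 :=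
    fun i => HasDerivAt.add
      (((γ.contDiffAt_form hz _).differentiableAt (by simp)).hasFDerivAt.comp_hasDerivAt_of_eq 0 hE
        (by simp)) (hasDerivAt_pi.1 (hasDerivAt_line z Z 0).prod_snd.prod_snd i)
  have h3 := (hasDerivAt_const (0 : ℝ) (0 : Base n)).prodMk
    ((hasDerivAt_const (0 : ℝ) (0 : Fib n)).prodMk (hasDerivAt_pi.2 h2))
  refine h1.unique (h3.congr_of_eventuallyEq ?_)
  have hev : ∀ᶠ z' in nhds z, z' ∈ jDom p q e := (isOpen_jDom e).mem_nhds hz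
  filter_upwards [(tendsto_line z Z).eventually hev] with t ht
  refine Prod.ext rfl (Prod.ext rfl (funext fun i => ?_))
  exact γ.form_apply (show (z + t • Z).toE ∈ eDom p q e from ht) _ _

/-- The terms containing the jet coordinates cancel. The bracket is thus vertical over `E`, with the
same components at every jet over a given point of `E`. -/
theorem EhresmannConnection.lieBracket_vert_prolong (γ : EhresmannConnection n N p q)
    {e : CoordSys n N} {z : JCoord n} (hz : z ∈ jDom p q e) {u : Base n → Base n}
    (hu : ContDiffAt ℝ ∞ u z.1) :
    VectorField.lieBracket ℝ (γ.vert e) (prolong u (liftFib u)) z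
      = (0, 0, γ.liftDeviation e u z.toE) := by
  have hd : DifferentiableAt ℝ (prolong u (liftFib u)) z :=
    (contDiffAt_prolong hu (contDiffAt_liftFib (w := z.toE) hu)).differentiableAt (by simp)
  rw [VectorField.lieBracket, γ.fderiv_vert hz]
  have h1 : γ.vert e z = (0, 0, fun i => γ.form e z.toE (EuclideanSpace.single i 1, 0) + z.2.2 i) :=
    Prod.ext rfl (Prod.ext rfl (funext fun i => γ.form_apply hz _ _))
  rw [h1, fderiv_prolong_vertical hd]
  refine Prod.ext (sub_zero _) (Prod.ext (sub_zero _) (funext fun i => ?_))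
  change fderiv ℝ (liftFib u) z.toE (0, _ + z.2.2 i) - ∑ k, pd i u z.1 k • (_ + z.2.2 k)
    - (fderiv ℝ _ z.toE (u z.1, liftFib u z.toE) + (fderiv ℝ (liftFib u) z.toE
      (EuclideanSpace.single i 1, z.2.2 i) - ∑ k, pd i u z.1 k • z.2.2 k)) = _
  have e1 : ∀ a : Base n, ∀ b c : Fib n, ((a, b + c) : ECoord n) = (a, b) + (0, c) := fun a b c => by
    simp
  have e2 : ((EuclideanSpace.single i 1, z.2.2 i) : ECoord n)
      = (EuclideanSpace.single i 1, 0) + (0, z.2.2 i) := by simp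
  rw [e1, e2, map_add, map_add]
  simp only [smul_add, Finset.sum_add_distrib, EhresmannConnection.liftDeviation]
  have e3 : z.toE.1 = z.1 := rfl
  rw [e3]
  abel

theorem LagrangianDensity.contDiffAt (Λ : LagrangianDensity n N p q) {e : CoordSys n N}
    {z : JCoord n} (hz : z ∈ jDom p q e) : ContDiffAt ℝ ∞ (Λ.coeff e) z :=
  (Λ.smooth e).contDiffAt ((isOpen_jDom e).mem_nhds hz)

theorem contDiffAt_covariantHamiltonian (γ : EhresmannConnection n N p q)
    (Λ : LagrangianDensity n N p q) {e : CoordSys n N} {z : JCoord n} (hz : z ∈ jDom p q e) :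
    ContDiffAt ℝ ∞ (covariantHamiltonian γ Λ e) z :=
  (((Λ.contDiffAt hz).fderiv_right (m := ∞) (by simp)).clm_apply (γ.contDiffAt_vert hz)).sub
    (Λ.contDiffAt hz)

end Bracket

/-! ### Invariance as a scalar equation, and its defect for the covariant Hamiltonian -/

section Invariance

variable {n : ℕ} {N : Type*} [TopologicalSpace N] [ChartedSpace (Base n) N]
  [IsManifold (𝓡 n) ∞ N] {p q : ℕ}

theorem isInvariantDensity_iff {L : CoordSys n N → JCoord n → ℝ}
    (hL : ∀ e, ∀ z ∈ jDom p q e, DifferentiableAt ℝ (L e) z) :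
    IsInvariantDensity p q L ↔ ∀ X : (x : N) → TangentSpace (𝓡 n) x, IsSmoothVectorField X →
      ∀ e, ∀ z ∈ jDom p q e, fderiv ℝ (L e) z (jetLift X e z)
        + LinearMap.trace ℝ (Base n) (fderiv ℝ (localExpr X e) z.1).toLinearMap * L e z = 0 := by
  have key : ∀ X : (x : N) → TangentSpace (𝓡 n) x, IsSmoothVectorField X →
      ∀ e, ∀ z ∈ jDom p q e, ∀ V : Fin n → JCoord n,
      lieDerivForm (jetLift X e) (horizontalForm (L e)) z V = (fderiv ℝ (L e) z (jetLift X e z)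
        + LinearMap.trace ℝ (Base n) (fderiv ℝ (localExpr X e) z.1).toLinearMap * L e z)
        * (EuclideanSpace.basisFun (Fin n) ℝ).toBasis.det fun i => (V i).1 := fun X hX e z hz V =>
    lieDerivForm_horizontalForm (hL e z hz)
      ((contDiffAt_jetLift hX (z := z) hz.1).differentiableAt (by simp))
      ((contDiffAt_localExpr hX e hz.1).differentiableAt (by simp)) V
  refine ⟨fun h X hX e z hz => ?_, fun h X hX e z hz V => ?_⟩
  -- On the standard frame the determinant factor is `1`.
  · have h1 := h X hX e z hz fun i => ((EuclideanSpace.basisFun (Fin n) ℝ).toBasis i, 0)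
    rw [key X hX e z hz, Module.Basis.det_self, mul_one] at h1
    exact h1
  · rw [key X hX e z hz, h X hX e z hz, zero_mul]

/-- The failure of invariance of the covariant Hamiltonian is given by the bracket with `D^γ`. -/
theorem fderiv_covariantHamiltonian (γ : EhresmannConnection n N p q)
    {Λ : LagrangianDensity n N p q} (hΛ : IsInvariantDensity p q Λ.coeff)
    {X : (x : N) → TangentSpace (𝓡 n) x} (hX : IsSmoothVectorField X) {e : CoordSys n N}
    {z : JCoord n} (hz : z ∈ jDom p q e) :
    fderiv ℝ (covariantHamiltonian γ Λ e) z (jetLift X e z)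
        + LinearMap.trace ℝ (Base n) (fderiv ℝ (localExpr X e) z.1).toLinearMap
          * covariantHamiltonian γ Λ e z
      = -fderiv ℝ (Λ.coeff e) z (VectorField.lieBracket ℝ (γ.vert e) (jetLift X e) z) := by
  have hinv := (isInvariantDensity_iff fun e z hz =>
    (Λ.contDiffAt hz).differentiableAt (by simp)).1 hΛ X hX e
  have hL := Λ.contDiffAt hz
  have hD := (γ.contDiffAt_vert hz).differentiableAt (by simp)
  have hXd : DifferentiableAt ℝ (jetLift X e) z :=
    (contDiffAt_jetLift hX (z := z) hz.1).differentiableAt (by simp)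
  have hdL := hL.differentiableAt_fderiv
  have hbr := VectorField.fderiv_apply_lieBracket (n := ∞) hL
    (by simpa using WithTop.coe_le_coe.2 (le_top (a := (2 : ℕ∞)))) hXd hD
  set c := LinearMap.trace ℝ (Base n) (fderiv ℝ (localExpr X e) z.1).toLinearMap with hc
  -- The invariance equation of `L` is differentiated along `D^γ`; as the base point does not move,
  -- the divergence `c` is constant on the line.
  have h1 : HasDerivAt (fun t : ℝ => fderiv ℝ (Λ.coeff e) (z + t • γ.vert e z)
      (jetLift X e (z + t • γ.vert e z)) + c * Λ.coeff e (z + t • γ.vert e z))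
      (fderiv ℝ (fun y => fderiv ℝ (Λ.coeff e) y (jetLift X e y)) z (γ.vert e z)
        + c * fderiv ℝ (Λ.coeff e) z (γ.vert e z)) 0 :=
    ((hdL.clm_apply hXd).hasDerivAt_line (γ.vert e z)).add
      (((hL.differentiableAt (by simp)).hasDerivAt_line (γ.vert e z)).const_mul c)
  have hev : ∀ᶠ z' in nhds z, z' ∈ jDom p q e := (isOpen_jDom e).mem_nhds hz
  have h2 := h1.unique ((hasDerivAt_const (0 : ℝ) (0 : ℝ)).congr_of_eventuallyEq (by
    filter_upwards [(tendsto_line z (γ.vert e z)).eventually hev] with t ht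
    have h3 := hinv _ ht
    have e1 : (z + t • γ.vert e z).1 = z.1 := by simp [EhresmannConnection.vert]
    rw [e1] at h3
    exact h3))
  have h3 : fderiv ℝ (covariantHamiltonian γ Λ e) z (jetLift X e z)
      = fderiv ℝ (fun y => fderiv ℝ (Λ.coeff e) y (γ.vert e y)) z (jetLift X e z)
        - fderiv ℝ (Λ.coeff e) z (jetLift X e z) := by
    have := (hdL.clm_apply hD).hasFDerivAt.sub (hL.differentiableAt (by simp)).hasFDerivAt
    exact DFunLike.congr_fun this.fderiv (jetLift X e z)
  have h4 := hinv z hz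
  rw [h3, covariantHamiltonian]
  rw [hbr]
  linear_combination h2 - h4

end Invariance

/-! ### Vertical vectors annihilated by the test Lagrangians -/

section VerticalDirections

variable {n : ℕ} {N : Type*} [TopologicalSpace N] [ChartedSpace (Base n) N] {p q : ℕ}

/-- A vertical vector of `J¹E → E` given by a symmetric `3`-tensor in the direction of the
connections. -/
structure IsSymmetricVertical (ξ : Fin n → Fib n) : Prop where
  fst_eq_zero : ∀ k, (ξ k).1 = 0
  swap_left : ∀ i a b c, (ξ a).2 i b c = (ξ b).2 i a c
  swap_right : ∀ i a b c, (ξ a).2 i b c = (ξ a).2 i c b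

/-- The linear part of the covariant derivative of the metric is the metric part of the jet, an
arbitrary `3`-tensor symmetric in two slots. Raising keeps this symmetry, so `JetTensor.lin_eq_zero`
applies. -/
theorem fst_eq_zero_of_fderiv_coeff_eq_zero {v : CoordSys n N → Base n → ℝ} {e : CoordSys n N}
    {w : ECoord n} (hw : w ∈ eDom p q e) (hv : ContinuousAt (v e) w.1) (h0 : v e w.1 ≠ 0)
    {ξ : Fin n → Fib n}
    (h : ∀ S, fderiv ℝ ((nonMetricityTensor n N).coeff v e) (w.1, w.2, S) (0, 0, ξ) = 0)
    (k : Fin n) : (ξ k).1 = 0 := by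
  have hc : ∀ (S : Fin n → Fib n) (J : Fin 3 → Fin n),
      tcomp ((nonMetricityTensor n N).lin w S) J = (S (J 2)).1 s(J 0, J 1) := fun S J => by
    change (along S (EuclideanSpace.single (J 2) 1)).1.val (EuclideanSpace.single (J 0) 1)
      (EuclideanSpace.single (J 1) 1) = _
    rw [along_single, SymForm.val_single]
  set τ := (tpow 3 w.2.1.mat⁻¹).mulVec (tcomp ((nonMetricityTensor n N).lin w ξ)) with hτ
  have hsymm : ∀ I, τ (I ∘ Equiv.swap 0 1) = τ I := fun I => by
    rw [hτ, tpow_mulVec_comp]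
    congr 2
    funext J
    rw [hc, hc, Sym2.eq_swap]
    rfl
  have h1 := (nonMetricityTensor n N).lin_eq_zero hw hv h0 h
    (S := fun k => (Sym2.lift ⟨fun i j => τ ![i, j, k], fun i j => by
      refine (hsymm _).symm.trans (congrArg τ ?_)
      funext m
      fin_cases m <;> rfl⟩, 0)) (funext fun I => by
      rw [hc]
      change τ ![I 0, I 1, I 2] = τ I
      congr 1
      funext m
      fin_cases m <;> rfl)
  funext s
  induction s using Sym2.ind with
  | _ i j =>
    have h2 := congrFun h1 ![i, j, k]
    rw [hc] at h2
    exact h2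

/-- The linear part of the curvature is an antisymmetrization, so its vanishing is the asserted
symmetry. The linear parts fill all `4`-tensors antisymmetric in the first two slots, and raising
preserves this class. -/
theorem app_comm_of_fderiv_coeff_eq_zero {v : CoordSys n N → Base n → ℝ} {e : CoordSys n N}
    {w : ECoord n} (hw : w ∈ eDom p q e) (hv : ContinuousAt (v e) w.1) (h0 : v e w.1 ≠ 0)
    {θ : ConnForm n →L[ℝ] ConnForm n} (hθ : IsIdOrTranspose θ) (hs : Function.Surjective θ)
    {ξ : Fin n → Fib n}
    (h : ∀ S, fderiv ℝ ((curvatureTensor N hθ).coeff v e) (w.1, w.2, S) (0, 0, ξ) = 0)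
    (i a b c : Fin n) : θ (ξ a).2 i b c = θ (ξ b).2 i a c := by
  have hc : ∀ (S : Fin n → Fib n) (J : Fin 4 → Fin n),
      tcomp ((curvatureTensor N hθ).lin w S) J
        = w.2.1.val (WithLp.toLp 2 fun i => θ (S (J 0)).2 i (J 1) (J 2))
            (EuclideanSpace.single (J 3) 1)
          - w.2.1.val (WithLp.toLp 2 fun i => θ (S (J 1)).2 i (J 0) (J 2))
            (EuclideanSpace.single (J 3) 1) := fun S J => by
    change w.2.1.val ((θ (along S (EuclideanSpace.single (J 0) 1)).2).app
      (EuclideanSpace.single (J 1) 1) (EuclideanSpace.single (J 2) 1)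
      - (θ (along S (EuclideanSpace.single (J 1) 1)).2).app
      (EuclideanSpace.single (J 0) 1) (EuclideanSpace.single (J 2) 1))
      (EuclideanSpace.single (J 3) 1) = _
    rw [along_single, along_single, SymForm.val_sub_left]
    congr 2
    · ext i; exact ConnForm.app_single _ _ _ _
    · ext i; exact ConnForm.app_single _ _ _ _
  set τ := (tpow 4 w.2.1.mat⁻¹).mulVec (tcomp ((curvatureTensor N hθ).lin w ξ)) with hτ
  have hanti : ∀ I, τ (I ∘ Equiv.swap 0 1) = -τ I := fun I => by
    rw [hτ, tpow_mulVec_comp, ← Pi.neg_apply, ← Matrix.mulVec_neg]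
    congr 2
    funext J
    rw [Pi.neg_apply, hc, hc, neg_sub]
    rfl
  -- Half of `τ` with its last index turned into the upper index of a connection; antisymmetrizing
  -- it gives back `τ`. Surjectivity of `θ` allows `θ (B a)` to be prescribed.
  choose B hB using fun a : Fin n => hs fun i b c =>
    (w.2.1.mat⁻¹.mulVec fun d => τ ![a, b, c, d] / 2) i
  have hval : ∀ a b c d, w.2.1.val (WithLp.toLp 2 fun i => θ (B a) i b c)
      (EuclideanSpace.single d 1) = τ ![a, b, c, d] / 2 := fun a b c d => by
    rw [SymForm.val_comm, SymForm.val_single_left, hB]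
    change (w.2.1.mat.mulVec (w.2.1.mat⁻¹.mulVec fun d => τ ![a, b, c, d] / 2)) d = _
    rw [Matrix.mulVec_mulVec, Matrix.mul_nonsing_inv _ hw.2.det_ne_zero.isUnit, Matrix.one_mulVec]
  have h1 := (curvatureTensor N hθ).lin_eq_zero hw hv h0 h (S := fun a => (0, B a))
    (funext fun I => by
      rw [hc, hval, hval]
      have e1 : ![I 0, I 1, I 2, I 3] = I := by funext m; fin_cases m <;> rfl
      have e2 : ![I 1, I 0, I 2, I 3] = I ∘ Equiv.swap 0 1 := by funext m; fin_cases m <;> rfl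
      rw [e1, e2, hanti]
      change τ I / 2 - -τ I / 2 = τ I
      ring)
  have h2 : (WithLp.toLp 2 fun i => θ (ξ a).2 i b c - θ (ξ b).2 i a c : Base n) = 0 :=
    hw.2.nondegenerate fun d => by
      rw [← sum_smul_single d, SymForm.val_sum_left]
      refine Finset.sum_eq_zero fun d' _ => ?_
      have h3 := congrFun h1 ![a, b, c, d']
      rw [hc, ← SymForm.val_sub_left] at h3
      rw [SymForm.val_smul_left, SymForm.val_comm]
      exact mul_eq_zero_of_right _ h3
  exact sub_eq_zero.1 (congrArg (fun x : Base n => x i) h2)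

/-- The two curvatures allow the derivative index to be exchanged with the first and with the second
lower index; these transpositions generate all permutations of the three. -/
theorem isSymmetricVertical_of_fderiv_coeff_eq_zero {v : CoordSys n N → Base n → ℝ}
    {e : CoordSys n N} {w : ECoord n} (hw : w ∈ eDom p q e) (hv : ContinuousAt (v e) w.1)
    (h0 : v e w.1 ≠ 0) {ξ : Fin n → Fib n}
    (h : ∀ (k : ℕ) (T : JetTensor n k N) (S : Fin n → Fib n),
      fderiv ℝ (T.coeff v e) (w.1, w.2, S) (0, 0, ξ) = 0) : IsSymmetricVertical ξ := by
  have h1 := app_comm_of_fderiv_coeff_eq_zero hw hv h0 isIdOrTranspose_id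
    Function.surjective_id (h _ _)
  have h2 := app_comm_of_fderiv_coeff_eq_zero hw hv h0 isIdOrTranspose_transposeCLM
    (fun A => ⟨A.transpose, rfl⟩) (h _ _)
  have h3 : ∀ i a b c, (ξ a).2 i b c = (ξ b).2 i a c := h1
  have h4 : ∀ i a b c, (ξ a).2 i c b = (ξ b).2 i c a := h2
  exact ⟨fst_eq_zero_of_fderiv_coeff_eq_zero hw hv h0 (h _ _), h3, fun i a b c => by
    rw [h3 i a b c, h4 i b c a, h3 i a c b]⟩

variable [IsManifold (𝓡 n) ∞ N]

/-- The bracket has the same components on the whole fibre over `w`, and (P) makes it annihilate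
each Lagrangian `T.lagrangian` there; the orientation enters through these Lagrangians. -/
theorem EhresmannConnection.PropertyP.isSymmetricVertical {γ : EhresmannConnection n N p q}
    (hγ : γ.PropertyP) (hN : IsOrientable n N) {X : (x : N) → TangentSpace (𝓡 n) x}
    (hX : IsSmoothVectorField X) {e : CoordSys n N} {w : ECoord n} (hw : w ∈ eDom p q e) :
    IsSymmetricVertical (γ.liftDeviation e (localExpr X e) w) := by
  obtain ⟨v, hv, hv0, hvt⟩ := hN
  refine isSymmetricVertical_of_fderiv_coeff_eq_zero (v := v) hw
    ((hv e).continuousOn.continuousAt (e.1.open_target.mem_nhds hw.1)) (hv0 e _ hw.1)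
    fun k T S => ?_
  have hz : ((w.1, w.2, S) : JCoord n) ∈ jDom p q e := hw
  have hinv : IsInvariantDensity p q (T.lagrangian p q hv hv0 hvt).coeff :=
    T.isInvariantDensity hv hv0
  have h1 := (isInvariantDensity_iff fun e z hz =>
    (contDiffAt_covariantHamiltonian γ _ hz).differentiableAt (by simp)).1 (hγ _ hinv) X hX e _ hz
  rw [fderiv_covariantHamiltonian γ hinv hX hz, neg_eq_zero] at h1
  have h2 := γ.lieBracket_vert_prolong hz (contDiffAt_localExpr hX e hz.1)
  rw [jetLift, h2] at h1
  exact h1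

end VerticalDirections

/-! ### Symmetric vertical vectors are lifts of cubic vector fields -/

section Cubic

variable {n : ℕ}

/-- The trilinear map `(a, b, c) ↦ S_a(b, c)`. -/
noncomputable def alongAppCLM (ξ : Fin n → Fib n) : Base n →L[ℝ] Base n →L[ℝ] Base n →L[ℝ] Base n :=
  LinearMap.toContinuousLinearMap
    { toFun := fun a => LinearMap.toContinuousLinearMap
        { toFun := fun b => LinearMap.toContinuousLinearMap
            { toFun := fun c => (along ξ a).2.app b c
              map_add' := fun c c' => ConnForm.app_add_right _ _ _ _
              map_smul' := fun t c => ConnForm.app_smul_right _ _ _ _ }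
          map_add' := fun b b' => ContinuousLinearMap.ext fun c => ConnForm.app_add_left _ _ _ _
          map_smul' := fun t b => ContinuousLinearMap.ext fun c => ConnForm.app_smul_left _ _ _ _ }
      map_add' := fun a a' => ContinuousLinearMap.ext fun b => ContinuousLinearMap.ext fun c => by
        change (along ξ (a + a')).2.app b c = (along ξ a).2.app b c + (along ξ a').2.app b c
        rw [along_add, Prod.snd_add, ConnForm.app_add_form]
      map_smul' := fun t a => ContinuousLinearMap.ext fun b => ContinuousLinearMap.ext fun c => by
        change (along ξ (t • a)).2.app b c = t • (along ξ a).2.app b c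
        rw [along_smul, Prod.smul_snd, ConnForm.app_smul_form] }

theorem along_app_apply (ξ : Fin n → Fib n) (a b c : Base n) (i : Fin n) :
    (along ξ a).2.app b c i = ∑ l, ∑ j, ∑ k, (ξ l).2 i j k * (a l * b j * c k) := by
  simp only [ConnForm.app_apply, along, Prod.snd_sum, Finset.sum_apply, Prod.smul_snd,
    Pi.smul_apply, smul_eq_mul, Finset.sum_mul]
  rw [Finset.sum_congr rfl fun j _ => Finset.sum_comm, Finset.sum_comm]
  exact Finset.sum_congr rfl fun l _ => Finset.sum_congr rfl fun j _ =>
    Finset.sum_congr rfl fun k _ => by ring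

theorem IsSymmetricVertical.app_swap_left {ξ : Fin n → Fib n} (h : IsSymmetricVertical ξ)
    (a b c : Base n) : (along ξ a).2.app b c = (along ξ b).2.app a c := by
  ext i
  rw [along_app_apply, along_app_apply, Finset.sum_comm]
  exact Finset.sum_congr rfl fun l _ => Finset.sum_congr rfl fun j _ =>
    Finset.sum_congr rfl fun k _ => by rw [h.swap_left]; ring

theorem IsSymmetricVertical.app_swap_right {ξ : Fin n → Fib n} (h : IsSymmetricVertical ξ)
    (a b c : Base n) : (along ξ a).2.app b c = (along ξ a).2.app c b := by
  ext i
  rw [along_app_apply, along_app_apply]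
  refine Finset.sum_congr rfl fun l _ => ?_
  rw [Finset.sum_comm]
  exact Finset.sum_congr rfl fun j _ => Finset.sum_congr rfl fun k _ => by
    rw [h.swap_right]; ring

theorem hasFDerivAt_apply_sub {E F : Type*} [NormedAddCommGroup E] [NormedSpace ℝ E]
    [NormedAddCommGroup F] [NormedSpace ℝ F] (B : E →L[ℝ] F) (x y : E) :
    HasFDerivAt (fun y => B (y - x)) B y :=
  B.hasFDerivAt.comp y (hasFDerivAt_sub_const x)

theorem hasFDerivAt_cubic {E F : Type*} [NormedAddCommGroup E] [NormedSpace ℝ E]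
    [NormedAddCommGroup F] [NormedSpace ℝ F] {B : E →L[ℝ] E →L[ℝ] E →L[ℝ] F}
    (h1 : ∀ a b, B a b = B b a) (h2 : ∀ a b c, B a b c = B a c b) (x y : E) :
    HasFDerivAt (fun y => B (y - x) (y - x) (y - x)) ((3 : ℝ) • B (y - x) (y - x)) y ∧
    HasFDerivAt (fun y => (3 : ℝ) • B (y - x) (y - x)) ((6 : ℝ) • B (y - x)) y ∧
    HasFDerivAt (fun y => (6 : ℝ) • B (y - x)) ((6 : ℝ) • B) y := by
  have h0 : HasFDerivAt (fun y => y - x) (ContinuousLinearMap.id ℝ E) y := hasFDerivAt_sub_const x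
  have k1 : HasFDerivAt (fun y => B (y - x)) B y :=
    hasFDerivAt_apply_sub (F := E →L[ℝ] E →L[ℝ] F) B x y
  have k2 : HasFDerivAt (fun y => B (y - x) (y - x)) ((2 : ℝ) • B (y - x)) y := by
    refine (k1.clm_apply h0).congr_fderiv (ContinuousLinearMap.ext fun v => ?_)
    change B (y - x) v + B v (y - x) = (2 : ℝ) • B (y - x) v
    rw [h1 v, two_smul]
  have k3 : HasFDerivAt (fun y => B (y - x) (y - x) (y - x)) ((3 : ℝ) • B (y - x) (y - x)) y := by
    refine (k2.clm_apply h0).congr_fderiv (ContinuousLinearMap.ext fun v => ?_)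
    change B (y - x) (y - x) v + (2 : ℝ) • B (y - x) v (y - x) = (3 : ℝ) • B (y - x) (y - x) v
    rw [h2 _ v]
    module
  refine ⟨k3, (k2.const_smul (3 : ℝ)).congr_fderiv ?_,
    hasFDerivAt_apply_sub (F := E →L[ℝ] E →L[ℝ] F) ((6 : ℝ) • B) x y⟩
  rw [smul_smul]
  norm_num

theorem fderiv_of_eventuallyEq_cubic {E F : Type*} [NormedAddCommGroup E] [NormedSpace ℝ E]
    [NormedAddCommGroup F] [NormedSpace ℝ F] {B : E →L[ℝ] E →L[ℝ] E →L[ℝ] F}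
    (h1 : ∀ a b, B a b = B b a) (h2 : ∀ a b c, B a b c = B a c b) {u : E → F} {x : E}
    (hu : u =ᶠ[nhds x] fun y => B (y - x) (y - x) (y - x)) :
    u x = 0 ∧ fderiv ℝ u x = 0 ∧ fderiv ℝ (fderiv ℝ u) x = 0 ∧
      ∀ a b c, fderiv ℝ (fderiv ℝ (fderiv ℝ u)) x a b c = (6 : ℝ) • B a b c := by
  have key := hasFDerivAt_cubic h1 h2 x
  have f1 : fderiv ℝ u =ᶠ[nhds x] fun y => (3 : ℝ) • B (y - x) (y - x) :=
    hu.fderiv.trans (Filter.Eventually.of_forall fun y => (key y).1.fderiv)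
  have f2 : fderiv ℝ (fderiv ℝ u) =ᶠ[nhds x] fun y => (6 : ℝ) • B (y - x) :=
    f1.fderiv.trans (Filter.Eventually.of_forall fun y => (key y).2.1.fderiv)
  have d3 : fderiv ℝ (fderiv ℝ (fderiv ℝ u)) x = (6 : ℝ) • B :=
    f2.fderiv_eq.trans (key x).2.2.fderiv
  refine ⟨?_, ?_, ?_, fun a b c => ?_⟩
  · rw [hu.eq_of_nhds, sub_self, map_zero]
  · rw [f1.eq_of_nhds, sub_self, map_zero, smul_zero]
  · rw [f2.eq_of_nhds, sub_self, map_zero]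
    exact ContinuousLinearMap.ext fun a => ContinuousLinearMap.ext fun b => smul_zero (6 : ℝ)
  · rw [d3]; rfl

theorem app_zero_form (a b : Base n) : ConnForm.app (0 : ConnForm n) a b = 0 := by
  simpa using ConnForm.app_smul_form 0 (0 : ConnForm n) a b

/-- The field vanishes to second order at `z.1`, and third derivatives of `u` enter the prolongation
only in the derivatives of the connection, with a minus sign. The factor `-(1 / 6)` offsets this
sign and the `6` from differentiating a cubic thrice. -/
theorem prolong_eq_of_eventuallyEq_cubic {ξ : Fin n → Fib n} (h : IsSymmetricVertical ξ)
    {u : Base n → Base n} {z : JCoord n} (hu : ContDiffAt ℝ ∞ u z.1)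
    (h' : u =ᶠ[nhds z.1] fun y => alongAppCLM ((-(1 / 6 : ℝ)) • ξ) (y - z.1) (y - z.1) (y - z.1)) :
    prolong u (liftFib u) z = (0, 0, ξ) := by
  have hBa : ∀ a b c, alongAppCLM ((-(1 / 6 : ℝ)) • ξ) a b c
      = (-(1 / 6 : ℝ)) • (along ξ a).2.app b c := fun a b c => by
    change (along ((-(1 / 6 : ℝ)) • ξ) a).2.app b c = _
    rw [along_smul_left, Prod.smul_snd, ConnForm.app_smul_form]
  obtain ⟨d0, d1, d2, d3⟩ := fderiv_of_eventuallyEq_cubic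
    (fun a b => ContinuousLinearMap.ext fun c => by rw [hBa, hBa, h.app_swap_left])
    (fun a b c => by rw [hBa, hBa, h.app_swap_right]) h'
  have d1' : ∀ a, fderiv ℝ u z.1 a = 0 := fun a => by rw [d1]; rfl
  have d2' : ∀ a b, fderiv ℝ (fderiv ℝ u) z.1 a b = 0 := fun a b => by rw [d2]; rfl
  have hal : along z.2.2 (0 : Base n) = 0 := by simp [along]
  refine Prod.ext d0 (Prod.ext (Prod.ext (SymForm.ext_val fun a b => ?_)
    (ConnForm.ext_app fun a b => ?_)) (along_ext fun c => Prod.ext (SymForm.ext_val fun a b => ?_)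
      (ConnForm.ext_app fun a b => ?_)))
  · rw [prolong_val, d1', d1', val_zero_left, val_zero_right, add_zero, neg_zero]
    exact (val_zero_form a b).symm
  · rw [prolong_app hu, d1', d1', d1', d2', app_zero_left, app_zero_right]
    refine Eq.trans ?_ (app_zero_form a b).symm
    simp
  · have h1 : (along ξ c).1 = 0 := by simp [along, Prod.fst_sum, h.fst_eq_zero]
    rw [along_prolong_val hu, d1', d1', d1', d2', d2', hal]
    change _ = (along ξ c).1.val a b
    rw [h1]
    simp [val_zero_left, val_zero_right, val_zero_form]
  · rw [along_prolong_app hu, d1', d1', d1', d1', d2', d2', d2', d3, hBa, hal]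
    simp [app_zero_left, app_zero_right, app_zero_form, smul_smul]

end Cubic

/-! ### Linearity of the prolonged lift in the vector field -/

section Linearity

variable {n : ℕ}

theorem eventuallyEq_fderiv_add_smul {E F : Type*} [NormedAddCommGroup E] [NormedSpace ℝ E]
    [NormedAddCommGroup F] [NormedSpace ℝ F] {f g h : E → F} {x : E} {c : ℝ}
    (hf : ContDiffAt ℝ ∞ f x) (hg : ContDiffAt ℝ ∞ g x) (hh : h =ᶠ[nhds x] fun y => f y + c • g y) :
    fderiv ℝ h =ᶠ[nhds x] fun y => fderiv ℝ f y + c • fderiv ℝ g y := by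
  have ev : ∀ {f : E → F}, ContDiffAt ℝ ∞ f x → ∀ᶠ y in nhds x, DifferentiableAt ℝ f y :=
    fun hf => ((hf.of_le (m := 1) (by simp)).eventually (by simp)).mono fun y hy =>
      hy.differentiableAt (by simp)
  filter_upwards [hh.fderiv (𝕜 := ℝ), ev hf, ev hg] with y h1 h2 h3
  rw [h1]
  exact (h2.hasFDerivAt.add ((h3.hasFDerivAt (𝕜 := ℝ)).const_smul c)).fderiv

theorem prolong_add_smul {u u' : Base n → Base n} {z : JCoord n} (hu : ContDiffAt ℝ ∞ u z.1)
    (hu' : ContDiffAt ℝ ∞ u' z.1) (c : ℝ) :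
    prolong (u + c • u') (liftFib (u + c • u')) z
      = prolong u (liftFib u) z + c • prolong u' (liftFib u') z := by
  have hs : ContDiffAt ℝ ∞ (u + c • u') z.1 := hu.add (hu'.const_smul c)
  have d : ∀ {F : Type} [NormedAddCommGroup F] [NormedSpace ℝ F] {f : Base n → F},
      ContDiffAt ℝ ∞ f z.1 → ContDiffAt ℝ ∞ (fderiv ℝ f) z.1 := fun hf =>
    hf.fderiv_right (m := ∞) (by simp)
  have f1 := eventuallyEq_fderiv_add_smul (h := u + c • u') hu hu' (Filter.EventuallyEq.refl _ _)
  have f2 := eventuallyEq_fderiv_add_smul (d hu) (d hu') f1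
  have f3 := eventuallyEq_fderiv_add_smul (d (d hu)) (d (d hu')) f2
  have d1 := f1.eq_of_nhds
  have d2 := f2.eq_of_nhds
  have d3 := f3.eq_of_nhds
  refine Prod.ext rfl (Prod.ext (Prod.ext (SymForm.ext_val fun a b => ?_)
    (ConnForm.ext_app fun a b => ?_)) (along_ext fun v => Prod.ext (SymForm.ext_val fun a b => ?_)
      (ConnForm.ext_app fun a b => ?_)))
  · simp only [Prod.snd_add, Prod.fst_add, Prod.smul_snd, Prod.smul_fst, SymForm.val_add_form,
      SymForm.val_smul_form, prolong_val, d1, add_apply,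
      smul_apply, SymForm.val_add_left, SymForm.val_add_right,
      SymForm.val_smul_left, SymForm.val_smul_right]
    ring
  · simp only [Prod.snd_add, Prod.fst_add, Prod.smul_snd, Prod.smul_fst, ConnForm.app_add_form,
      ConnForm.app_smul_form, prolong_app hs, prolong_app hu, prolong_app hu', d1, d2,
      add_apply, smul_apply, ConnForm.app_add_left,
      ConnForm.app_add_right, ConnForm.app_smul_left, ConnForm.app_smul_right]
    module
  · simp only [Prod.snd_add, Prod.fst_add, Prod.smul_snd, Prod.smul_fst, along_add_left,
      along_smul_left, SymForm.val_add_form, SymForm.val_smul_form, along_prolong_val hs,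
      along_prolong_val hu, along_prolong_val hu', d1, d2, add_apply,
      smul_apply, SymForm.val_add_left, SymForm.val_add_right,
      SymForm.val_smul_left, SymForm.val_smul_right, along_add, along_smul]
    ring
  · simp only [Prod.snd_add, Prod.smul_snd, along_add_left, along_smul_left, ConnForm.app_add_form, ConnForm.app_smul_form, along_prolong_app hs,
      along_prolong_app hu, along_prolong_app hu', d1, d2, d3, add_apply,
      smul_apply, ConnForm.app_add_left, ConnForm.app_add_right,
      ConnForm.app_smul_left, ConnForm.app_smul_right, along_add, along_smul]
    module

end Linearity

/-! ### `𝒟` is pointwise a subspace and contains the symmetric vertical vectors -/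

section Extension

variable {n : ℕ} {N : Type*} [TopologicalSpace N] [ChartedSpace (Base n) N]

theorem CoordSys.mDifferentiable (e : CoordSys n N) :
    e.1.MDifferentiable (𝓡 n) 𝓘(ℝ, Base n) :=
  ⟨(contMDiffOn_of_mem_maximalAtlas e.2).mdifferentiableOn (by simp),
    (contMDiffOn_symm_of_mem_maximalAtlas e.2).mdifferentiableOn (by simp)⟩

theorem CoordSys.isInvertible_mfderiv (e : CoordSys n N) {y : N} (hy : y ∈ e.1.source) :
    (mfderiv (𝓡 n) 𝓘(ℝ, Base n) e.1 y).IsInvertible :=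
  ⟨e.mDifferentiable.mfderiv hy, rfl⟩

theorem ContinuousLinearMap.IsInvertible.apply_inverse {E F : Type*} [AddCommGroup E]
    [TopologicalSpace E] [Module ℝ E] [AddCommGroup F] [TopologicalSpace F] [Module ℝ F] {f : E →L[ℝ] F}
    (hf : f.IsInvertible) (v : F) : f (f.inverse v) = v := by
  obtain ⟨A, rfl⟩ := hf
  rw [ContinuousLinearMap.inverse_equiv]
  exact A.apply_symm_apply v

variable [IsManifold (𝓡 n) ∞ N]

theorem IsSmoothVectorField.zero :
    IsSmoothVectorField (n := n) (N := N) (0 : (x : N) → TangentSpace (𝓡 n) x) :=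
  Bundle.contMDiff_zeroSection ℝ (TangentSpace (𝓡 n) : N → Type _)

theorem IsSmoothVectorField.add_smul {X Y : (x : N) → TangentSpace (𝓡 n) x}
    (hX : IsSmoothVectorField X) (hY : IsSmoothVectorField Y) (c : ℝ) :
    IsSmoothVectorField (X + c • Y) :=
  ContMDiff.add_section hX (ContMDiff.const_smul_section hY)

theorem jetLift_add_smul {X Y : (x : N) → TangentSpace (𝓡 n) x}
    (hX : IsSmoothVectorField X) (hY : IsSmoothVectorField Y) (c : ℝ) {e : CoordSys n N}
    {z : JCoord n} (hz : z.1 ∈ e.1.target) :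
    jetLift (X + c • Y) e z = jetLift X e z + c • jetLift Y e z := by
  have h : localExpr (X + c • Y) e = localExpr X e + c • localExpr Y e := by
    funext x
    change mfderiv (𝓡 n) 𝓘(ℝ, Base n) e.1 (e.1.symm x) (X (e.1.symm x) + c • Y (e.1.symm x)) = _
    rw [map_add, map_smul]
    rfl
  rw [jetLift, h]
  exact prolong_add_smul (contDiffAt_localExpr hX e hz) (contDiffAt_localExpr hY e hz) c

/-- The invariance distribution at a point is a linear subspace. -/
def invSubspace (e : CoordSys n N) {z : JCoord n} (hz : z.1 ∈ e.1.target) :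
    Submodule ℝ (JCoord n) where
  carrier := invDistribution e z
  add_mem' := by
    rintro _ _ ⟨X, hX, rfl⟩ ⟨Y, hY, rfl⟩
    exact ⟨_, hX.add_smul hY 1, by rw [jetLift_add_smul hX hY 1 hz, one_smul]⟩
  -- Only combinations `X + c • Y` are at hand: zero is written as `0 + (-1) • 0`, and below `c • X`
  -- as `X + (c - 1) • X`.
  zero_mem' := ⟨_, IsSmoothVectorField.zero.add_smul IsSmoothVectorField.zero (-1), by
    rw [jetLift_add_smul IsSmoothVectorField.zero IsSmoothVectorField.zero _ hz]
    module⟩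
  smul_mem' := by
    rintro c _ ⟨X, hX, rfl⟩
    exact ⟨_, hX.add_smul hX (c - 1), by rw [jetLift_add_smul hX hX _ hz]; module⟩

open Classical in
/-- A vector field with compact support in a coordinate domain extends by zero. -/
theorem exists_isSmoothVectorField_localExpr [T2Space N] (e : CoordSys n N) {u : Base n → Base n}
    (hu : ContDiff ℝ ∞ u) (hc : HasCompactSupport u) (hs : tsupport u ⊆ e.1.target) :
    ∃ X : (x : N) → TangentSpace (𝓡 n) x, IsSmoothVectorField X ∧
      ∀ x ∈ e.1.target, localExpr X e x = u x := by
  refine ⟨fun y => if y ∈ e.1.source then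
    VectorField.mpullback (𝓡 n) 𝓘(ℝ, Base n) e.1 u y else 0, fun y => ?_, fun x hx => ?_⟩
  · by_cases hy : y ∈ e.1.source
    · have h1 : ContMDiffAt (𝓡 n) (𝓡 n).tangent ∞ (fun y => (⟨y, VectorField.mpullback (𝓡 n)
          𝓘(ℝ, Base n) e.1 u y⟩ : TangentBundle (𝓡 n) N)) y := by
        refine ContMDiffAt.mpullback_vectorField_preimage (n := ∞) ?_
          ((contMDiffOn_of_mem_maximalAtlas e.2).contMDiffAt (e.1.open_source.mem_nhds hy))
          (e.isInvertible_mfderiv hy) (by simp)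
        exact contMDiffAt_vectorSpace_iff_contDiffAt.2 hu.contDiffAt
      refine h1.congr_of_eventuallyEq ?_
      filter_upwards [e.1.open_source.mem_nhds hy] with y' hy'
      rw [if_pos hy']
    -- In a Hausdorff manifold the image of the compact support is closed, so the extension vanishes
    -- near every point outside the chart.
    · have hcl : IsClosed (e.1.symm '' tsupport u) :=
        (hc.isCompact.image_of_continuousOn (e.1.continuousOn_symm.mono hs)).isClosed
      have hy' : y ∉ e.1.symm '' tsupport u := by
        rintro ⟨x, hx, rfl⟩
        exact hy (e.1.map_target (hs hx))
      refine (IsSmoothVectorField.zero (n := n) (N := N) y).congr_of_eventuallyEq ?_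
      filter_upwards [hcl.isOpen_compl.mem_nhds hy'] with y' hy'
      change (⟨y', _⟩ : TangentBundle (𝓡 n) N) = ⟨y', 0⟩
      congr 1
      split_ifs with h
      · have h0 : u (e.1 y') = 0 := by
          by_contra h0
          exact hy' ⟨e.1 y', subset_tsupport u h0, e.1.left_inv h⟩
        exact (congrArg (mfderiv (𝓡 n) 𝓘(ℝ, Base n) e.1 y').inverse h0).trans (map_zero _)
      · rfl
  · have hy := e.1.map_target hx
    rw [localExpr, if_pos hy]
    exact ((e.isInvertible_mfderiv hy).apply_inverse (u (e.1 (e.1.symm x)))).trans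
      (congrArg u (e.1.right_inv hx))

/-- The cubic field is multiplied by a bump function equal to `1` near `z.1`, which does not affect
its derivatives there, and then extended by zero to `N`. -/
theorem IsSymmetricVertical.mem_invDistribution [T2Space N] {ξ : Fin n → Fib n}
    (h : IsSymmetricVertical ξ) {e : CoordSys n N} {z : JCoord n} (hz : z.1 ∈ e.1.target) :
    ((0, 0, ξ) : JCoord n) ∈ invDistribution e z := by
  obtain ⟨r, hr, hrs⟩ := Metric.nhds_basis_closedBall.mem_iff.1 (e.1.open_target.mem_nhds hz)
  let ρ : ContDiffBump z.1 := ⟨r / 2, r, half_pos hr, half_lt_self hr⟩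
  let B := alongAppCLM ((-(1 / 6 : ℝ)) • ξ)
  have hsub : tsupport (fun y => ρ y • B (y - z.1) (y - z.1) (y - z.1)) ⊆ tsupport ρ :=

    closure_mono fun y hy h0 => hy (by
      change ρ y • _ = 0
      rw [h0, zero_smul])
  obtain ⟨X, hX, hXu⟩ := exists_isSmoothVectorField_localExpr e
    (u := fun y => ρ y • B (y - z.1) (y - z.1) (y - z.1))
    (ρ.contDiff.smul (by fun_prop))
    (ρ.hasCompactSupport.mono' ((subset_tsupport _).trans hsub))
    (hsub.trans (ρ.tsupport_eq.trans_subset hrs))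
  refine ⟨X, hX, (prolong_eq_of_eventuallyEq_cubic h (contDiffAt_localExpr hX e hz) ?_).symm⟩
  filter_upwards [e.1.open_target.mem_nhds hz, ρ.eventuallyEq_one] with y hy hρ
  rw [hXu y hy, hρ]
  exact one_smul _ _

end Extension

/-! ### Skew endomorphisms have trace zero -/

section Skew

variable {n p q : ℕ}

theorem trace_rowMat (M : Base n →ₗ[ℝ] Base n) : (rowMat M).trace = LinearMap.trace ℝ (Base n) M := by
  rw [LinearMap.trace_eq_matrix_trace ℝ (EuclideanSpace.basisFun (Fin n) ℝ).toBasis,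
    ← Matrix.trace_transpose]
  congr 1

theorem HasSignature.trace_eq_zero {g : SymForm n} (hg : HasSignature p q g)
    {P : Base n →ₗ[ℝ] Base n} (hP : ∀ a b, g.val (P a) b + g.val a (P b) = 0) :
    LinearMap.trace ℝ (Base n) P = 0 := by
  have hu : IsUnit g.mat.det := hg.det_ne_zero.isUnit
  have h1 : rowMat P * g.mat + g.mat * (rowMat P).transpose = 0 := by
    ext i j
    have h := hP (EuclideanSpace.single i 1) (EuclideanSpace.single j 1)
    rw [SymForm.val_comm, SymForm.val_single_left, SymForm.val_single_left] at h
    rw [Matrix.zero_apply, ← h, Matrix.add_apply]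
    congr 1
    simp only [Matrix.mul_apply, Matrix.mulVec, dotProduct, rowMat, Matrix.of_apply,
      SymForm.mat_apply]
    exact Finset.sum_congr rfl fun k _ => by rw [Sym2.eq_swap, mul_comm]
  -- Skewness makes the matrix of `P` conjugate to minus its transpose, so its trace equals its own
  -- negative.
  have h2 : rowMat P = -(g.mat * (rowMat P).transpose * g.mat⁻¹) := by
    rw [← Matrix.neg_mul, ← eq_neg_of_add_eq_zero_left h1, Matrix.mul_assoc,
      Matrix.mul_nonsing_inv _ hu, Matrix.mul_one]
  have h3 := congrArg Matrix.trace h2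
  rw [Matrix.trace_neg, Matrix.mul_assoc, Matrix.trace_mul_comm, Matrix.mul_assoc,
    Matrix.nonsing_inv_mul _ hu, Matrix.mul_one, Matrix.trace_transpose, trace_rowMat] at h3
  linarith

end Skew

/-! ### The two implications -/

section Equivalence

variable {n : ℕ} {N : Type*} [TopologicalSpace N] [ChartedSpace (Base n) N]
  [IsManifold (𝓡 n) ∞ N] {p q : ℕ}

theorem EhresmannConnection.propertyP_of_jetBracket {γ : EhresmannConnection n N p q}
    (h : ∀ Y ∈ sectionsInvDistribution n N p q,
      jetBracket γ.vert Y ∈ sectionsInvDistribution n N p q) : γ.PropertyP := by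
  intro Λ hΛ
  refine (isInvariantDensity_iff fun e z hz =>
    (contDiffAt_covariantHamiltonian γ Λ hz).differentiableAt (by simp)).2 fun X hX e z hz => ?_
  rw [fderiv_covariantHamiltonian γ hΛ hX hz, neg_eq_zero]
  obtain ⟨X', hX', hb⟩ := (h (jetLift X) ⟨isVectorFieldOnJet_jetLift hX,
    fun e z _ => ⟨X, hX, rfl⟩⟩).2 e z hz
  change VectorField.lieBracket ℝ (γ.vert e) (jetLift X e) z = _ at hb
  have h1 := (isInvariantDensity_iff fun e z hz =>
    (Λ.contDiffAt hz).differentiableAt (by simp)).1 hΛ X' hX' e z hz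
  have h2 : (jetLift X' e z).2.1 = 0 := by
    rw [← hb, jetLift, γ.lieBracket_vert_prolong hz (contDiffAt_localExpr hX e hz.1)]
  -- The bracket has no component along `E`, so the lift of `X'` fixes the metric to first order.
  -- This makes the derivative of `X'` skew and removes the divergence term from `h1`.
  have h3 : LinearMap.trace ℝ (Base n) (fderiv ℝ (localExpr X' e) z.1).toLinearMap = 0 :=
    hz.2.trace_eq_zero fun a b => by
      have h4 := prolong_val (localExpr X' e) z a b
      change (jetLift X' e z).2.1.1.val a b = _ at h4
      rw [h2] at h4
      exact neg_eq_zero.1 (h4.symm.trans (val_zero_form a b))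
  rwa [h3, zero_mul, add_zero, ← hb] at h1

/-- Transport of a prolonged lift along the flow of `D^γ`. -/
theorem EhresmannConnection.jetLift_add_smul_vert (γ : EhresmannConnection n N p q)
    {X : (x : N) → TangentSpace (𝓡 n) x} (hX : IsSmoothVectorField X) {e : CoordSys n N}
    {z : JCoord n} (hz : z ∈ jDom p q e) (t : ℝ) :
    let V := jetLift X e (z + t • γ.vert e z)
    V + t • (V - fderiv ℝ (γ.vert e) z V)
      = (1 + t) • jetLift X e z + t • (0, 0, γ.liftDeviation e (localExpr X e) z.toE) := by
  intro V
  have hd : DifferentiableAt ℝ (jetLift X e) z :=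
    (contDiffAt_jetLift hX hz.1).differentiableAt (by simp)
  set W := fderiv ℝ (jetLift X e) z (γ.vert e z) with hW
  have hV : V = jetLift X e z + t • W := by
    rw [hW, EhresmannConnection.vert, jetLift, fderiv_prolong_vertical hd]
    exact prolong_add_smul_vertical _ _ z _ t
  have hb : W - fderiv ℝ (γ.vert e) z (jetLift X e z)
      = (0, 0, γ.liftDeviation e (localExpr X e) z.toE) :=
    γ.lieBracket_vert_prolong hz (contDiffAt_localExpr hX e hz.1)
  -- On vertical vectors the derivative of `D^γ` is the identity, so the terms quadratic in `t`
  -- cancel.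
  have hWv : fderiv ℝ (γ.vert e) z W = W := by
    have hW' : W = (0, 0, W.2.2) := by
      have h : W = _ := fderiv_prolong_vertical hd _
      rw [h]
    rw [hW', γ.fderiv_vert hz]
    refine Prod.ext rfl (Prod.ext rfl (funext fun i => ?_))
    change fderiv ℝ _ z.toE 0 + W.2.2 i = W.2.2 i
    rw [map_zero, zero_add]
  rw [← hb, hV, map_add, map_smul, hWv]
  module

theorem Submodule.mem_of_hasDerivAt {E : Type*} [NormedAddCommGroup E] [NormedSpace ℝ E]
    [FiniteDimensional ℝ E] (S : Submodule ℝ E) {f : ℝ → E} {f' : E} {t : ℝ}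
    (hf : HasDerivAt f f' t) (h : ∀ t, f t ∈ S) : f' ∈ S :=
  S.closed_of_finiteDimensional.mem_of_tendsto (hasDerivAt_iff_tendsto_slope_zero.1 hf)
    (Filter.Eventually.of_forall fun _ => S.smul_mem _ (S.sub_mem (h _) (h _)))

/-- The field `X` representing `Y` may vary arbitrarily from point to point, so it cannot be
differentiated. Instead the bracket is obtained as a limit inside the single closed subspace `𝒟_z`.
-/
theorem EhresmannConnection.PropertyP.jetBracket_mem [T2Space N] {γ : EhresmannConnection n N p q}
    (hγ : γ.PropertyP) (hN : IsOrientable n N) {Y : CoordSys n N → JCoord n → JCoord n}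
    (hY : Y ∈ sectionsInvDistribution n N p q) :
    jetBracket γ.vert Y ∈ sectionsInvDistribution n N p q := by
  refine ⟨(isVectorFieldOnJet_vert γ).jetBracket hY.1, fun e z hz => ?_⟩
  set A := fderiv ℝ (γ.vert e) z with hA
  have h1 := (hY.1.differentiableAt hz).hasDerivAt_line (γ.vert e z)
  -- The correction `t • (V - A V)` brings the values of `Y` back into `𝒟_z`, and the derivative at
  -- `0` is the bracket plus `Y e z`.
  have h2 : HasDerivAt (fun t : ℝ => Y e (z + t • γ.vert e z)
      + t • (Y e (z + t • γ.vert e z) - A (Y e (z + t • γ.vert e z))))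
      (fderiv ℝ (Y e) z (γ.vert e z) + (Y e z - A (Y e z))) 0 := by
    refine (h1.add ((hasDerivAt_id (0 : ℝ)).smul
      (h1.sub (A.hasFDerivAt.comp_hasDerivAt 0 h1)))).congr_deriv ?_
    simp
  have h3 := (invSubspace e hz.1).mem_of_hasDerivAt h2 fun t => by
    have hzt : (z + t • γ.vert e z).toE = z.toE := by
      refine Prod.ext ?_ ?_ <;> simp [JCoord.toE, EhresmannConnection.vert]
    obtain ⟨X, hX, hYX⟩ := hY.2 e (z + t • γ.vert e z)
      (show (z + t • γ.vert e z).toE ∈ eDom p q e by rw [hzt]; exact hz)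
    rw [hYX, hA, γ.jetLift_add_smul_vert hX hz]
    exact Submodule.add_mem _ (Submodule.smul_mem _ _ ⟨X, hX, rfl⟩) (Submodule.smul_mem _ _
      ((hγ.isSymmetricVertical hN hX hz).mem_invDistribution hz.1))
  have h4 := (invSubspace e hz.1).sub_mem h3 (hY.2 e z hz)
  have h5 : jetBracket γ.vert Y e z
      = fderiv ℝ (Y e) z (γ.vert e z) + (Y e z - A (Y e z)) - Y e z := by
    rw [jetBracket, VectorField.lieBracket]
    module
  rw [h5]
  exact h4

end Equivalence

theorem mainTheorem7 (n p q : ℕ) (hpq : p + q = n) (N : Type*) [TopologicalSpace N] [T2Space N]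
    [SecondCountableTopology N] [ConnectedSpace N] [ChartedSpace (Base n) N]
    [IsManifold (𝓡 n) ∞ N] (hN : IsOrientable n N) (γ : EhresmannConnection n N p q) :
    γ.PropertyP ↔
      ∀ Y ∈ sectionsInvDistribution n N p q,
        jetBracket γ.vert Y ∈ sectionsInvDistribution n N p q :=
  ⟨fun hγ _ hY => hγ.jetBracket_mem hN hY, EhresmannConnection.propertyP_of_jetBracket⟩
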